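/- **Corollary 7.** Let $d\ge 2$ and let $\mathcal H=\mathbb C^d$ with its computational basis. Let $\mathscr D^{\mathrm R}(\mathcal H)$ be the set of density matrices on $\mathcal H$ with real entries in this basis, and $\mathscr P^{\mathrm R}(\mathcal H)$ the set of pure states in it. For a set $\mathscr S$ of states on $\mathcal H$, a *masker* for $\mathscr S$ is an isometry $M:\mathcal H\to\mathcal H_A\otimes\mathcal H_B$ into a bipartite system of arbitrary finite dimension such that neither of the reduced states $\operatorname{tr}_B(M\rho M^\dagger)$, $\operatorname{tr}_A(M\rho M^\dagger)$ depends on $\rho\in\mathscr S$; it is *real* if $M\rho M^\dagger$ is a real density matrix (in the product of the computational bases) for every $\rho\in\mathscr S$. An *entanglement monotone* $E$ is a real-valued function of the states of all finite-dimensional bipartite systems that does not increase under local operations and classical communication (LOCC). The *entanglement of masking* of $\mathscr S$ is $$E(\mathscr S)=\min_M\ \max_{\rho\in\mathscr S}E(M\rho M^\dagger),$$ with the minimum over all maskers $M$ for $\mathscr S$; $E^{\mathrm R}(\mathscr S)$ is defined in the same way with the minimum over all real maskers. Let $$\kappa(d)=2^{\lfloor (d-1)/2\rfloor},\qquad \tilde\kappa(d)=\max\{\kappa(d),2\},\qquad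 \kappa^{\mathrm R}(d)=\begin{cases}\kappa(d), & d\equiv 0,1,7 \pmod 8,\\ 2\kappa(d), & d\equiv 2,3,4,5,6 \pmod 8,\end{cases}$$ and let $|\Phi(m)\rangle$ denote any maximally entangled state of Schmidt rank $m$. Then, for every entanglement monotone $E$, the minima and maxima above exist and $$E(\mathscr D^{\mathrm R}(\mathcal H))=E(\mathscr P^{\mathrm R}(\mathcal H))=E(|\Phi(\tilde\kappa(d))\rangle),\qquad E^{\mathrm R}(\mathscr D^{\mathrm R}(\mathcal H))=E^{\mathrm R}(\mathscr P^{\mathrm R}(\mathcal H))=E(|\Phi(\kappa^{\mathrm R}(d))\rangle).$$ In particular, let $E_{\mathrm C}$ be the entanglement cost: $E_{\mathrm C}(\rho)$ is the infimum of the rates $r\ge 0$ for which there are LOCC maps $\Lambda_n$ with $\|\Lambda_n(|\Phi(2^{\lfloor rn\rfloor})\rangle\langle\Phi(2^{\lfloor rn\rfloor})|)-\rho^{\otimes n}\|_1\to 0$ as $n\to\infty$. Then $$E_{\mathrm C}(\mathscr D^{\mathrm R}(\mathcal H))=E_{\mathrm C}(\mathscr P^{\mathrm R}(\mathcal H))=\begin{cases}1,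 & d=2,\\ \lfloor (d-1)/2\rfloor, & d\ge 3,\end{cases}$$ $$E_{\mathrm C}^{\mathrm R}(\mathscr D^{\mathrm R}(\mathcal H))=E_{\mathrm C}^{\mathrm R}(\mathscr P^{\mathrm R}(\mathcal H))=\begin{cases}\lfloor (d-1)/2\rfloor, & d\equiv 0,1,7 \pmod 8,\\ \lfloor (d-1)/2\rfloor+1, & d\equiv 2,3,4,5,6 \pmod 8.\end{cases}$$ -/

import Mathlib

namespace RealMasking

open scoped ComplexOrder Kronecker Matrix Topology

noncomputable section

/-! ### States

A finite-dimensional Hilbert space with its computational basis is `ι → ℂ` for a finite type `ι`;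
the bipartite space of `A` and `B` has the product basis, indexed by `A × B`. -/

/-- Density matrices. -/
def IsDensity {ι : Type} [Fintype ι] (ρ : Matrix ι ι ℂ) : Prop :=
  ρ.PosSemidef ∧ ρ.trace = 1

/-- The operator `|ψ⟩⟨ψ|`. -/
def ketBra {ι : Type} (ψ : ι → ℂ) : Matrix ι ι ℂ :=
  Matrix.vecMulVec ψ (star ψ)

/-- Pure states: the density matrices of the form `|ψ⟩⟨ψ|` (rank-one projectors). -/
def IsPure {ι : Type} [Fintype ι] (ρ : Matrix ι ι ℂ) : Prop :=
  IsDensity ρ ∧ ∃ ψ : ι → ℂ, ρ = ketBra ψ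

/-- The set of real states: density matrices with real entries in the computational basis. -/
def realStates (ι : Type) [Fintype ι] : Set (Matrix ι ι ℂ) :=
  {ρ | IsDensity ρ ∧ ∀ i j, (ρ i j).im = 0}

/-- The set of real pure states. -/
def realPureStates (ι : Type) [Fintype ι] : Set (Matrix ι ι ℂ) :=
  {ρ | ρ ∈ realStates ι ∧ IsPure ρ}

/-- Partial trace over the second factor: the reduced state of `A`. -/
def traceB {A B : Type} [Fintype B] (ρ : Matrix (A × B) (A × B) ℂ) : Matrix A A ℂ :=
  Matrix.of fun a a' => ∑ b, ρ (a, b) (a', b)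

/-- Partial trace over the first factor: the reduced state of `B`. -/
def traceA {A B : Type} [Fintype A] (ρ : Matrix (A × B) (A × B) ℂ) : Matrix B B ℂ :=
  Matrix.of fun b b' => ∑ a, ρ (a, b) (a, b')

/-- `Ψ` is a maximally entangled ket of Schmidt rank `m`, that is,
`Ψ = m ^ (-1/2) ∑ j, |u_j⟩ ⊗ |v_j⟩` for orthonormal families `u_1, …, u_m` and `v_1, …, v_m`
(the columns of the matrices `u` and `v`). -/
def IsMaxEntangled {A B : Type} [Fintype A] [Fintype B] (m : ℕ) (Ψ : A × B → ℂ) : Prop :=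
  ∃ (u : Matrix A (Fin m) ℂ) (v : Matrix B (Fin m) ℂ), uᴴ * u = 1 ∧ vᴴ * v = 1 ∧
    ∀ a b, Ψ (a, b) = ((1 / √(m : ℝ) : ℝ) : ℂ) * ∑ j, u a j * v b j

/-- The standard maximally entangled ket `m ^ (-1/2) ∑ j, |j j⟩` of Schmidt rank `m`. -/
def stdMaxEntangled (m : ℕ) : Fin m × Fin m → ℂ :=
  fun p => if p.1 = p.2 then ((1 / √(m : ℝ) : ℝ) : ℂ) else 0

/-! ### Local operations and classical communication -/

/-- `IsLOCC Λ`: the map `Λ`, from operators on `A ⊗ B` to operators on `A' ⊗ B'`, is implemented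
by an LOCC protocol with finitely many rounds. Either the protocol is over, or one party applies a
local quantum measurement with Kraus operators `K i`, announces the outcome `i`, and both parties
go on with an LOCC protocol that depends on `i`; the outcomes are forgotten at the end.
Local channels (isometries, partial traces, ...) are measurements whose outcome is not used. -/
inductive IsLOCC {A' B' : Type} [Fintype A'] [DecidableEq A'] [Fintype B'] [DecidableEq B'] :
    {A B : Type} → [Fintype A] → [DecidableEq A] → [Fintype B] → [DecidableEq B] →
    (Matrix (A × B) (A × B) ℂ → Matrix (A' × B') (A' × B') ℂ) → Prop
  | done : IsLOCC (A := A') (B := B') fun ρ => ρ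
  | alice {A B : Type} [Fintype A] [DecidableEq A] [Fintype B] [DecidableEq B]
      {ι : Type} [Fintype ι] (A₁ : ι → Type) [∀ i, Fintype (A₁ i)] [∀ i, DecidableEq (A₁ i)]
      (K : ∀ i, Matrix (A₁ i) A ℂ) (hK : ∑ i, (K i)ᴴ * K i = 1)
      (Λ : ∀ i, Matrix (A₁ i × B) (A₁ i × B) ℂ → Matrix (A' × B') (A' × B') ℂ)
      (hΛ : ∀ i, IsLOCC (Λ i)) :
      IsLOCC (A := A) (B := B) fun ρ =>
        ∑ i, Λ i ((K i ⊗ₖ (1 : Matrix B B ℂ)) * ρ * (K i ⊗ₖ (1 : Matrix B B ℂ))ᴴ)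
  | bob {A B : Type} [Fintype A] [DecidableEq A] [Fintype B] [DecidableEq B]
      {ι : Type} [Fintype ι] (B₁ : ι → Type) [∀ i, Fintype (B₁ i)] [∀ i, DecidableEq (B₁ i)]
      (K : ∀ i, Matrix (B₁ i) B ℂ) (hK : ∑ i, (K i)ᴴ * K i = 1)
      (Λ : ∀ i, Matrix (A × B₁ i) (A × B₁ i) ℂ → Matrix (A' × B') (A' × B') ℂ)
      (hΛ : ∀ i, IsLOCC (Λ i)) :
      IsLOCC (A := A) (B := B) fun ρ =>
        ∑ i, Λ i (((1 : Matrix A A ℂ) ⊗ₖ K i) * ρ * ((1 : Matrix A A ℂ) ⊗ₖ K i)ᴴ)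

/-! ### Entanglement monotones -/

/-- Real-valued functions of the states of all bipartite systems `ℂ^m ⊗ ℂ^n`. -/
abbrev BipartiteFunctional : Type :=
  ∀ m n : ℕ, Matrix (Fin m × Fin n) (Fin m × Fin n) ℂ → ℝ

/-- An entanglement monotone does not increase under LOCC. No convexity, normalization or
monotonicity on average is required. -/
def IsEntanglementMonotone (E : BipartiteFunctional) : Prop :=
  ∀ (m n m' n' : ℕ)
    (Λ : Matrix (Fin m × Fin n) (Fin m × Fin n) ℂ → Matrix (Fin m' × Fin n') (Fin m' × Fin n') ℂ),
    IsLOCC Λ → ∀ ρ, IsDensity ρ → E m' n' (Λ ρ) ≤ E m n ρ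

/-! ### Maskers and the entanglement of masking -/

/-- The isometry `M : ℂ^d → ℂ^m ⊗ ℂ^n` masks the set `S`: both reduced states of `M ρ M†` are
the same for all `ρ ∈ S`. -/
def IsMasker {d m n : ℕ} (S : Set (Matrix (Fin d) (Fin d) ℂ))
    (M : Matrix (Fin m × Fin n) (Fin d) ℂ) : Prop :=
  Mᴴ * M = 1 ∧ ∃ (τA : Matrix (Fin m) (Fin m) ℂ) (τB : Matrix (Fin n) (Fin n) ℂ),
    ∀ ρ ∈ S, traceB (M * ρ * Mᴴ) = τA ∧ traceA (M * ρ * Mᴴ) = τB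

/-- A masker for `S` is real if it maps `S` to real states. -/
def IsRealMasker {d m n : ℕ} (S : Set (Matrix (Fin d) (Fin d) ℂ))
    (M : Matrix (Fin m × Fin n) (Fin d) ℂ) : Prop :=
  IsMasker S M ∧ ∀ ρ ∈ S, M * ρ * Mᴴ ∈ realStates (Fin m × Fin n)

/-- `E(S, M) = e`, where `E(S, M)` is the maximum of `E(M ρ M†)` over `ρ ∈ S`. -/
def MaskerEntanglementEq (E : BipartiteFunctional) {d m n : ℕ}
    (S : Set (Matrix (Fin d) (Fin d) ℂ)) (M : Matrix (Fin m × Fin n) (Fin d) ℂ) (e : ℝ) : Prop :=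
  IsGreatest {x | ∃ ρ ∈ S, x = E m n (M * ρ * Mᴴ)} e

/-- `E(S) = e`, where the entanglement of masking `E(S)` is the minimum of `E(S, M)` over all
maskers `M` for `S`, into bipartite systems of arbitrary dimensions. The maximum that defines
`E(S, M)` is asserted to exist for every masker, and the minimum is asserted to exist. -/
def MaskingEntanglementEq (E : BipartiteFunctional) {d : ℕ}
    (S : Set (Matrix (Fin d) (Fin d) ℂ)) (e : ℝ) : Prop :=
  (∀ (m n : ℕ) (M : Matrix (Fin m × Fin n) (Fin d) ℂ), IsMasker S M →
    ∃ x, MaskerEntanglementEq E S M x) ∧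
  IsLeast {x | ∃ (m n : ℕ) (M : Matrix (Fin m × Fin n) (Fin d) ℂ),
    IsMasker S M ∧ MaskerEntanglementEq E S M x} e

/-- `E^R(S) = e`: the same with the minimum over all real maskers for `S`. -/
def RealMaskingEntanglementEq (E : BipartiteFunctional) {d : ℕ}
    (S : Set (Matrix (Fin d) (Fin d) ℂ)) (e : ℝ) : Prop :=
  (∀ (m n : ℕ) (M : Matrix (Fin m × Fin n) (Fin d) ℂ), IsRealMasker S M →
    ∃ x, MaskerEntanglementEq E S M x) ∧
  IsLeast {x | ∃ (m n : ℕ) (M : Matrix (Fin m × Fin n) (Fin d) ℂ),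
    IsRealMasker S M ∧ MaskerEntanglementEq E S M x} e

/-! ### Entanglement cost -/

/-- The trace norm `tr √(X† X)`, the sum of the singular values of `X`. -/
def traceNorm {ι : Type} [Fintype ι] [DecidableEq ι] (X : Matrix ι ι ℂ) : ℝ :=
  ∑ i, √((Matrix.isHermitian_conjTranspose_mul_self X).eigenvalues i)

/-- The `n`-fold tensor power of a bipartite operator, as an operator on `A^n ⊗ B^n`. -/
def tensorPower {A B : Type} (ρ : Matrix (A × B) (A × B) ℂ) (n : ℕ) :
    Matrix ((Fin n → A) × (Fin n → B)) ((Fin n → A) × (Fin n → B)) ℂ :=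
  Matrix.of fun x y => ∏ k, ρ (x.1 k, x.2 k) (y.1 k, y.2 k)

/-- `r` is an achievable rate for `ρ`: LOCC protocols turn maximally entangled states of Schmidt
rank `2 ^ ⌊r n⌋` into states whose trace distance from `ρ^{⊗ n}` tends to `0`. -/
def IsAchievableRate {A B : Type} [Fintype A] [DecidableEq A] [Fintype B] [DecidableEq B]
    (ρ : Matrix (A × B) (A × B) ℂ) (r : ℝ) : Prop :=
  0 ≤ r ∧ ∃ Λ : ∀ n : ℕ,
      Matrix (Fin (2 ^ ⌊r * n⌋₊) × Fin (2 ^ ⌊r * n⌋₊)) (Fin (2 ^ ⌊r * n⌋₊) × Fin (2 ^ ⌊r * n⌋₊)) ℂ →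
      Matrix ((Fin n → A) × (Fin n → B)) ((Fin n → A) × (Fin n → B)) ℂ,
    (∀ n, IsLOCC (Λ n)) ∧
    Filter.Tendsto
      (fun n => traceNorm (Λ n (ketBra (stdMaxEntangled (2 ^ ⌊r * n⌋₊))) - tensorPower ρ n))
      Filter.atTop (𝓝 0)

/-- The entanglement cost: the infimum of the achievable rates. -/
def entanglementCost : BipartiteFunctional :=
  fun _ _ ρ => sInf {r : ℝ | IsAchievableRate ρ r}

/-! ### The Hurwitz-Radon numbers -/

/-- `κ(d) = 2 ^ ⌊(d - 1) / 2⌋`. -/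
def kappa (d : ℕ) : ℕ := 2 ^ ((d - 1) / 2)

/-- `κ^R(d)` is `κ(d)` if `d = 0, 1, 7 mod 8` and `2 κ(d)` otherwise. -/
def kappaReal (d : ℕ) : ℕ :=
  if d % 8 = 0 ∨ d % 8 = 1 ∨ d % 8 = 7 then kappa d else 2 * kappa d

end

end RealMasking

open RealMasking

namespace RealMasking

open scoped ComplexOrder Kronecker Matrix Topology

noncomputable section

/-! Write the ket `M |j⟩` as a coefficient matrix `X j` (`coeff M j`). By polarization, masking the
real states amounts to `X j (X k)ᴴ + X k (X j)ᴴ = 2 δ_jk τ` together with the analogous relations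
for `(X j)ᴴ X k` (`IsMaskFamily`). On an eigenspace of the common reduced state `τ` with eigenvalue
`c > 0`, the operators `c⁻¹ X j (X 0)ᴴ` with `j ≠ 0` are therefore `d - 1` anticommuting square
roots of `-1` (`IsMaskFamily.isCliffordOn`). An eigenspace that carries such a Clifford
representation has dimension at least `κ(d)`. If the masker is real, complex conjugation combined
with a product of generators gives, for `d = 2, …, 6` mod 8, an antilinear map of square `-1` on a
joint eigenspace of commuting involutions; this doubles the bound to `κ^R(d)`. Since `τ` has trace
one, its eigenvalues are at most `1 / κ(d)`, respectively `1 / κ^R(d)`. Orthogonality of the kets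
gives in addition the bound `1 / 2`, which explains the maximum with 2.

A pure state whose reduced state has eigenvalues at most `1 / k` can be converted by LOCC to a
maximally entangled state of Schmidt rank `k`; this case of Nielsen's theorem follows from
Birkhoff's theorem (`LOCCReach.maxEntangled`). All outputs of a masker are mixtures of pure states
with the same reduced state `τ`, so they are reached from one pure output (`IsMaskFamily.reach`).
Hence the maximum over inputs sits at a pure output and is at least `E(|Φ(k)⟩)`. Equality holds for
maskers `|j⟩ ↦ (J_j ⊗ 1)|Φ(k)⟩` built from Clifford families (`exists_masker`), which exist in the
required dimensions by tensor constructions from quaternions and octonions and by Bott periodicity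
(`hasClifford_complex`, `hasClifford_kappaReal`). Only monotonicity of `E` enters.

For the entanglement cost it remains to see that it is a monotone, because LOCC maps contract the
trace norm and can be applied copy by copy, and that it equals `p` on `|Φ(2^p)⟩`: exact preparation
gives one bound, and the fidelity bound `IsLOCC.fidelity_le` the other. -/

/-! ### Elementary properties of LOCC maps -/

section LOCC

set_option linter.unusedSectionVars false

variable {A B A' B' A'' B'' : Type} [Fintype A] [DecidableEq A] [Fintype B]
  [DecidableEq B] [Fintype A'] [DecidableEq A'] [Fintype B'] [DecidableEq B']
  [Fintype A''] [DecidableEq A''] [Fintype B''] [DecidableEq B'']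

/-- LOCC maps are separable: they have product Kraus operators. -/
theorem IsLOCC.exists_kraus {Λ : Matrix (A × B) (A × B) ℂ → Matrix (A' × B') (A' × B') ℂ}
    (h : IsLOCC Λ) :
    ∃ (ι : Type) (_ : Fintype ι) (a : ι → Matrix A' A ℂ) (b : ι → Matrix B' B ℂ),
      ∑ s, (a s ⊗ₖ b s)ᴴ * (a s ⊗ₖ b s) = 1 ∧
      ∀ ρ, Λ ρ = ∑ s, (a s ⊗ₖ b s) * ρ * (a s ⊗ₖ b s)ᴴ := by
  induction h with
  | done => exact ⟨Unit, inferInstance, fun _ => 1, fun _ => 1, by simp, by simp⟩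
  | @alice A B _ _ _ _ ι _ A₁ _ _ K hK Λ hΛ ih =>
    choose κ hκ a b hab hΛ' using ih
    have key : ∀ i s, (a i s * K i) ⊗ₖ b i s = (a i s ⊗ₖ b i s) * (K i ⊗ₖ (1 : Matrix B B ℂ)) :=
      fun i s => by rw [← Matrix.mul_kronecker_mul, Matrix.mul_one]
    refine ⟨Σ i, κ i, inferInstance, fun x => a x.1 x.2 * K x.1, fun x => b x.1 x.2, ?_, ?_⟩
    · simp only [key, Fintype.sum_sigma, Matrix.conjTranspose_mul]
      have : ∀ i, ∑ s, (K i ⊗ₖ (1 : Matrix B B ℂ))ᴴ * (a i s ⊗ₖ b i s)ᴴ *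
          ((a i s ⊗ₖ b i s) * (K i ⊗ₖ (1 : Matrix B B ℂ))) =
          ((K i)ᴴ * K i) ⊗ₖ (1 : Matrix B B ℂ) := fun i => by
        calc _ = (K i ⊗ₖ (1 : Matrix B B ℂ))ᴴ * (∑ s, (a i s ⊗ₖ b i s)ᴴ * (a i s ⊗ₖ b i s)) *
              (K i ⊗ₖ (1 : Matrix B B ℂ)) := by
              simp only [Matrix.mul_sum, Matrix.sum_mul, Matrix.mul_assoc]
          _ = _ := by
              rw [hab, Matrix.mul_one, Matrix.conjTranspose_kronecker, ← Matrix.mul_kronecker_mul]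
              simp
      simp only [this]
      have hsum : ∑ i, ((K i)ᴴ * K i) ⊗ₖ (1 : Matrix B B ℂ) =
          (∑ i, (K i)ᴴ * K i) ⊗ₖ (1 : Matrix B B ℂ) := by
        ext x y
        simp [Matrix.sum_apply, Finset.sum_mul]
      rw [hsum, hK, Matrix.one_kronecker_one]
    · intro ρ
      simp only [key, Fintype.sum_sigma, Matrix.conjTranspose_mul, hΛ', Matrix.mul_assoc]
  | @bob A B _ _ _ _ ι _ B₁ _ _ K hK Λ hΛ ih =>
    choose κ hκ a b hab hΛ' using ih
    have key : ∀ i s, a i s ⊗ₖ (b i s * K i) = (a i s ⊗ₖ b i s) * ((1 : Matrix A A ℂ) ⊗ₖ K i) :=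
      fun i s => by rw [← Matrix.mul_kronecker_mul, Matrix.mul_one]
    refine ⟨Σ i, κ i, inferInstance, fun x => a x.1 x.2, fun x => b x.1 x.2 * K x.1, ?_, ?_⟩
    · simp only [key, Fintype.sum_sigma, Matrix.conjTranspose_mul]
      have : ∀ i, ∑ s, ((1 : Matrix A A ℂ) ⊗ₖ K i)ᴴ * (a i s ⊗ₖ b i s)ᴴ *
          ((a i s ⊗ₖ b i s) * ((1 : Matrix A A ℂ) ⊗ₖ K i)) =
          (1 : Matrix A A ℂ) ⊗ₖ ((K i)ᴴ * K i) := fun i => by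
        calc _ = ((1 : Matrix A A ℂ) ⊗ₖ K i)ᴴ * (∑ s, (a i s ⊗ₖ b i s)ᴴ * (a i s ⊗ₖ b i s)) *
              ((1 : Matrix A A ℂ) ⊗ₖ K i) := by
              simp only [Matrix.mul_sum, Matrix.sum_mul, Matrix.mul_assoc]
          _ = _ := by
              rw [hab, Matrix.mul_one, Matrix.conjTranspose_kronecker, ← Matrix.mul_kronecker_mul]
              simp
      simp only [this]
      have hsum : ∑ i, (1 : Matrix A A ℂ) ⊗ₖ ((K i)ᴴ * K i) =
          (1 : Matrix A A ℂ) ⊗ₖ (∑ i, (K i)ᴴ * K i) := by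
        ext x y
        simp [Matrix.sum_apply, Finset.mul_sum]
      rw [hsum, hK, Matrix.one_kronecker_one]
    · intro ρ
      simp only [key, Fintype.sum_sigma, Matrix.conjTranspose_mul, hΛ', Matrix.mul_assoc]

variable {Λ : Matrix (A × B) (A × B) ℂ → Matrix (A' × B') (A' × B') ℂ}

theorem IsLOCC.map_sum (h : IsLOCC Λ) {ι : Type*} (s : Finset ι)
    (ρ : ι → Matrix (A × B) (A × B) ℂ) : Λ (∑ i ∈ s, ρ i) = ∑ i ∈ s, Λ (ρ i) := by
  obtain ⟨κ, _, a, b, -, hΛ⟩ := h.exists_kraus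
  simp only [hΛ, Matrix.mul_sum, Matrix.sum_mul]
  exact Finset.sum_comm

theorem IsLOCC.map_sub (h : IsLOCC Λ) (ρ σ : Matrix (A × B) (A × B) ℂ) :
    Λ (ρ - σ) = Λ ρ - Λ σ := by
  obtain ⟨κ, _, a, b, -, hΛ⟩ := h.exists_kraus
  simp only [hΛ, Matrix.mul_sub, Matrix.sub_mul, Finset.sum_sub_distrib]

theorem IsLOCC.map_zero (h : IsLOCC Λ) : Λ 0 = 0 := by
  obtain ⟨κ, _, a, b, -, hΛ⟩ := h.exists_kraus
  simp [hΛ]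

theorem IsLOCC.posSemidef (h : IsLOCC Λ) {ρ : Matrix (A × B) (A × B) ℂ} (hρ : ρ.PosSemidef) :
    (Λ ρ).PosSemidef := by
  obtain ⟨κ, _, a, b, -, hΛ⟩ := h.exists_kraus
  rw [hΛ]
  exact Matrix.posSemidef_sum _ fun s _ => hρ.mul_mul_conjTranspose_same _

theorem IsLOCC.trace (h : IsLOCC Λ) (ρ : Matrix (A × B) (A × B) ℂ) :
    (Λ ρ).trace = ρ.trace := by
  obtain ⟨κ, _, a, b, hab, hΛ⟩ := h.exists_kraus
  rw [hΛ, Matrix.trace_sum]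
  have : ∀ s, ((a s ⊗ₖ b s) * ρ * (a s ⊗ₖ b s)ᴴ).trace =
      ((a s ⊗ₖ b s)ᴴ * (a s ⊗ₖ b s) * ρ).trace := fun s => by
    rw [Matrix.trace_mul_comm, Matrix.mul_assoc]
  simp only [this]
  rw [← Matrix.trace_sum, ← Matrix.sum_mul, hab, Matrix.one_mul]

theorem IsLOCC.isDensity (h : IsLOCC Λ) {ρ : Matrix (A × B) (A × B) ℂ} (hρ : IsDensity ρ) :
    IsDensity (Λ ρ) :=
  ⟨h.posSemidef hρ.1, (h.trace ρ).trans hρ.2⟩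

/-- The second protocol is run at the end of every branch of the first; additivity of `Λ'` carries
it through the sums over forgotten outcomes. -/
theorem IsLOCC.comp {Λ' : Matrix (A' × B') (A' × B') ℂ → Matrix (A'' × B'') (A'' × B'') ℂ}
    (h' : IsLOCC Λ') (h : IsLOCC Λ) : IsLOCC fun ρ => Λ' (Λ ρ) := by
  induction h with
  | done => exact h'
  | @alice A B _ _ _ _ ι _ A₁ _ _ K hK Λ hΛ ih =>
    simp only [h'.map_sum]
    exact IsLOCC.alice A₁ K hK (fun i ρ => Λ' (Λ i ρ)) ih
  | @bob A B _ _ _ _ ι _ B₁ _ _ K hK Λ hΛ ih =>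
    simp only [h'.map_sum]
    exact IsLOCC.bob B₁ K hK (fun i ρ => Λ' (Λ i ρ)) ih

/-- `σ` can be obtained from `ρ` by LOCC. -/
def LOCCReach (ρ : Matrix (A × B) (A × B) ℂ) (σ : Matrix (A' × B') (A' × B') ℂ) : Prop :=
  ∃ Λ : Matrix (A × B) (A × B) ℂ → Matrix (A' × B') (A' × B') ℂ, IsLOCC Λ ∧ Λ ρ = σ

theorem LOCCReach.trans {ρ : Matrix (A × B) (A × B) ℂ} {σ : Matrix (A' × B') (A' × B') ℂ}
    {τ : Matrix (A'' × B'') (A'' × B'') ℂ} (h : LOCCReach ρ σ) (h' : LOCCReach σ τ) :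
    LOCCReach ρ τ := by
  obtain ⟨Λ, hΛ, rfl⟩ := h
  obtain ⟨Λ', hΛ', rfl⟩ := h'
  exact ⟨_, hΛ'.comp hΛ, rfl⟩

/-- The pure-state operator of the ket with coefficient matrix `X`. -/
def pureOp {A B : Type} (X : Matrix A B ℂ) : Matrix (A × B) (A × B) ℂ :=
  ketBra fun p => X p.1 p.2

/-- Product operators act on coefficient matrices by multiplication from the two sides, which turns
local operations on pure states into matrix algebra. -/
theorem kronecker_sandwich_pureOp (a : Matrix A' A ℂ) (b : Matrix B' B ℂ) (X : Matrix A B ℂ) :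
    (a ⊗ₖ b) * pureOp X * (a ⊗ₖ b)ᴴ = pureOp (a * X * bᵀ) := by
  have : (a ⊗ₖ b) *ᵥ (fun p => X p.1 p.2) = fun p => (a * X * bᵀ) p.1 p.2 := by
    ext p
    simp only [Matrix.mulVec, dotProduct, Matrix.kroneckerMap_apply, Matrix.mul_apply,
      Matrix.transpose_apply, Fintype.sum_prod_type, Finset.sum_mul]
    rw [Finset.sum_comm]
    exact Finset.sum_congr rfl fun y _ => Finset.sum_congr rfl fun x _ => by ring
  rw [pureOp, ketBra, Matrix.mul_vecMulVec, Matrix.vecMulVec_mul, this, ← Matrix.star_mulVec, this]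
  rfl

theorem alice_sandwich_pureOp (K : Matrix A' A ℂ) (X : Matrix A B ℂ) :
    (K ⊗ₖ (1 : Matrix B B ℂ)) * pureOp X * (K ⊗ₖ (1 : Matrix B B ℂ))ᴴ = pureOp (K * X) := by
  rw [kronecker_sandwich_pureOp, Matrix.transpose_one, Matrix.mul_one]

theorem bob_sandwich_pureOp (K : Matrix B' B ℂ) (X : Matrix A B ℂ) :
    ((1 : Matrix A A ℂ) ⊗ₖ K) * pureOp X * ((1 : Matrix A A ℂ) ⊗ₖ K)ᴴ = pureOp (X * Kᵀ) := by
  rw [kronecker_sandwich_pureOp, Matrix.one_mul]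

theorem pureOp_smul (c : ℂ) (X : Matrix A B ℂ) :
    pureOp (c • X) = (c * star c) • pureOp X := by
  ext x y
  simp [pureOp, ketBra, Matrix.vecMulVec_apply]
  ring

@[simp]
theorem pureOp_zero : pureOp (0 : Matrix A B ℂ) = 0 := by
  ext x y
  simp [pureOp, ketBra, Matrix.vecMulVec_apply]

theorem pureOp_posSemidef (X : Matrix A B ℂ) : (pureOp X).PosSemidef :=
  Matrix.posSemidef_vecMulVec_self_star _

theorem trace_pureOp (X : Matrix A B ℂ) : (pureOp X).trace = (X * Xᴴ).trace := by
  simp [pureOp, ketBra, Matrix.trace, Matrix.vecMulVec_apply, Matrix.mul_apply,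
    Fintype.sum_prod_type]

theorem isDensity_pureOp {X : Matrix A B ℂ} (hX : (X * Xᴴ).trace = 1) : IsDensity (pureOp X) :=
  ⟨pureOp_posSemidef X, (trace_pureOp X).trans hX⟩

/-- The Kraus operators `|x₀⟩⟨x| R` that complete an incomplete measurement. -/
theorem sum_completion {ι A₁ : Type} [Fintype ι] [Fintype A₁] [DecidableEq A₁] (x₀ : A₁)
    (K : ι → Matrix A₁ A ℂ) (R : Matrix A A ℂ) (hR : Rᴴ = R) (hRR : R * R = R)
    (hK : ∑ i, (K i)ᴴ * K i = 1 - R) :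
    ∑ i, (Sum.elim K (fun x : A => Matrix.single x₀ x (1 : ℂ) * R) i)ᴴ *
      (Sum.elim K (fun x : A => Matrix.single x₀ x (1 : ℂ) * R) i) = 1 := by
  rw [Fintype.sum_sum_type]
  simp only [Sum.elim_inl, Sum.elim_inr, hK, Matrix.conjTranspose_mul, hR]
  have : ∀ x : A, R * (Matrix.single x₀ x (1 : ℂ))ᴴ * (Matrix.single x₀ x (1 : ℂ) * R) =
      R * Matrix.single x x 1 * R := fun x => by
    rw [Matrix.conjTranspose_single, Matrix.mul_assoc, ← Matrix.mul_assoc (Matrix.single x x₀ _),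
      Matrix.single_mul_single_same]
    simp [Matrix.mul_assoc]
  simp only [this]
  rw [← Matrix.sum_mul, ← Matrix.mul_sum]
  have h1 : ∑ x : A, Matrix.single x x (1 : ℂ) = 1 := by
    ext i j
    simp [Matrix.sum_apply, Matrix.single_apply, Matrix.one_apply, ite_and]
  rw [h1, Matrix.mul_one, hRR, sub_add_cancel]

/-- Since `R` annihilates `X`, the outcomes added to complete the measurement never occur on this
state; `Λ₀` merely fills their branches. -/
theorem IsLOCC.exists_alice {ι A₁ : Type} [Fintype ι] [Fintype A₁] [DecidableEq A₁] [Nonempty A₁]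
    (K : ι → Matrix A₁ A ℂ) (R : Matrix A A ℂ) (hR : Rᴴ = R) (hRR : R * R = R)
    (hK : ∑ i, (K i)ᴴ * K i = 1 - R)
    (Λ : ι → Matrix (A₁ × B) (A₁ × B) ℂ → Matrix (A' × B') (A' × B') ℂ)
    (hΛ : ∀ i, IsLOCC (Λ i))
    (Λ₀ : Matrix (A₁ × B) (A₁ × B) ℂ → Matrix (A' × B') (A' × B') ℂ) (hΛ₀ : IsLOCC Λ₀)
    (X : Matrix A B ℂ) (hX : R * X = 0) :
    LOCCReach (pureOp X) (∑ i, Λ i (pureOp (K i * X))) := by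
  let x₀ : A₁ := Classical.arbitrary _
  refine ⟨_, IsLOCC.alice (fun _ => A₁) _ (sum_completion x₀ K R hR hRR hK)
    (Sum.elim Λ fun _ => Λ₀) ?_, ?_⟩
  · rintro (i | x)
    · exact hΛ i
    · exact hΛ₀
  · simp only [alice_sandwich_pureOp, Fintype.sum_sum_type, Sum.elim_inl, Sum.elim_inr]
    simp only [Matrix.mul_assoc, hX, Matrix.mul_zero, pureOp_zero, hΛ₀.map_zero, Finset.sum_const_zero,
      add_zero]

theorem IsLOCC.exists_bob {B₁ : Type} [Fintype B₁] [DecidableEq B₁] [Nonempty B₁]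
    (K : Matrix B₁ B ℂ) (R : Matrix B B ℂ) (hR : Rᴴ = R) (hRR : R * R = R)
    (hK : Kᴴ * K = 1 - R) (X : Matrix A B ℂ) (hX : X * Rᵀ = 0) :
    ∃ Λ : Matrix (A × B) (A × B) ℂ → Matrix (A × B₁) (A × B₁) ℂ, IsLOCC Λ ∧
      Λ (pureOp X) = pureOp (X * Kᵀ) := by
  let x₀ : B₁ := Classical.arbitrary _
  refine ⟨_, IsLOCC.bob (fun _ => B₁) _
    (sum_completion x₀ (fun _ : Unit => K) R hR hRR (by simpa using hK)) (fun _ ρ => ρ)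
    (fun _ => IsLOCC.done), ?_⟩
  simp only [bob_sandwich_pureOp, Fintype.sum_sum_type, Sum.elim_inl, Sum.elim_inr,
      Matrix.transpose_mul, ← Matrix.mul_assoc, hX, Matrix.zero_mul, pureOp_zero,
      Finset.sum_const_zero, add_zero]
  simp

/-- Local relabellings and local isometries. -/
theorem LOCCReach.local_isometry (u : Matrix A' A ℂ) (v : Matrix B' B ℂ) (hu : uᴴ * u = 1)
    (hv : vᴴ * v = 1) (ρ : Matrix (A × B) (A × B) ℂ) :
    LOCCReach ρ ((u ⊗ₖ v) * ρ * (u ⊗ₖ v)ᴴ) := by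
  have hA : IsLOCC fun ρ : Matrix (A × B) (A × B) ℂ =>
      ∑ i : Unit, (u ⊗ₖ (1 : Matrix B B ℂ)) * ρ * (u ⊗ₖ (1 : Matrix B B ℂ))ᴴ :=
    IsLOCC.alice (fun _ : Unit => A') (fun _ => u) (by simpa using hu) (fun _ ρ => ρ)
      (fun _ => IsLOCC.done)
  have hB : IsLOCC fun ρ : Matrix (A' × B) (A' × B) ℂ =>
      ∑ i : Unit, ((1 : Matrix A' A' ℂ) ⊗ₖ v) * ρ * ((1 : Matrix A' A' ℂ) ⊗ₖ v)ᴴ :=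
    IsLOCC.bob (fun _ : Unit => B') (fun _ => v) (by simpa using hv) (fun _ ρ => ρ)
      (fun _ => IsLOCC.done)
  refine ⟨_, hB.comp hA, ?_⟩
  have : u ⊗ₖ v = ((1 : Matrix A' A' ℂ) ⊗ₖ v) * (u ⊗ₖ (1 : Matrix B B ℂ)) := by
    rw [← Matrix.mul_kronecker_mul, Matrix.one_mul, Matrix.mul_one]
  simp [this, Matrix.conjTranspose_mul, Matrix.mul_assoc]

end LOCC

/-! ### One-way protocols on pure states -/

section OneWay

set_option linter.unusedSectionVars false

variable {A B A' B' : Type} [Fintype A] [DecidableEq A] [Fintype B]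
  [DecidableEq B] [Fintype A'] [DecidableEq A'] [Fintype B'] [DecidableEq B']

theorem exists_eigen_decomposition {τ : Matrix A A ℂ} (h : τ.IsHermitian) :
    ∃ U : Matrix A A ℂ, Uᴴ * U = 1 ∧ U * Uᴴ = 1 ∧
      τ = U * Matrix.diagonal (fun i => (h.eigenvalues i : ℂ)) * Uᴴ := by
  refine ⟨h.eigenvectorUnitary, ?_, ?_, ?_⟩
  · exact Unitary.coe_star_mul_self h.eigenvectorUnitary
  · exact Unitary.coe_mul_star_self h.eigenvectorUnitary
  · have := h.spectral_theorem
    rwa [Unitary.conjStarAlgAut_apply] at this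

theorem conj_diagonal_mul {U : Matrix A A ℂ} (hU : Uᴴ * U = 1) (v w : A → ℂ) :
    (U * Matrix.diagonal v * Uᴴ) * (U * Matrix.diagonal w * Uᴴ) =
      U * Matrix.diagonal (v * w) * Uᴴ := by
  calc _ = U * Matrix.diagonal v * (Uᴴ * U) * Matrix.diagonal w * Uᴴ := by
        simp only [Matrix.mul_assoc]
    _ = _ := by
        rw [hU, Matrix.mul_one, Matrix.mul_assoc U, Matrix.diagonal_mul_diagonal]
        rfl

theorem conj_diagonal_conjTranspose (U : Matrix A A ℂ) (l : A → ℝ) :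
    (U * Matrix.diagonal (fun i => (l i : ℂ)) * Uᴴ)ᴴ =
      U * Matrix.diagonal (fun i => (l i : ℂ)) * Uᴴ := by
  simp only [Matrix.conjTranspose_mul, Matrix.conjTranspose_conjTranspose,
    Matrix.diagonal_conjTranspose, Matrix.mul_assoc]
  congr 3
  ext i
  simp

/-- Hermitian matrices have a pseudo-inverse. -/
theorem exists_pseudoInverse {τ : Matrix A A ℂ} (h : τ.IsHermitian) :
    ∃ G : Matrix A A ℂ, Gᴴ = G ∧ τ * G * τ = τ ∧ G * τ * G = G := by
  obtain ⟨U, hU, -, hτ⟩ := exists_eigen_decomposition h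
  generalize h.eigenvalues = l at hτ
  subst hτ
  refine ⟨U * Matrix.diagonal (fun i => (l i : ℂ)⁻¹) * Uᴴ, ?_, ?_, ?_⟩
  · simpa using conj_diagonal_conjTranspose U fun i => (l i)⁻¹
  all_goals
    rw [conj_diagonal_mul hU, conj_diagonal_mul hU]
    congr 3
    ext i
    by_cases hl : (l i : ℂ) = 0 <;> simp [hl]

/-- Purifications of the same state are related by an operation on the purifying system. -/
theorem exists_locc_of_reduced_eq [Nonempty B'] (Y : Matrix A B ℂ) (T : Matrix A B' ℂ)
    (h : Y * Yᴴ = T * Tᴴ) :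
    ∃ Λ : Matrix (A × B) (A × B) ℂ → Matrix (A × B') (A × B') ℂ, IsLOCC Λ ∧
      Λ (pureOp Y) = pureOp T := by
  obtain ⟨G, hG, h1, h2⟩ := exists_pseudoInverse (Matrix.isHermitian_mul_conjTranspose_self Y)
  -- `Z` has the same column space as `Y`, and `Y Yᴴ G` is the identity there.
  have supp : ∀ {C : Type} [Fintype C] (Z : Matrix A C ℂ), Z * Zᴴ = Y * Yᴴ →
      Y * Yᴴ * G * Z = Z := by
    intro C _ Z hZ
    have : (Z - Y * Yᴴ * G * Z) * (Z - Y * Yᴴ * G * Z)ᴴ = 0 := by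
      have e : (Z - Y * Yᴴ * G * Z)ᴴ = Zᴴ * (1 - G * (Y * Yᴴ)) := by
        simp [Matrix.conjTranspose_sub, Matrix.conjTranspose_mul, hG, Matrix.mul_sub,
          Matrix.mul_assoc]
      rw [e, ← Matrix.mul_assoc, Matrix.sub_mul, hZ, Matrix.mul_assoc (Y * Yᴴ * G), hZ, h1,
        sub_self, Matrix.zero_mul]
    exact (sub_eq_zero.1 (Matrix.self_mul_conjTranspose_eq_zero.1 this)).symm
  -- A partial isometry with `Y W = T`; up to transposition it is Bob's operation. `W Wᴴ = Yᴴ G Y`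
  -- projects onto the range of `Yᴴ`, so its complement completes the measurement without ever being
  -- triggered.
  set W : Matrix B B' ℂ := Yᴴ * G * T with hW
  have hWW : W * Wᴴ = Yᴴ * G * Y := by
    calc W * Wᴴ = Yᴴ * (G * (T * Tᴴ) * G) * Y := by
          simp [hW, Matrix.conjTranspose_mul, hG, Matrix.mul_assoc]
      _ = Yᴴ * G * Y := by rw [← h, h2]
  have hYW : Y * W = T := by
    rw [hW, ← Matrix.mul_assoc, ← Matrix.mul_assoc, supp T h.symm]
  have hY : Y * (Yᴴ * G * Y) = Y := by
    rw [← Matrix.mul_assoc, ← Matrix.mul_assoc, supp Y rfl]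
  have hP : (Yᴴ * G * Y) * (Yᴴ * G * Y) = Yᴴ * G * Y := by
    rw [Matrix.mul_assoc (Yᴴ * G) Y, hY]
  have hPH : (Yᴴ * G * Y)ᴴ = Yᴴ * G * Y := by
    simp [Matrix.conjTranspose_mul, hG, Matrix.mul_assoc]
  obtain ⟨Λ, hΛ, hΛX⟩ := IsLOCC.exists_bob Wᵀ (1 - (Yᴴ * G * Y)ᵀ)
    (by
      rw [Matrix.conjTranspose_sub, Matrix.conjTranspose_one]
      exact congrArg (fun Z : Matrix B B ℂ => 1 - Zᵀ) hPH)
    (by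
      rw [Matrix.sub_mul, Matrix.mul_sub, Matrix.mul_sub, ← Matrix.transpose_mul, hP]
      simp)
    (by
      have : Wᵀᴴ * Wᵀ = (W * Wᴴ)ᵀ := (Matrix.transpose_mul W Wᴴ).symm
      rw [this, hWW, sub_sub_cancel]) Y
    (by
      rw [Matrix.transpose_sub, Matrix.transpose_one, Matrix.transpose_transpose, Matrix.mul_sub,
        hY, Matrix.mul_one, sub_self])
  exact ⟨Λ, hΛ, by rw [hΛX, Matrix.transpose_transpose, hYW]⟩

/-- Alice measures, announces the outcome, and Bob adapts his purification. -/
theorem LOCCReach.oneWay {ι : Type} [Fintype ι] [Nonempty A'] [Nonempty B']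
    (X : Matrix A B ℂ) (K : ι → Matrix A' A ℂ) (R : Matrix A A ℂ) (hR : Rᴴ = R) (hRR : R * R = R)
    (hK : ∑ i, (K i)ᴴ * K i = 1 - R) (hX : R * X = 0) (T : ι → Matrix A' B' ℂ)
    (hT : ∀ i, K i * (X * Xᴴ) * (K i)ᴴ = T i * (T i)ᴴ) :
    LOCCReach (pureOp X) (∑ i, pureOp (T i)) := by
  have := fun i => exists_locc_of_reduced_eq (K i * X) (T i)
    (by rw [← hT i, Matrix.conjTranspose_mul]; simp only [Matrix.mul_assoc])
  choose Λ hΛ hΛX using this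
  obtain ⟨Λ₀, hΛ₀, -⟩ := exists_locc_of_reduced_eq (0 : Matrix A' B ℂ) (0 : Matrix A' B' ℂ)
    (by simp)
  simpa only [hΛX] using IsLOCC.exists_alice K R hR hRR hK Λ hΛ Λ₀ hΛ₀ X hX

end OneWay

/-! ### Conversion to and from maximally entangled states -/

section Conversion

set_option linter.unusedSectionVars false

variable {A B A' B' : Type} [Fintype A] [DecidableEq A] [Fintype B]
  [DecidableEq B] [Fintype A'] [DecidableEq A'] [Fintype B'] [DecidableEq B']

/-- A vector in `[0, 1]^A` with integral sum `k` is a mixture of indicators of `k`-element sets,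
which are written as the images of a fixed `k`-element set under permutations. -/
theorem exists_perm_weights {k : ℕ} (hk : 0 < k) (x : A → ℝ) (h0 : ∀ i, 0 ≤ x i)
    (h1 : ∀ i, x i ≤ 1) (hs : ∑ i, x i = k) :
    ∃ (f : Fin k ↪ A) (w : Equiv.Perm A → ℝ), (∀ σ, 0 ≤ w σ) ∧ ∑ σ, w σ = 1 ∧
      ∀ i, ∑ σ, ∑ j, (if σ (f j) = i then w σ else 0) = x i := by
  have hkA : k ≤ Fintype.card A := by
    have : ∑ i, x i ≤ ∑ i : A, (1 : ℝ) := Finset.sum_le_sum fun i _ => h1 i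
    rw [hs] at this
    simpa using this
  obtain ⟨f⟩ : Nonempty (Fin k ↪ A) :=
    Function.Embedding.nonempty_of_card_le (by simpa using hkA)
  set N := Fintype.card A with hN
  -- The rows of the chosen `k`-element set carry `x` and the remaining rows its complement `1 - x`,
  -- normalized to be doubly stochastic. In the Birkhoff decomposition, row `f j` says that `σ (f j)
  -- = i` has probability `x i / k`; summing over `j` gives `x i`.
  let M : Matrix A A ℝ := Matrix.of fun a i =>
    if a ∈ Finset.univ.map f then x i / k else (1 - x i) / (N - k : ℝ)
  have hk0 : (k : ℝ) ≠ 0 := by positivity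
  have hcard : (Finset.univ.map f).card = k := by simp
  have hcard' : ((Finset.univ.map f)ᶜ.card : ℝ) = N - k := by
    rw [Finset.card_compl, hcard, Nat.cast_sub hkA]
  have hMds : M ∈ doublyStochastic ℝ A := by
    rw [mem_doublyStochastic_iff_sum]
    refine ⟨fun a i => ?_, fun a => ?_, fun i => ?_⟩
    · simp only [M, Matrix.of_apply]
      have : (0 : ℝ) ≤ N - k := by rw [sub_nonneg]; exact_mod_cast hkA
      split_ifs
      · exact div_nonneg (h0 i) (by positivity)
      · exact div_nonneg (sub_nonneg.2 (h1 i)) this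
    · simp only [M, Matrix.of_apply]
      split_ifs with ha
      · rw [← Finset.sum_div, hs, div_self hk0]
      · rw [← Finset.sum_div, Finset.sum_sub_distrib, hs]
        have : (N - k : ℝ) ≠ 0 := by
          rw [← hcard']
          exact_mod_cast (Finset.card_pos.2 ⟨a, Finset.mem_compl.2 ha⟩).ne'
        simp [← hN, div_self this]
    · simp only [M, Matrix.of_apply]
      rw [← Finset.sum_add_sum_compl (Finset.univ.map f)]
      rw [Finset.sum_congr rfl (fun a ha => if_pos ha),
        Finset.sum_congr rfl (fun a ha => if_neg (Finset.mem_compl.1 ha))]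
      rw [Finset.sum_const, Finset.sum_const, nsmul_eq_mul, nsmul_eq_mul, hcard, hcard',
        mul_div_cancel₀ _ hk0]
      -- If `N = k`, the complementary rows are absent and the division by zero is harmless: `x` is
      -- identically one.
      by_cases hNk : (N - k : ℝ) = 0
      · have hall : ∑ i, (1 - x i) = 0 := by
          rw [Finset.sum_sub_distrib, hs]
          simpa [← hN] using hNk
        have := (Finset.sum_eq_zero_iff_of_nonneg (fun i _ => sub_nonneg.2 (h1 i))).1 hall i
          (Finset.mem_univ i)
        rw [hNk, this]
        linarith
      · rw [mul_div_cancel₀ _ hNk]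
        ring
  obtain ⟨w, hw0, hw1, hw⟩ := exists_eq_sum_perm_of_mem_doublyStochastic hMds
  refine ⟨f, w, hw0, hw1, fun i => ?_⟩
  rw [Finset.sum_comm]
  have : ∀ j : Fin k, ∑ σ, (if σ (f j) = i then w σ else 0) = x i / k := fun j => by
    have h := congrFun (congrFun hw (f j)) i
    simp only [M, Matrix.of_apply, Finset.mem_map, Finset.mem_univ, true_and,
      exists_apply_eq_apply, if_true] at h
    rw [← h, Matrix.sum_apply]
    refine Finset.sum_congr rfl fun σ _ => ?_
    simp [Equiv.Perm.permMatrix, PEquiv.toMatrix_apply, eq_comm]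
  rw [Finset.sum_congr rfl fun j _ => this j]
  simp
  field_simp

theorem IsMaxEntangled.exists_coeff {k : ℕ} {Φ : A × B → ℂ} (hΦ : IsMaxEntangled k Φ) :
    ∃ (u : Matrix A (Fin k) ℂ) (v : Matrix B (Fin k) ℂ), uᴴ * u = 1 ∧ vᴴ * v = 1 ∧
      ketBra Φ = pureOp (((1 / √(k : ℝ) : ℝ) : ℂ) • (u * vᵀ)) := by
  obtain ⟨u, v, hu, hv, h⟩ := hΦ
  refine ⟨u, v, hu, hv, ?_⟩
  unfold pureOp
  congr 1
  ext ⟨a, b⟩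
  simp [h, Matrix.mul_apply]

/-- A pure state whose reduced state is at most `1 / k` can be converted by LOCC to a maximally
entangled state of Schmidt rank `k`. -/
theorem LOCCReach.maxEntangled {k : ℕ} (hk : 0 < k) {X : Matrix A B ℂ}
    (htr : (X * Xᴴ).trace = 1) {U : Matrix A A ℂ} {l : A → ℝ} (hU : Uᴴ * U = 1)
    (hU' : U * Uᴴ = 1) (hτ : X * Xᴴ = U * Matrix.diagonal (fun i => (l i : ℂ)) * Uᴴ)
    (h0 : ∀ i, 0 ≤ l i) (hle : ∀ i, l i ≤ 1 / k)
    {Φ : A' × B' → ℂ} (hΦ : IsMaxEntangled k Φ) : LOCCReach (pureOp X) (ketBra Φ) := by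
  have hl : ∑ i, l i = 1 := by
    rw [hτ, Matrix.trace_mul_comm, ← Matrix.mul_assoc, hU, Matrix.one_mul,
      Matrix.trace_diagonal] at htr
    exact_mod_cast htr
  have hkR : (0 : ℝ) < k := by positivity
  -- The bound `l ≤ 1 / k` enters here: it puts the vector `k l` in the unit cube, and its sum is
  -- `k`.
  obtain ⟨f, w, hw0, hw1, hw⟩ := exists_perm_weights hk (fun i => k * l i)
    (fun i => mul_nonneg hkR.le (h0 i))
    (fun i => by have := hle i; rw [le_div_iff₀ hkR] at this; linarith)
    (by rw [← Finset.mul_sum, hl, mul_one])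
  -- A set of eigenvectors with positive weight contains no zero eigenvalue, so the inverses of `l`
  -- below are genuine whenever they matter.
  have hpos : ∀ σ j, w σ ≠ 0 → l (σ (f j)) ≠ 0 := by
    intro σ j hσ hl0
    have h := hw (σ (f j))
    simp only [hl0, mul_zero] at h
    have nn : ∀ σ' j', 0 ≤ (if σ' (f j') = σ (f j) then w σ' else 0) := fun σ' j' => by
      split_ifs
      exacts [hw0 _, le_rfl]
    rw [Finset.sum_eq_zero_iff_of_nonneg fun _ _ => Finset.sum_nonneg fun _ _ => nn _ _] at h
    have h' := h σ (Finset.mem_univ _)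
    rw [Finset.sum_eq_zero_iff_of_nonneg fun _ _ => nn _ _] at h'
    have := h' j (Finset.mem_univ _)
    simp only [if_true] at this
    exact hσ this
  have havg : ∀ g : A → ℂ, ∑ σ, ∑ j, (w σ : ℂ) * g (σ (f j)) = ∑ i, (k * l i : ℂ) * g i := by
    intro g
    have : ∀ i, (k * l i : ℂ) * g i = ∑ σ, ∑ j, (if σ (f j) = i then (w σ : ℂ) * g i else 0) := by
      intro i
      have h := congrArg (fun r : ℝ => (r : ℂ) * g i) (hw i)
      simp only [Complex.ofReal_mul, Complex.ofReal_natCast] at h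
      rw [← h]
      simp only [Complex.ofReal_sum, Finset.sum_mul]
      exact Finset.sum_congr rfl fun σ _ => Finset.sum_congr rfl fun j _ => by split_ifs <;> simp
    rw [Finset.sum_congr rfl fun i _ => this i]
    conv_rhs => rw [Finset.sum_comm]
    refine Finset.sum_congr rfl fun σ _ => ?_
    rw [Finset.sum_comm]
    simp
  obtain ⟨u, v, hu, hv, hΦX⟩ := hΦ.exists_coeff
  have : Nonempty A' := by
    by_contra hA
    rw [not_nonempty_iff] at hA
    have := congrFun (congrFun hu ⟨0, hk⟩) ⟨0, hk⟩
    simp [Matrix.mul_apply] at this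
  have : Nonempty B' := by
    by_contra hA
    rw [not_nonempty_iff] at hA
    have := congrFun (congrFun hv ⟨0, hk⟩) ⟨0, hk⟩
    simp [Matrix.mul_apply] at this
  let V : Equiv.Perm A → Matrix A (Fin k) ℂ := fun σ => U.submatrix id fun j => σ (f j)
  -- Outcome `σ` keeps the `k` eigenvectors `V σ` and rescales them so that the spectrum becomes
  -- flat: `D σ * diag(l) * D σ = (w σ / k) • 1`. Averaging with the weights makes the Kraus
  -- operators sum to the support projection of `X Xᴴ`.
  let s : Equiv.Perm A → Fin k → ℝ := fun σ j => √(w σ / k) * (√(l (σ (f j))))⁻¹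
  let D : Equiv.Perm A → Matrix (Fin k) (Fin k) ℂ := fun σ => Matrix.diagonal fun j => (s σ j : ℂ)
  have hD : ∀ σ, (D σ)ᴴ = D σ := fun σ => by
    simp only [D, Matrix.diagonal_conjTranspose]
    congr 1
    ext j
    simp
  have hss : ∀ σ j, s σ j * s σ j = w σ / k * (l (σ (f j)))⁻¹ := fun σ j => by
    simp only [s]
    rw [mul_mul_mul_comm, ← mul_inv, Real.mul_self_sqrt (h0 _),
      Real.mul_self_sqrt (div_nonneg (hw0 _) hkR.le)]
  have hVU : ∀ σ, Uᴴ * V σ = (1 : Matrix A A ℂ).submatrix id fun j => σ (f j) := fun σ => by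
    rw [← hU]
    rfl
  have key : LOCCReach (pureOp X) (∑ σ, pureOp
      (((√(w σ) : ℝ) : ℂ) • (((1 / √(k : ℝ) : ℝ) : ℂ) • (u * vᵀ)))) := by
    refine LOCCReach.oneWay X (fun σ => u * (D σ * (V σ)ᴴ))
      (U * Matrix.diagonal (fun i => ((if l i = 0 then 1 else 0 : ℝ) : ℂ)) * Uᴴ)
      (conj_diagonal_conjTranspose _ _) ?_ ?_ ?_ _ ?_
    · rw [conj_diagonal_mul hU]
      congr 3
      ext i
      by_cases hli : l i = 0 <;> simp [hli]
    · have e1 : ∀ σ, (u * (D σ * (V σ)ᴴ))ᴴ * (u * (D σ * (V σ)ᴴ)) = V σ * (D σ * D σ) * (V σ)ᴴ := by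
        intro σ
        calc _ = V σ * (D σ)ᴴ * (uᴴ * u) * D σ * (V σ)ᴴ := by
              simp only [Matrix.conjTranspose_mul, Matrix.conjTranspose_conjTranspose,
                Matrix.mul_assoc]
          _ = _ := by rw [hu, hD, Matrix.mul_one, Matrix.mul_assoc (V σ)]
      simp only [e1]
      have e2 : (1 : Matrix A A ℂ) = U * Matrix.diagonal (fun _ => 1) * Uᴴ := by simp [hU']
      rw [e2, ← Matrix.sub_mul, ← Matrix.mul_sub, Matrix.diagonal_sub]
      ext a b
      simp only [Matrix.sum_apply, D, Matrix.diagonal_mul_diagonal, Matrix.mul_apply (M := _ * _),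
        Matrix.mul_diagonal, Matrix.conjTranspose_apply]
      have e3 : ∀ σ j, V σ a j * ((s σ j : ℂ) * s σ j) * star (V σ b j) =
          (w σ : ℂ) * (fun i => (k : ℂ)⁻¹ * (l i : ℂ)⁻¹ * (U a i * star (U b i))) (σ (f j)) := by
        intro σ j
        have h := congrArg (fun r : ℝ => (r : ℂ)) (hss σ j)
        push_cast at h
        rw [h]
        simp only [V, Matrix.submatrix_apply, id]
        ring
      simp only [e3]
      refine (havg fun i => (k : ℂ)⁻¹ * (l i : ℂ)⁻¹ * (U a i * star (U b i))).trans ?_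
      refine Finset.sum_congr rfl fun i _ => ?_
      have hkC : (k : ℂ) ≠ 0 := by exact_mod_cast hk.ne'
      by_cases hli : l i = 0
      · simp [hli]
      · have : (l i : ℂ) ≠ 0 := by exact_mod_cast hli
        simp only [hli, if_false]
        field_simp
        simp
    · rw [← Matrix.self_mul_conjTranspose_eq_zero, Matrix.conjTranspose_mul,
        conj_diagonal_conjTranspose, ← Matrix.mul_assoc, Matrix.mul_assoc _ X, hτ,
        conj_diagonal_mul hU, conj_diagonal_mul hU]
      have : ((fun i => ((if l i = 0 then 1 else 0 : ℝ) : ℂ)) * fun i => (l i : ℂ)) = 0 := by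
        ext i
        by_cases hli : l i = 0 <;> simp [hli]
      rw [this]
      simp
    · intro σ
      have e1 : (V σ)ᴴ * (X * Xᴴ) * V σ = Matrix.diagonal fun j => (l (σ (f j)) : ℂ) := by
        rw [hτ]
        calc _ = (Uᴴ * V σ)ᴴ * Matrix.diagonal (fun i => (l i : ℂ)) * (Uᴴ * V σ) := by
              simp only [Matrix.conjTranspose_mul, Matrix.conjTranspose_conjTranspose,
                Matrix.mul_assoc]
          _ = _ := by
              rw [hVU]
              ext i j
              rcases eq_or_ne i j with rfl | hij
              · simp [Matrix.mul_apply, Matrix.diagonal_apply, Matrix.one_apply]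
              · simp [Matrix.mul_apply, Matrix.diagonal_apply, Matrix.one_apply,
                  f.injective.eq_iff, hij]
      have e2 : D σ * (Matrix.diagonal fun j => (l (σ (f j)) : ℂ)) * D σ =
          ((w σ / k : ℝ) : ℂ) • 1 := by
        simp only [D, Matrix.diagonal_mul_diagonal]
        rw [← Matrix.diagonal_one, ← Matrix.diagonal_smul]
        congr 1
        ext j
        have : s σ j * l (σ (f j)) * s σ j = w σ / k := by
          rw [mul_right_comm, hss]
          by_cases hwσ : w σ = 0
          · simp [hwσ]
          · have := hpos σ j hwσ
            field_simp
        simp only [Pi.smul_apply, smul_eq_mul, mul_one]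
        exact_mod_cast this
      calc u * (D σ * (V σ)ᴴ) * (X * Xᴴ) * (u * (D σ * (V σ)ᴴ))ᴴ
          = u * (D σ * ((V σ)ᴴ * (X * Xᴴ) * V σ) * (D σ)ᴴ) * uᴴ := by
            simp only [Matrix.conjTranspose_mul, Matrix.conjTranspose_conjTranspose,
              Matrix.mul_assoc]
        _ = ((w σ / k : ℝ) : ℂ) • (u * uᴴ) := by
            rw [e1, hD, e2]
            simp
        _ = _ := by
            have e3 : (u * vᵀ) * (u * vᵀ)ᴴ = u * uᴴ := by
              have : vᵀ * vᵀᴴ = 1 := by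
                have h := congrArg Matrix.transpose hv
                rw [Matrix.transpose_mul, Matrix.transpose_one] at h
                exact h
              rw [Matrix.conjTranspose_mul, ← Matrix.mul_assoc, Matrix.mul_assoc u, this,
                Matrix.mul_one]
            rw [smul_smul, Matrix.conjTranspose_smul, Matrix.smul_mul, Matrix.mul_smul, e3,
              smul_smul]
            congr 1
            simp only [star_mul', Complex.star_def, Complex.conj_ofReal]
            norm_cast
            rw [mul_mul_mul_comm, Real.mul_self_sqrt (hw0 σ), div_mul_div_comm,
              Real.mul_self_sqrt hkR.le]
            ring
  have hfin : ∑ σ, pureOp (((√(w σ) : ℝ) : ℂ) • (((1 / √(k : ℝ) : ℝ) : ℂ) • (u * vᵀ))) =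
      ketBra Φ := by
    rw [hΦX]
    have : ∀ σ, pureOp (((√(w σ) : ℝ) : ℂ) • (((1 / √(k : ℝ) : ℝ) : ℂ) • (u * vᵀ))) =
        (w σ : ℂ) • pureOp (((1 / √(k : ℝ) : ℝ) : ℂ) • (u * vᵀ)) := fun σ => by
      rw [pureOp_smul]
      congr 1
      rw [Complex.star_def, Complex.conj_ofReal, ← Complex.ofReal_mul, Real.mul_self_sqrt (hw0 σ)]
    simp only [this]
    rw [← Finset.sum_smul, ← Complex.ofReal_sum, hw1, Complex.ofReal_one, one_smul]
  rwa [hfin] at key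

/-- Positive semidefinite matrices are sums of operators `|ξ⟩⟨ξ|`. -/
theorem exists_eq_sum_ketBra {ρ : Matrix A A ℂ} (hρ : ρ.PosSemidef) :
    ∃ ξ : A → A → ℂ, ρ = ∑ i, ketBra (ξ i) := by
  have h0 := hρ.eigenvalues_nonneg
  obtain ⟨U, -, -, h⟩ := exists_eigen_decomposition hρ.1
  generalize hρ.1.eigenvalues = l at h h0
  refine ⟨fun i a => ((√(l i) : ℝ) : ℂ) * U a i, ?_⟩
  rw [h]
  ext a b
  simp only [Matrix.mul_apply (M := _ * _), Matrix.mul_diagonal, Matrix.conjTranspose_apply,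
    Matrix.sum_apply, ketBra, Matrix.vecMulVec_apply, Pi.star_apply, star_mul', Complex.star_def,
    Complex.conj_ofReal]
  refine Finset.sum_congr rfl fun i _ => ?_
  have : (l i : ℂ) = (√(l i) : ℝ) * (√(l i) : ℝ) := by
    rw [← Complex.ofReal_mul, Real.mul_self_sqrt (h0 i)]
  rw [this]
  ring

/-- Every state of `A' ⊗ B` can be prepared by LOCC from the maximally entangled state of
`B ⊗ B`. -/
theorem LOCCReach.of_uniform [AddCommGroup B] {ρ : Matrix (A' × B) (A' × B) ℂ}
    (hρ : IsDensity ρ) :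
    LOCCReach (pureOp (((1 / √(Fintype.card B : ℝ) : ℝ) : ℂ) • (1 : Matrix B B ℂ))) ρ := by
  have : Nonempty A' := by
    by_contra hA
    rw [not_nonempty_iff] at hA
    have := hρ.2
    simp [Matrix.trace] at this
  obtain ⟨ξ, hξ⟩ := exists_eq_sum_ketBra hρ.1
  let Ξ : A' × B → Matrix A' B ℂ := fun x => Matrix.of fun a b => ξ x (a, b)
  have hΞ : ρ = ∑ x, pureOp (Ξ x) := hξ
  have hdec : ∀ x, ∃ (U : Matrix B B ℂ) (l : B → ℝ), Uᴴ * U = 1 ∧ U * Uᴴ = 1 ∧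
      (Ξ x)ᴴ * Ξ x = U * Matrix.diagonal (fun i => (l i : ℂ)) * Uᴴ := fun x =>
    let ⟨U, h⟩ := exists_eigen_decomposition (Matrix.isHermitian_conjTranspose_mul_self (Ξ x))
    ⟨U, _, h⟩
  choose U l hU hU' hUD using hdec
  have hcard : (0 : ℝ) < Fintype.card B := by exact_mod_cast Fintype.card_pos
  set c : ℂ := ((1 / √(Fintype.card B : ℝ) : ℝ) : ℂ) with hc
  have hcc : c * star c = (Fintype.card B : ℂ)⁻¹ := by
    rw [hc, Complex.star_def, Complex.conj_ofReal, ← Complex.ofReal_mul, div_mul_div_comm,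
      Real.mul_self_sqrt hcard.le]
    simp
  have key : LOCCReach (pureOp (c • (1 : Matrix B B ℂ)))
      (∑ y : (A' × B) × B, pureOp (c • Ξ y.1)) := by
    -- The columns of `Ξ x * U x` are orthogonal, so each `Kᴴ K` is diagonal, and averaging over the
    -- translations of the group `B` makes these diagonals sum to a multiple of the identity.
    -- Translating columns does not change `K Kᴴ`, so for every translation Bob can correct the
    -- result to `Ξ x`.
    refine LOCCReach.oneWay _ (fun y : (A' × B) × B => (Ξ y.1 * U y.1).submatrix id (· + y.2)) 0
      (by simp) (by simp) ?_ (by simp) _ ?_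
    · have e1 : ∀ x t, ((Ξ x * U x).submatrix id (· + t))ᴴ * (Ξ x * U x).submatrix id (· + t) =
          (Matrix.diagonal (fun i => (l x i : ℂ))).submatrix (· + t) (· + t) := by
        intro x t
        have : (Ξ x * U x)ᴴ * (Ξ x * U x) = Matrix.diagonal (fun i => (l x i : ℂ)) := by
          calc _ = (U x)ᴴ * ((Ξ x)ᴴ * Ξ x) * U x := by
                simp only [Matrix.conjTranspose_mul, Matrix.mul_assoc]
            _ = ((U x)ᴴ * U x) * Matrix.diagonal (fun i => (l x i : ℂ)) * ((U x)ᴴ * U x) := by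
                rw [hUD]
                simp only [Matrix.mul_assoc]
            _ = _ := by rw [hU, Matrix.one_mul, Matrix.mul_one]
        rw [← this]
        rfl
      have e2 : ∀ x, (pureOp (Ξ x)).trace = ∑ b, (l x b : ℂ) := fun x => by
        rw [trace_pureOp, Matrix.trace_mul_comm, hUD, Matrix.trace_mul_comm, ← Matrix.mul_assoc,
          hU, Matrix.one_mul, Matrix.trace_diagonal]
      have e3 : ∑ x, ∑ b, (l x b : ℂ) = 1 := by
        rw [← hρ.2, hΞ, Matrix.trace_sum]
        exact Finset.sum_congr rfl fun x _ => (e2 x).symm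
      simp only [e1, sub_zero]
      ext b b'
      rw [Matrix.sum_apply, Fintype.sum_prod_type]
      rcases eq_or_ne b b' with rfl | hb
      · simp only [Matrix.submatrix_apply, Matrix.diagonal_apply_eq, Matrix.one_apply_eq]
        rw [← e3]
        exact Finset.sum_congr rfl fun x _ =>
          Fintype.sum_equiv (Equiv.addLeft b) _ _ fun _ => rfl
      · simp [hb]
    · rintro ⟨x, t⟩
      have e1 : (Ξ x * U x).submatrix id (· + t) * ((Ξ x * U x).submatrix id (· + t))ᴴ =
          Ξ x * (Ξ x)ᴴ := by
        calc _ = ((Ξ x * U x) * (Ξ x * U x)ᴴ).submatrix id id := by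
              rw [Matrix.conjTranspose_submatrix]
              exact Matrix.submatrix_mul_equiv _ _ id (Equiv.addRight t) id
          _ = Ξ x * (U x * (U x)ᴴ) * (Ξ x)ᴴ := by
              rw [Matrix.submatrix_id_id]
              simp only [Matrix.conjTranspose_mul, Matrix.mul_assoc]
          _ = _ := by rw [hU', Matrix.mul_one]
      simp only [Matrix.conjTranspose_smul, Matrix.smul_mul, Matrix.mul_smul,
        Matrix.conjTranspose_one, Matrix.mul_one, e1]
  have hfin : ∑ y : (A' × B) × B, pureOp (c • Ξ y.1) = ρ := by
    rw [Fintype.sum_prod_type, hΞ]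
    refine Finset.sum_congr rfl fun x _ => ?_
    simp only [pureOp_smul, hcc]
    rw [Finset.sum_const, Finset.card_univ, ← Nat.cast_smul_eq_nsmul ℂ, smul_smul,
      mul_inv_cancel₀ (by exact_mod_cast hcard.ne'), one_smul]
  rwa [hfin] at key

end Conversion

/-! ### The trace norm -/

section TraceNorm

set_option linter.unusedSectionVars false

variable {ι : Type} [Fintype ι] [DecidableEq ι]

/-- The eigenvalues of `Xᴴ X` and the squared eigenvalues of `X` are indexed independently and agree
only as multisets; hence the comparison of roots of the characteristic polynomial. -/
theorem traceNorm_eq_sum_abs_eigenvalues {X : Matrix ι ι ℂ} (hX : X.IsHermitian) :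
    traceNorm X = ∑ i, |hX.eigenvalues i| := by
  set H := Matrix.isHermitian_conjTranspose_mul_self X
  obtain ⟨U, hU, -, hXU⟩ := exists_eigen_decomposition hX
  have hsq : Xᴴ * X = U * Matrix.diagonal (fun i => ((hX.eigenvalues i ^ 2 : ℝ) : ℂ)) * Uᴴ := by
    rw [hX.eq]
    generalize hX.eigenvalues = d at hXU
    rw [hXU, conj_diagonal_mul hU]
    congr 3
    ext i
    simp [sq]
  have hroots : (Xᴴ * X).charpoly.roots =
      Finset.univ.val.map fun i => ((hX.eigenvalues i ^ 2 : ℝ) : ℂ) := by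
    rw [hsq, Matrix.charpoly_mul_comm, ← Matrix.mul_assoc, hU, Matrix.one_mul,
      Matrix.charpoly_diagonal]
    have h := Polynomial.roots_multiset_prod_X_sub_C
      (Finset.univ.val.map fun i => ((hX.eigenvalues i ^ 2 : ℝ) : ℂ))
    rwa [Multiset.map_map] at h
  have h := H.roots_charpoly_eq_eigenvalues
  rw [hroots] at h
  have h' := congrArg (fun s : Multiset ℂ => (s.map fun z => √z.re).sum) h
  simp only [Multiset.map_map, Function.comp_def, Complex.ofReal_re, Real.sqrt_sq_eq_abs] at h'
  exact h'.symm

/-- Jordan decomposition. With `traceNorm_sub_le` it makes the trace norm of a Hermitian matrix the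
least value of `tr P + tr N`. -/
theorem exists_posSemidef_sub {X : Matrix ι ι ℂ} (hX : X.IsHermitian) :
    ∃ P N : Matrix ι ι ℂ, P.PosSemidef ∧ N.PosSemidef ∧ X = P - N ∧
      P.trace.re + N.trace.re = traceNorm X := by
  rw [traceNorm_eq_sum_abs_eigenvalues hX]
  obtain ⟨U, hU, -, hXU⟩ := exists_eigen_decomposition hX
  generalize hX.eigenvalues = d at hXU
  have psd : ∀ e : ι → ℝ, (∀ i, 0 ≤ e i) →
      (U * Matrix.diagonal (fun i => (e i : ℂ)) * Uᴴ).PosSemidef := fun e he =>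
    (Matrix.posSemidef_diagonal_iff.2 fun i => by exact_mod_cast he i).mul_mul_conjTranspose_same _
  have tr : ∀ e : ι → ℝ, (U * Matrix.diagonal (fun i => (e i : ℂ)) * Uᴴ).trace.re = ∑ i, e i := by
    intro e
    rw [Matrix.trace_mul_comm, ← Matrix.mul_assoc, hU, Matrix.one_mul, Matrix.trace_diagonal]
    simp
  refine ⟨_, _, psd (fun i => (d i)⁺) (fun i => posPart_nonneg _), psd (fun i => (d i)⁻)
    (fun i => negPart_nonneg _), ?_, ?_⟩
  · rw [← Matrix.sub_mul, ← Matrix.mul_sub, Matrix.diagonal_sub, hXU]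
    congr 3
    ext i
    rw [← Complex.ofReal_sub, posPart_sub_negPart]
  · rw [tr, tr, ← Finset.sum_add_distrib]
    exact Finset.sum_congr rfl fun i _ => posPart_add_negPart _

theorem traceNorm_sub_le {P N : Matrix ι ι ℂ} (hP : P.PosSemidef) (hN : N.PosSemidef) :
    traceNorm (P - N) ≤ P.trace.re + N.trace.re := by
  have hX : (P - N).IsHermitian := hP.1.sub hN.1
  rw [traceNorm_eq_sum_abs_eigenvalues hX]
  obtain ⟨U, hU, hU', hXU⟩ := exists_eigen_decomposition hX
  generalize hX.eigenvalues = d at hXU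
  have hd : ∀ i, d i = ((Uᴴ * P * U) i i).re - ((Uᴴ * N * U) i i).re := by
    intro i
    have : Uᴴ * (P - N) * U = Matrix.diagonal (fun i => (d i : ℂ)) := by
      rw [hXU]
      calc _ = (Uᴴ * U) * Matrix.diagonal (fun i => (d i : ℂ)) * (Uᴴ * U) := by
            simp only [Matrix.mul_assoc]
        _ = _ := by rw [hU, Matrix.one_mul, Matrix.mul_one]
    have h := congrArg Complex.re (congrFun (congrFun this i) i)
    rw [Matrix.mul_sub, Matrix.sub_mul] at h
    simpa using h.symm
  have nn : ∀ {Q : Matrix ι ι ℂ}, Q.PosSemidef → ∀ i, 0 ≤ ((Uᴴ * Q * U) i i).re := fun hQ i =>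
    (Complex.le_def.1 ((hQ.conjTranspose_mul_mul_same U).diag_nonneg (i := i))).1
  have tr : ∀ Q : Matrix ι ι ℂ, ∑ i, ((Uᴴ * Q * U) i i).re = Q.trace.re := fun Q => by
    rw [← Complex.re_sum]
    change (Uᴴ * Q * U).trace.re = _
    rw [Matrix.trace_mul_comm, ← Matrix.mul_assoc, hU', Matrix.one_mul]
  rw [← tr P, ← tr N, ← Finset.sum_add_distrib]
  refine Finset.sum_le_sum fun i _ => ?_
  rw [hd i]
  refine (abs_sub _ _).trans ?_
  rw [abs_of_nonneg (nn hP i), abs_of_nonneg (nn hN i)]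

/-- Positivity and trace are preserved, so an optimal decomposition `P - N` of `X` is carried to a
decomposition of `Λ X` with the same total trace. -/
theorem IsLOCC.traceNorm_le {A B A' B' : Type} [Fintype A] [DecidableEq A] [Fintype B]
    [DecidableEq B] [Fintype A'] [DecidableEq A'] [Fintype B'] [DecidableEq B']
    {Λ : Matrix (A × B) (A × B) ℂ → Matrix (A' × B') (A' × B') ℂ} (h : IsLOCC Λ)
    {X : Matrix (A × B) (A × B) ℂ} (hX : X.IsHermitian) : traceNorm (Λ X) ≤ traceNorm X := by
  obtain ⟨P, N, hP, hN, rfl, htr⟩ := exists_posSemidef_sub hX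
  rw [h.map_sub, ← htr, ← h.trace P, ← h.trace N]
  exact traceNorm_sub_le (h.posSemidef hP) (h.posSemidef hN)

theorem traceNorm_nonneg (X : Matrix ι ι ℂ) : 0 ≤ traceNorm X :=
  Finset.sum_nonneg fun _ _ => Real.sqrt_nonneg _

theorem traceNorm_zero : traceNorm (0 : Matrix ι ι ℂ) = 0 := by
  have := traceNorm_sub_le (Matrix.PosSemidef.zero (n := ι) (R := ℂ)) Matrix.PosSemidef.zero
  rw [sub_zero] at this
  exact le_antisymm (by simpa using this) (traceNorm_nonneg _)

theorem re_trace_mul_projection_le {P Q : Matrix ι ι ℂ} (hP : P.PosSemidef) (hQ : Qᴴ = Q)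
    (hQQ : Q * Q = Q) : 0 ≤ (P * Q).trace.re ∧ (P * Q).trace.re ≤ P.trace.re := by
  have aux : ∀ S : Matrix ι ι ℂ, Sᴴ = S → S * S = S → 0 ≤ (P * S).trace.re := by
    intro S hS hSS
    have h1 : (P * S).trace = (S * P * Sᴴ).trace := by
      rw [hS, Matrix.trace_mul_comm (S * P), ← Matrix.mul_assoc, hSS, Matrix.trace_mul_comm]
    rw [h1]
    exact (Complex.le_def.1 (hP.mul_mul_conjTranspose_same S).trace_nonneg).1
  refine ⟨aux Q hQ hQQ, ?_⟩
  have := aux (1 - Q) (by simp [hQ]) (by simp [Matrix.mul_sub, Matrix.sub_mul, hQQ])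
  rw [Matrix.mul_sub, Matrix.mul_one, Matrix.trace_sub, Complex.sub_re] at this
  linarith

/-- A projective test bounds the trace distance from below; it is applied with `Q` the projector on
a maximally entangled target. -/
theorem re_trace_mul_projection_sub_le {ρ σ Q : Matrix ι ι ℂ} (hρ : ρ.IsHermitian)
    (hσ : σ.IsHermitian) (hQ : Qᴴ = Q) (hQQ : Q * Q = Q) :
    (ρ * Q).trace.re - (σ * Q).trace.re ≤ traceNorm (σ - ρ) := by
  obtain ⟨P, N, hP, hN, hPN, htr⟩ := exists_posSemidef_sub (hσ.sub hρ)
  have h1 := re_trace_mul_projection_le hP hQ hQQ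
  have h2 := re_trace_mul_projection_le hN hQ hQQ
  have h3 : (ρ * Q).trace.re - (σ * Q).trace.re = (N * Q).trace.re - (P * Q).trace.re := by
    have h := congrArg (fun Z => (Z * Q).trace.re) hPN
    simp only [Matrix.sub_mul, Matrix.trace_sub, Complex.sub_re] at h
    linarith
  have h4 := (Complex.le_def.1 hP.trace_nonneg).1
  rw [h3, ← htr]
  simp only [Complex.zero_re] at h4
  linarith

/-- `|tr Y|² ≤ rank(Y) tr(Y Y†)`. -/
theorem norm_trace_sq_le_rank_mul (Y : Matrix ι ι ℂ) {K : ℕ} (hY : Y.rank ≤ K) :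
    ‖Y.trace‖ ^ 2 ≤ K * (Y * Yᴴ).trace.re := by
  have h0 : ∀ i, 0 ≤ (Matrix.isHermitian_conjTranspose_mul_self Y).eigenvalues i :=
    (Matrix.posSemidef_conjTranspose_mul_self Y).eigenvalues_nonneg
  have hrank := (Matrix.isHermitian_conjTranspose_mul_self Y).rank_eq_card_non_zero_eigs
  rw [Matrix.rank_conjTranspose_mul_self] at hrank
  obtain ⟨U, hU, hU', hD⟩ := exists_eigen_decomposition (Matrix.isHermitian_conjTranspose_mul_self Y)
  generalize (Matrix.isHermitian_conjTranspose_mul_self Y).eigenvalues = d at h0 hrank hD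
  have sumsq : ∀ (Z : Matrix ι ι ℂ) i, ((∑ a, ‖Z a i‖ ^ 2 : ℝ) : ℂ) = (Zᴴ * Z) i i := by
    intro Z i
    rw [Matrix.mul_apply, Complex.ofReal_sum]
    refine Finset.sum_congr rfl fun a _ => ?_
    rw [Matrix.conjTranspose_apply, Complex.star_def, Complex.conj_mul']
    norm_cast
  have hYU : (Y * U)ᴴ * (Y * U) = Matrix.diagonal (fun i => (d i : ℂ)) := by
    calc _ = Uᴴ * (Yᴴ * Y) * U := by simp only [Matrix.conjTranspose_mul, Matrix.mul_assoc]
      _ = (Uᴴ * U) * Matrix.diagonal (fun i => (d i : ℂ)) * (Uᴴ * U) := by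
          rw [hD]
          simp only [Matrix.mul_assoc]
      _ = _ := by rw [hU, Matrix.one_mul, Matrix.mul_one]
  -- In an eigenbasis of `Yᴴ Y`, Cauchy-Schwarz bounds each diagonal entry of `Y` by a singular
  -- value. Only rank-many of these are nonzero, and a second Cauchy-Schwarz produces the rank as a
  -- factor.
  have hdiag : ∀ i, ‖(Uᴴ * (Y * U)) i i‖ ≤ √(d i) := by
    intro i
    apply Real.le_sqrt_of_sq_le
    have e1 : ∑ a, ‖U a i‖ ^ 2 = 1 := by
      have := sumsq U i
      rw [hU, Matrix.one_apply_eq] at this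
      exact_mod_cast this
    have e2 : ∑ a, ‖(Y * U) a i‖ ^ 2 = d i := by
      have := sumsq (Y * U) i
      rw [hYU, Matrix.diagonal_apply_eq] at this
      exact_mod_cast this
    calc ‖(Uᴴ * (Y * U)) i i‖ ^ 2 ≤ (∑ a, ‖U a i‖ * ‖(Y * U) a i‖) ^ 2 := by
          gcongr
          rw [Matrix.mul_apply]
          refine (norm_sum_le _ _).trans (Finset.sum_le_sum fun a _ => ?_)
          rw [norm_mul, Matrix.conjTranspose_apply, norm_star]
      _ ≤ (∑ a, ‖U a i‖ ^ 2) * ∑ a, ‖(Y * U) a i‖ ^ 2 := Finset.sum_mul_sq_le_sq_mul_sq _ _ _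
      _ = d i := by rw [e1, e2, one_mul]
  have htr : Y.trace = ∑ i, (Uᴴ * (Y * U)) i i := by
    change _ = (Uᴴ * (Y * U)).trace
    rw [Matrix.trace_mul_comm, Matrix.mul_assoc, hU', Matrix.mul_one]
  have hsum : (Y * Yᴴ).trace.re = ∑ i, d i := by
    rw [Matrix.trace_mul_comm, hD, Matrix.trace_mul_comm, ← Matrix.mul_assoc, hU, Matrix.one_mul,
      Matrix.trace_diagonal]
    simp
  have hle : ‖Y.trace‖ ≤ ∑ i with d i ≠ 0, √(d i) := by
    rw [htr]
    refine (norm_sum_le _ _).trans ((Finset.sum_le_sum fun i _ => hdiag i).trans (le_of_eq ?_))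
    rw [Finset.sum_filter]
    refine Finset.sum_congr rfl fun i _ => ?_
    split_ifs with h
    · rfl
    · rw [not_not.1 h, Real.sqrt_zero]
  have hcard : ((Finset.univ.filter fun i => d i ≠ 0).card : ℝ) ≤ K := by
    rw [Fintype.card_subtype] at hrank
    rw [← hrank]
    exact_mod_cast hY
  calc ‖Y.trace‖ ^ 2 ≤ (∑ i with d i ≠ 0, √(d i)) ^ 2 := by gcongr
    _ ≤ (Finset.univ.filter fun i => d i ≠ 0).card * ∑ i with d i ≠ 0, √(d i) ^ 2 :=
        sq_sum_le_card_mul_sum_sq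
    _ ≤ K * ∑ i, √(d i) ^ 2 := by
        refine mul_le_mul hcard ?_ (Finset.sum_nonneg fun _ _ => sq_nonneg _) (Nat.cast_nonneg _)
        exact Finset.sum_le_sum_of_subset_of_nonneg (Finset.filter_subset _ _)
          fun _ _ _ => sq_nonneg _
    _ = K * (Y * Yᴴ).trace.re := by
        rw [hsum]
        congr 1
        exact Finset.sum_congr rfl fun i _ => Real.sq_sqrt (h0 i)

end TraceNorm

/-! ### Tensor products of LOCC maps -/

section Tensor

set_option linter.unusedSectionVars false

variable {A B A' B' C D : Type} [Fintype A] [DecidableEq A] [Fintype B]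
  [DecidableEq B] [Fintype A'] [DecidableEq A'] [Fintype B'] [DecidableEq B']
  [Fintype C] [DecidableEq C] [Fintype D] [DecidableEq D]

theorem LOCCReach.isDensity {ρ : Matrix (A × B) (A × B) ℂ} {σ : Matrix (A' × B') (A' × B') ℂ}
    (h : LOCCReach ρ σ) (hρ : IsDensity ρ) : IsDensity σ := by
  obtain ⟨Λ, hΛ, rfl⟩ := h
  exact hΛ.isDensity hρ

/-- Local relabelling of the basis vectors. -/
theorem LOCCReach.relabel (e : A' ≃ A) (f : B' ≃ B) (ρ : Matrix (A × B) (A × B) ℂ) :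
    LOCCReach ρ (ρ.submatrix (Prod.map e f) (Prod.map e f)) := by
  have h := LOCCReach.local_isometry ((1 : Matrix A A ℂ).submatrix e id)
    ((1 : Matrix B B ℂ).submatrix f id)
    (by
      rw [Matrix.conjTranspose_submatrix, Matrix.submatrix_mul_equiv]
      simp)
    (by
      rw [Matrix.conjTranspose_submatrix, Matrix.submatrix_mul_equiv]
      simp) ρ
  have e1 : (1 : Matrix A A ℂ).submatrix e id ⊗ₖ (1 : Matrix B B ℂ).submatrix f id =
      (1 : Matrix (A × B) (A × B) ℂ).submatrix (Prod.map e f) id := by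
    rw [← Matrix.one_kronecker_one]
    rfl
  have e2 : ((1 : Matrix (A × B) (A × B) ℂ).submatrix (Prod.map e f) id) * ρ *
      ((1 : Matrix (A × B) (A × B) ℂ).submatrix (Prod.map e f) id)ᴴ =
      ρ.submatrix (Prod.map e f) (Prod.map e f) := by
    ext x y
    simp [Matrix.mul_apply, Matrix.one_apply]
  rwa [e1, e2] at h

/-- The tensor product of two bipartite operators, as an operator on `(A ⊗ C) ⊗ (B ⊗ D)`. -/
def bipartiteTensor {A B C D : Type} (ρ : Matrix (A × B) (A × B) ℂ)
    (ω : Matrix (C × D) (C × D) ℂ) : Matrix ((A × C) × (B × D)) ((A × C) × (B × D)) ℂ :=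
  (ρ ⊗ₖ ω).submatrix (Equiv.prodProdProdComm A C B D) (Equiv.prodProdProdComm A C B D)

theorem alice_sandwich_bipartiteTensor (K : Matrix A' A ℂ) (ρ : Matrix (A × B) (A × B) ℂ)
    (ω : Matrix (C × D) (C × D) ℂ) :
    ((K ⊗ₖ (1 : Matrix C C ℂ)) ⊗ₖ (1 : Matrix (B × D) (B × D) ℂ)) * bipartiteTensor ρ ω *
      ((K ⊗ₖ (1 : Matrix C C ℂ)) ⊗ₖ (1 : Matrix (B × D) (B × D) ℂ))ᴴ =
    bipartiteTensor ((K ⊗ₖ (1 : Matrix B B ℂ)) * ρ * (K ⊗ₖ (1 : Matrix B B ℂ))ᴴ) ω := by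
  have : (K ⊗ₖ (1 : Matrix C C ℂ)) ⊗ₖ (1 : Matrix (B × D) (B × D) ℂ) =
      ((K ⊗ₖ (1 : Matrix B B ℂ)) ⊗ₖ (1 : Matrix (C × D) (C × D) ℂ)).submatrix
        (Equiv.prodProdProdComm A' C B D) (Equiv.prodProdProdComm A C B D) := by
    ext ⟨⟨a, c⟩, b, d⟩ ⟨⟨a', c'⟩, b', d'⟩
    simp [Matrix.kroneckerMap_apply, Matrix.one_apply, ite_and]
    split_ifs <;> rfl
  rw [this, bipartiteTensor, bipartiteTensor, Matrix.conjTranspose_submatrix,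
    Matrix.submatrix_mul_equiv, Matrix.submatrix_mul_equiv, Matrix.conjTranspose_kronecker _ 1,
    ← Matrix.mul_kronecker_mul, ← Matrix.mul_kronecker_mul]
  simp

theorem bob_sandwich_bipartiteTensor (K : Matrix B' B ℂ) (ρ : Matrix (A × B) (A × B) ℂ)
    (ω : Matrix (C × D) (C × D) ℂ) :
    ((1 : Matrix (A × C) (A × C) ℂ) ⊗ₖ (K ⊗ₖ (1 : Matrix D D ℂ))) * bipartiteTensor ρ ω *
      ((1 : Matrix (A × C) (A × C) ℂ) ⊗ₖ (K ⊗ₖ (1 : Matrix D D ℂ)))ᴴ =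
    bipartiteTensor (((1 : Matrix A A ℂ) ⊗ₖ K) * ρ * ((1 : Matrix A A ℂ) ⊗ₖ K)ᴴ) ω := by
  have : (1 : Matrix (A × C) (A × C) ℂ) ⊗ₖ (K ⊗ₖ (1 : Matrix D D ℂ)) =
      (((1 : Matrix A A ℂ) ⊗ₖ K) ⊗ₖ (1 : Matrix (C × D) (C × D) ℂ)).submatrix
        (Equiv.prodProdProdComm A C B' D) (Equiv.prodProdProdComm A C B D) := by
    ext ⟨⟨a, c⟩, b, d⟩ ⟨⟨a', c'⟩, b', d'⟩
    simp [Matrix.kroneckerMap_apply, Matrix.one_apply, ite_and]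
    split_ifs <;> rfl
  rw [this, bipartiteTensor, bipartiteTensor, Matrix.conjTranspose_submatrix,
    Matrix.submatrix_mul_equiv, Matrix.submatrix_mul_equiv, Matrix.conjTranspose_kronecker _ 1,
    ← Matrix.mul_kronecker_mul, ← Matrix.mul_kronecker_mul]
  simp

theorem bipartiteTensor_sum {ι : Type*} (s : Finset ι) (ρ : ι → Matrix (A × B) (A × B) ℂ)
    (ω : Matrix (C × D) (C × D) ℂ) :
    bipartiteTensor (∑ i ∈ s, ρ i) ω = ∑ i ∈ s, bipartiteTensor (ρ i) ω := by
  ext x y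
  simp [bipartiteTensor, Matrix.sum_apply, Finset.sum_mul]

theorem sum_kronecker_one {ι : Type} [Fintype ι] {A₁ : ι → Type} [∀ i, Fintype (A₁ i)]
    [∀ i, DecidableEq (A₁ i)] (K : ∀ i, Matrix (A₁ i) A ℂ) (hK : ∑ i, (K i)ᴴ * K i = 1) :
    ∑ i, (K i ⊗ₖ (1 : Matrix C C ℂ))ᴴ * (K i ⊗ₖ (1 : Matrix C C ℂ)) = 1 := by
  have : ∀ i, (K i ⊗ₖ (1 : Matrix C C ℂ))ᴴ * (K i ⊗ₖ (1 : Matrix C C ℂ)) =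
      ((K i)ᴴ * K i) ⊗ₖ (1 : Matrix C C ℂ) := fun i => by
    rw [Matrix.conjTranspose_kronecker, ← Matrix.mul_kronecker_mul]
    simp
  simp only [this]
  rw [← Matrix.one_kronecker_one, ← hK]
  ext x y
  simp [Matrix.sum_apply, Finset.sum_mul]

/-- The same protocol is run with `C` and `D` idle. The induction follows only the given product
operator, so the extended map need not be described elsewhere. -/
theorem IsLOCC.reach_bipartiteTensor
    {Λ : Matrix (A × B) (A × B) ℂ → Matrix (A' × B') (A' × B') ℂ} (h : IsLOCC Λ)
    (ω : Matrix (C × D) (C × D) ℂ) (ρ : Matrix (A × B) (A × B) ℂ) :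
    LOCCReach (bipartiteTensor ρ ω) (bipartiteTensor (Λ ρ) ω) := by
  induction h with
  | done => exact ⟨_, IsLOCC.done, rfl⟩
  | @alice A B _ _ _ _ ι _ A₁ _ _ K hK Λ hΛ ih =>
    choose Γ hΓ hΓρ using fun i => ih i
      ((K i ⊗ₖ (1 : Matrix B B ℂ)) * ρ * (K i ⊗ₖ (1 : Matrix B B ℂ))ᴴ)
    refine ⟨_, IsLOCC.alice (fun i => A₁ i × C) (fun i => K i ⊗ₖ (1 : Matrix C C ℂ))
      (sum_kronecker_one K hK) Γ hΓ, ?_⟩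
    simp only [alice_sandwich_bipartiteTensor, hΓρ, bipartiteTensor_sum]
  | @bob A B _ _ _ _ ι _ B₁ _ _ K hK Λ hΛ ih =>
    choose Γ hΓ hΓρ using fun i => ih i
      (((1 : Matrix A A ℂ) ⊗ₖ K i) * ρ * ((1 : Matrix A A ℂ) ⊗ₖ K i)ᴴ)
    refine ⟨_, IsLOCC.bob (fun i => B₁ i × D) (fun i => K i ⊗ₖ (1 : Matrix D D ℂ))
      (sum_kronecker_one K hK) Γ hΓ, ?_⟩
    simp only [bob_sandwich_bipartiteTensor, hΓρ, bipartiteTensor_sum]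

theorem LOCCReach.bipartiteTensor_left {ρ : Matrix (A × B) (A × B) ℂ}
    {σ : Matrix (A' × B') (A' × B') ℂ} (h : LOCCReach ρ σ) (ω : Matrix (C × D) (C × D) ℂ) :
    LOCCReach (bipartiteTensor ρ ω) (bipartiteTensor σ ω) := by
  obtain ⟨Λ, hΛ, rfl⟩ := h
  exact hΛ.reach_bipartiteTensor ω ρ

theorem LOCCReach.bipartiteTensor_swap (ρ : Matrix (A × B) (A × B) ℂ)
    (ω : Matrix (C × D) (C × D) ℂ) : LOCCReach (bipartiteTensor ρ ω) (bipartiteTensor ω ρ) := by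
  have h := LOCCReach.relabel (Equiv.prodComm C A) (Equiv.prodComm D B) (bipartiteTensor ρ ω)
  convert h using 1
  ext ⟨⟨a, c⟩, b, d⟩ ⟨⟨a', c'⟩, b', d'⟩
  simp [bipartiteTensor, mul_comm]

theorem LOCCReach.bipartiteTensor_right {ρ : Matrix (A × B) (A × B) ℂ}
    {σ : Matrix (A' × B') (A' × B') ℂ} (h : LOCCReach ρ σ) (ω : Matrix (C × D) (C × D) ℂ) :
    LOCCReach (bipartiteTensor ω ρ) (bipartiteTensor ω σ) :=
  ((bipartiteTensor_swap ω ρ).trans (h.bipartiteTensor_left ω)).trans (bipartiteTensor_swap σ ω)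

theorem LOCCReach.tensorPower_succ (ρ : Matrix (A × B) (A × B) ℂ) (n : ℕ) :
    LOCCReach (tensorPower ρ (n + 1)) (bipartiteTensor ρ (tensorPower ρ n)) := by
  have h := LOCCReach.relabel (Fin.consEquiv fun _ => A) (Fin.consEquiv fun _ => B)
    (tensorPower ρ (n + 1))
  convert h using 1
  ext ⟨⟨a, c⟩, b, d⟩ ⟨⟨a', c'⟩, b', d'⟩
  simp [bipartiteTensor, tensorPower, Fin.prod_univ_succ]

theorem LOCCReach.succ_tensorPower (ρ : Matrix (A × B) (A × B) ℂ) (n : ℕ) :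
    LOCCReach (bipartiteTensor ρ (tensorPower ρ n)) (tensorPower ρ (n + 1)) := by
  have h := LOCCReach.relabel (Fin.consEquiv fun _ => A).symm (Fin.consEquiv fun _ => B).symm
    (bipartiteTensor ρ (tensorPower ρ n))
  convert h using 1
  ext ⟨x, y⟩ ⟨x', y'⟩
  simp [bipartiteTensor, tensorPower, Fin.prod_univ_succ, Fin.consEquiv, Fin.tail]

theorem LOCCReach.tensorPower {ρ : Matrix (A × B) (A × B) ℂ} {σ : Matrix (A' × B') (A' × B') ℂ}
    (h : LOCCReach ρ σ) (n : ℕ) : LOCCReach (tensorPower ρ n) (tensorPower σ n) := by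
  induction n with
  | zero =>
    have h := LOCCReach.relabel (Equiv.ofUnique (Fin 0 → A') (Fin 0 → A))
      (Equiv.ofUnique (Fin 0 → B') (Fin 0 → B)) (RealMasking.tensorPower ρ 0)
    convert h using 1
    ext x y
    simp [RealMasking.tensorPower]
  | succ n ih =>
    exact (((tensorPower_succ ρ n).trans (h.bipartiteTensor_left _)).trans
      (ih.bipartiteTensor_right _)).trans (succ_tensorPower σ n)

theorem isDensity_bipartiteTensor {ρ : Matrix (A × B) (A × B) ℂ} {ω : Matrix (C × D) (C × D) ℂ}
    (hρ : IsDensity ρ) (hω : IsDensity ω) : IsDensity (bipartiteTensor ρ ω) := by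
  refine ⟨(hρ.1.kronecker hω.1).submatrix _, ?_⟩
  rw [bipartiteTensor]
  have : ∀ (M : Matrix ((A × B) × (C × D)) ((A × B) × (C × D)) ℂ)
      (e : (A × C) × (B × D) ≃ (A × B) × (C × D)), (M.submatrix e e).trace = M.trace :=
    fun M e => Fintype.sum_equiv e _ _ fun _ => rfl
  rw [this, Matrix.trace_kronecker, hρ.2, hω.2, one_mul]

theorem isDensity_tensorPower {ρ : Matrix (A × B) (A × B) ℂ} (hρ : IsDensity ρ) (n : ℕ) :
    IsDensity (tensorPower ρ n) := by
  induction n with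
  | zero =>
    have : tensorPower ρ 0 = 1 := by
      ext x y
      rw [Subsingleton.elim x y]
      simp [tensorPower]
    rw [this]
    refine ⟨Matrix.PosSemidef.one, ?_⟩
    simp [Matrix.trace]
  | succ n ih => exact (LOCCReach.succ_tensorPower ρ n).isDensity (isDensity_bipartiteTensor hρ ih)

end Tensor

/-! ### The entanglement cost -/

section Cost

set_option linter.unusedSectionVars false

variable {A B : Type} [Fintype A] [DecidableEq A] [Fintype B] [DecidableEq B]

/-- The coefficient matrix of the maximally entangled ket on `B ⊗ B`. -/
def uniformCoeff (B : Type) [Fintype B] [DecidableEq B] : Matrix B B ℂ :=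
  ((1 / √(Fintype.card B : ℝ) : ℝ) : ℂ) • 1

theorem ketBra_stdMaxEntangled (m : ℕ) :
    ketBra (stdMaxEntangled m) = pureOp (uniformCoeff (Fin m)) := by
  unfold pureOp
  congr 1
  ext p
  simp [stdMaxEntangled, uniformCoeff, Matrix.one_apply]

theorem uniformCoeff_mul_conjTranspose :
    uniformCoeff B * (uniformCoeff B)ᴴ = ((Fintype.card B : ℝ)⁻¹ : ℂ) • 1 := by
  rw [uniformCoeff, Matrix.conjTranspose_smul, Matrix.conjTranspose_one, Matrix.smul_mul,
    Matrix.mul_smul, Matrix.mul_one, smul_smul, Complex.star_def, Complex.conj_ofReal,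
    ← Complex.ofReal_mul, div_mul_div_comm, Real.mul_self_sqrt (Nat.cast_nonneg _)]
  simp

theorem trace_uniformCoeff [Nonempty B] : (uniformCoeff B * (uniformCoeff B)ᴴ).trace = 1 := by
  rw [uniformCoeff_mul_conjTranspose, Matrix.trace_smul, Matrix.trace_one]
  simp

theorem isMaxEntangled_uniformCoeff :
    IsMaxEntangled (Fintype.card B) fun p : B × B => uniformCoeff B p.1 p.2 := by
  let e := (Fintype.equivFin B).symm
  have h : ((1 : Matrix B B ℂ).submatrix id e)ᴴ * (1 : Matrix B B ℂ).submatrix id e = 1 := by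
    ext i j
    simp [Matrix.mul_apply, Matrix.one_apply]
  refine ⟨(1 : Matrix B B ℂ).submatrix id e, (1 : Matrix B B ℂ).submatrix id e, h, h, ?_⟩
  intro a b
  have : ∑ j, (1 : Matrix B B ℂ).submatrix id e a j * (1 : Matrix B B ℂ).submatrix id e b j =
      (1 : Matrix B B ℂ) a b := by
    refine (e.sum_comp fun x => (1 : Matrix B B ℂ) a x * (1 : Matrix B B ℂ) b x).trans ?_
    simp [Matrix.one_apply]
  rw [this]
  simp [uniformCoeff]

theorem isMaxEntangled_stdMaxEntangled (m : ℕ) : IsMaxEntangled m (stdMaxEntangled m) := by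
  have h := isMaxEntangled_uniformCoeff (B := Fin m)
  rw [Fintype.card_fin] at h
  convert h using 1
  ext p
  simp [stdMaxEntangled, uniformCoeff, Matrix.one_apply]

theorem LOCCReach.maxEntangled_of_uniform [Nonempty B] {A' B' : Type} [Fintype A'] [DecidableEq A']
    [Fintype B'] [DecidableEq B'] {k : ℕ} (hk : 0 < k) (hkB : k ≤ Fintype.card B)
    {Φ : A' × B' → ℂ} (hΦ : IsMaxEntangled k Φ) :
    LOCCReach (pureOp (uniformCoeff B)) (ketBra Φ) := by
  refine LOCCReach.maxEntangled hk trace_uniformCoeff (U := 1)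
    (l := fun _ => (Fintype.card B : ℝ)⁻¹) (by simp) (by simp) ?_ (fun _ => by positivity)
    (fun _ => ?_) hΦ
  · rw [uniformCoeff_mul_conjTranspose]
    ext i j
    simp [Matrix.one_apply]
  · rw [one_div]
    have : (k : ℝ) ≤ Fintype.card B := by exact_mod_cast hkB
    exact inv_anti₀ (by exact_mod_cast hk) this

/-- Preparation without error: since `n ^ N ≤ 2 ^ (s N)`, the resource converts to the maximally
entangled state on two copies of Bob's `N`-fold system, and this yields every state of `N` copies.
Alice's dimension plays no role. -/
theorem isAchievableRate_of_card_le {m n : ℕ} {ρ : Matrix (Fin m × Fin n) (Fin m × Fin n) ℂ}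
    (hρ : IsDensity ρ) {s : ℕ} (hs : n ≤ 2 ^ s) : IsAchievableRate ρ s := by
  -- With this instance `Fin n`, and then `Fin N → Fin n`, is a group, as `LOCCReach.of_uniform`
  -- requires.
  have hn : NeZero n := by
    refine ⟨?_⟩
    rintro rfl
    have := hρ.2
    simp [Matrix.trace] at this
  have hfl : ∀ N : ℕ, ⌊(s : ℝ) * N⌋₊ = s * N := fun N => by
    rw [← Nat.cast_mul, Nat.floor_natCast]
  have key : ∀ N : ℕ, LOCCReach (ketBra (stdMaxEntangled (2 ^ ⌊(s : ℝ) * N⌋₊)))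
      (tensorPower ρ N) := by
    intro N
    rw [hfl, ketBra_stdMaxEntangled]
    have : NeZero (2 ^ (s * N)) := ⟨by positivity⟩
    have h1 : LOCCReach (pureOp (uniformCoeff (Fin (2 ^ (s * N)))))
        (pureOp (uniformCoeff (Fin N → Fin n))) :=
      LOCCReach.maxEntangled_of_uniform Fintype.card_pos
        (by
          rw [Fintype.card_fin, Fintype.card_fun, Fintype.card_fin, Fintype.card_fin, pow_mul]
          exact Nat.pow_le_pow_left hs N) isMaxEntangled_uniformCoeff
    exact h1.trans (LOCCReach.of_uniform (isDensity_tensorPower hρ N))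
  choose Λ hΛ hΛρ using key
  refine ⟨Nat.cast_nonneg _, Λ, hΛ, ?_⟩
  simp only [hΛρ, sub_self, traceNorm_zero]
  exact tendsto_const_nhds

theorem isDensity_stdMaxEntangled {m : ℕ} (hm : 0 < m) : IsDensity (ketBra (stdMaxEntangled m)) := by
  have : Nonempty (Fin m) := ⟨⟨0, hm⟩⟩
  rw [ketBra_stdMaxEntangled]
  exact isDensity_pureOp trace_uniformCoeff

/-- The conversion is applied to all copies after the protocol for `ρ`; contraction of the trace
norm keeps the error under control. -/
theorem IsAchievableRate.of_reach {A' B' : Type} [Fintype A'] [DecidableEq A']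
    [Fintype B'] [DecidableEq B'] {ρ : Matrix (A × B) (A × B) ℂ}
    {σ : Matrix (A' × B') (A' × B') ℂ} (hρ : IsDensity ρ) (h : LOCCReach ρ σ) {r : ℝ}
    (hr : IsAchievableRate ρ r) : IsAchievableRate σ r := by
  obtain ⟨hr0, Λ, hΛ, hlim⟩ := hr
  choose Γ hΓ hΓρ using fun n => h.tensorPower n
  refine ⟨hr0, fun n ω => Γ n (Λ n ω), fun n => (hΓ n).comp (hΛ n), ?_⟩
  refine squeeze_zero (fun n => traceNorm_nonneg _) (fun n => ?_) hlim
  rw [← hΓρ n, ← (hΓ n).map_sub]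
  refine (hΓ n).traceNorm_le ?_
  exact ((hΛ n).isDensity (isDensity_stdMaxEntangled (by positivity))).1.1.sub
    (isDensity_tensorPower hρ n).1.1

/-- LOCC enlarges the set of achievable rates. Comparing infima also needs a lower bound and some
achievable rate for `ρ`; the latter comes from exact preparation. -/
theorem isEntanglementMonotone_entanglementCost : IsEntanglementMonotone entanglementCost := by
  intro m n m' n' Λ hΛ ρ hρ
  refine csInf_le_csInf ⟨0, fun r hr => hr.1⟩ ?_ ?_
  · exact ⟨_, isAchievableRate_of_card_le hρ (s := n) Nat.lt_two_pow_self.le⟩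
  · exact fun r hr => hr.of_reach hρ ⟨Λ, hΛ, rfl⟩

theorem trace_pureOp_mul_uniform (Y : Matrix B B ℂ) :
    (pureOp Y * pureOp (uniformCoeff B)).trace.re = ‖Y.trace‖ ^ 2 / Fintype.card B := by
  have : (pureOp Y * pureOp (uniformCoeff B)).trace =
      (Y.trace * star Y.trace) * ((Fintype.card B : ℝ)⁻¹ : ℝ) := by
    have e1 : (star fun p : B × B => Y p.1 p.2) ⬝ᵥ (fun p : B × B => uniformCoeff B p.1 p.2) =
        ((1 / √(Fintype.card B : ℝ) : ℝ) : ℂ) * star Y.trace := by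
      simp [dotProduct, uniformCoeff, Fintype.sum_prod_type, Matrix.one_apply, Matrix.trace,
        Finset.mul_sum, mul_comm]
    have e2 : (fun p : B × B => Y p.1 p.2) ⬝ᵥ (star fun p : B × B => uniformCoeff B p.1 p.2) =
        ((1 / √(Fintype.card B : ℝ) : ℝ) : ℂ) * Y.trace := by
      simp [dotProduct, uniformCoeff, Fintype.sum_prod_type, Matrix.one_apply, Matrix.trace,
        Finset.mul_sum, mul_comm, apply_ite]
    have e3 : (((1 / √(Fintype.card B : ℝ) : ℝ) : ℂ)) * ((1 / √(Fintype.card B : ℝ) : ℝ) : ℂ) =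
        ((Fintype.card B : ℝ)⁻¹ : ℝ) := by
      rw [← Complex.ofReal_mul, div_mul_div_comm, Real.mul_self_sqrt (Nat.cast_nonneg _)]
      simp
    rw [pureOp, pureOp, ketBra, ketBra, Matrix.vecMulVec_mul_vecMulVec, e1, Matrix.trace_vecMulVec,
      dotProduct_smul, e2, ← e3, smul_eq_mul]
    ring
  rw [this, Complex.star_def, Complex.mul_conj']
  rw [div_eq_mul_inv]
  norm_cast

theorem pureOp_isProjection {X : Matrix A B ℂ} (hX : (X * Xᴴ).trace = 1) :
    (pureOp X)ᴴ = pureOp X ∧ pureOp X * pureOp X = pureOp X := by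
  refine ⟨(pureOp_posSemidef X).1, ?_⟩
  rw [pureOp, ketBra, Matrix.vecMulVec_mul_vecMulVec]
  have : (star fun p : A × B => X p.1 p.2) ⬝ᵥ (fun p : A × B => X p.1 p.2) = 1 := by
    rw [← hX, ← trace_pureOp, pureOp, ketBra, Matrix.trace_vecMulVec, dotProduct_comm]
  rw [this]
  simp

/-- LOCC transforms a state of Schmidt rank `|A|` to a state whose fidelity with the maximally
entangled state of `B ⊗ B` is at most `|A| / |B|`. -/
theorem IsLOCC.fidelity_le {Λ : Matrix (A × A) (A × A) ℂ → Matrix (B × B) (B × B) ℂ}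
    (h : IsLOCC Λ) {X : Matrix A A ℂ} (hX : (X * Xᴴ).trace = 1) :
    (Λ (pureOp X) * pureOp (uniformCoeff B)).trace.re ≤ Fintype.card A / Fintype.card B := by
  have htr := h.trace (pureOp X)
  obtain ⟨κ, _, a, b, -, hΛ⟩ := h.exists_kraus
  simp only [hΛ, kronecker_sandwich_pureOp] at htr ⊢
  rw [trace_pureOp, hX, Matrix.trace_sum] at htr
  simp only [trace_pureOp] at htr
  rw [Finset.sum_mul, Matrix.trace_sum, Complex.re_sum]
  simp only [trace_pureOp_mul_uniform]
  rw [← Finset.sum_div]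
  refine div_le_div_of_nonneg_right ?_ (Nat.cast_nonneg _)
  calc ∑ s, ‖(a s * X * (b s)ᵀ).trace‖ ^ 2
      ≤ ∑ s, (Fintype.card A : ℝ) * ((a s * X * (b s)ᵀ) * (a s * X * (b s)ᵀ)ᴴ).trace.re := by
        refine Finset.sum_le_sum fun s _ => norm_trace_sq_le_rank_mul _ ?_
        exact (Matrix.rank_mul_le_right _ _).trans (Matrix.rank_le_card_height _)
    _ = Fintype.card A := by
        rw [← Finset.mul_sum, ← Complex.re_sum, htr]
        simp

theorem tensorPower_uniform (m n : ℕ) :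
    tensorPower (pureOp (uniformCoeff (Fin m))) n = pureOp (uniformCoeff (Fin n → Fin m)) := by
  have h1 : ∀ x y : Fin n → Fin m, ∏ k, uniformCoeff (Fin m) (x k) (y k) =
      uniformCoeff (Fin n → Fin m) x y := by
    intro x y
    rcases eq_or_ne x y with rfl | hxy
    · have : √((m : ℝ) ^ n) = √(m : ℝ) ^ n := by
        rw [Real.sqrt_eq_iff_mul_self_eq (by positivity) (by positivity), ← mul_pow,
          Real.mul_self_sqrt (Nat.cast_nonneg _)]
      simp [uniformCoeff, this]
    · obtain ⟨k, hk⟩ := Function.ne_iff.1 hxy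
      rw [Finset.prod_eq_zero (Finset.mem_univ k) (by simp [uniformCoeff, hk])]
      simp [uniformCoeff, hxy]
  ext ⟨x, y⟩ ⟨x', y'⟩
  simp only [tensorPower, pureOp, ketBra, Matrix.of_apply, Matrix.vecMulVec_apply, Pi.star_apply,
    Finset.prod_mul_distrib, h1]
  rw [← star_prod, h1]

/-- Rate `p` is exact. For `r < p` the fidelity with `n` copies is at most `2 ^ (r n) / 2 ^ (p n)`,
which tends to zero, so the trace distance stays away from zero. -/
theorem entanglementCost_stdMaxEntangled (p : ℕ) :
    entanglementCost (2 ^ p) (2 ^ p) (ketBra (stdMaxEntangled (2 ^ p))) = p := by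
  have hdens : IsDensity (ketBra (stdMaxEntangled (2 ^ p))) :=
    isDensity_stdMaxEntangled (by positivity)
  refine IsLeast.csInf_eq ⟨isAchievableRate_of_card_le hdens le_rfl, ?_⟩
  rintro r ⟨hr0, Λ, hΛ, hlim⟩
  by_contra! hrp
  have hbound : ∀ n : ℕ, 1 - ((2 : ℝ) ^ (r - p)) ^ n ≤
      traceNorm (Λ n (ketBra (stdMaxEntangled (2 ^ ⌊r * n⌋₊))) -
        tensorPower (ketBra (stdMaxEntangled (2 ^ p))) n) := by
    intro n
    have : NeZero (2 ^ ⌊r * n⌋₊) := ⟨by positivity⟩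
    have : NeZero (2 ^ p) := ⟨by positivity⟩
    have hσ := (hΛ n).isDensity (isDensity_stdMaxEntangled (m := 2 ^ ⌊r * n⌋₊) (by positivity))
    have hρ := isDensity_tensorPower hdens n
    have hfid := (hΛ n).fidelity_le (trace_uniformCoeff (B := Fin (2 ^ ⌊r * n⌋₊)))
    simp only [ketBra_stdMaxEntangled, tensorPower_uniform] at hσ hρ ⊢
    obtain ⟨hQ, hQQ⟩ := pureOp_isProjection (trace_uniformCoeff (B := Fin n → Fin (2 ^ p)))
    have h1 := re_trace_mul_projection_sub_le hρ.1.1 hσ.1.1 hQ hQQ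
    rw [hQQ, hρ.2] at h1
    have h2 : (Fintype.card (Fin (2 ^ ⌊r * n⌋₊)) : ℝ) / Fintype.card (Fin n → Fin (2 ^ p)) ≤
        ((2 : ℝ) ^ (r - p)) ^ n := by
      rw [Fintype.card_fin, Fintype.card_fun, Fintype.card_fin, Fintype.card_fin]
      push_cast
      rw [← pow_mul, ← Real.rpow_natCast, ← Real.rpow_natCast, ← Real.rpow_sub two_pos,
        ← Real.rpow_natCast, ← Real.rpow_mul two_pos.le]
      refine Real.rpow_le_rpow_of_exponent_le one_le_two ?_
      have := Nat.floor_le (mul_nonneg hr0 (Nat.cast_nonneg n))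
      push_cast
      linarith
    rw [Complex.one_re] at h1
    linarith
  have h0 : (2 : ℝ) ^ (r - p) < 1 := Real.rpow_lt_one_of_one_lt_of_neg one_lt_two (by linarith)
  have hl := (tendsto_pow_atTop_nhds_zero_of_lt_one (Real.rpow_nonneg two_pos.le _) h0).const_sub 1
  have := le_of_tendsto_of_tendsto' hl hlim hbound
  norm_num at this

end Cost

/-! ### Clifford families -/

section Clifford

set_option linter.unusedSectionVars false

variable {R : Type} [CommRing R] [StarRing R]

/-- A family of pairwise anticommuting skew-Hermitian matrices that square to `-1`. -/
structure IsCliffordFamily {κ ι : Type} [Fintype ι] [DecidableEq ι] (J : κ → Matrix ι ι R) :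
    Prop where
  conjTranspose : ∀ i, (J i)ᴴ = -J i
  mul_self : ∀ i, J i * J i = -1
  anticomm : ∀ i j, i ≠ j → J i * J j = -(J j * J i)

theorem IsCliffordFamily.comp {κ κ' ι : Type} [Fintype ι] [DecidableEq ι]
    {J : κ → Matrix ι ι R} (hJ : IsCliffordFamily J) (f : κ' ↪ κ) :
    IsCliffordFamily fun k => J (f k) :=
  ⟨fun _ => hJ.1 _, fun _ => hJ.2 _, fun _ _ h => hJ.3 _ _ (f.injective.ne h)⟩

theorem IsCliffordFamily.submatrix {κ ι ι' : Type} [Fintype ι] [DecidableEq ι] [Fintype ι']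
    [DecidableEq ι'] {J : κ → Matrix ι ι R} (hJ : IsCliffordFamily J) (e : ι' ≃ ι) :
    IsCliffordFamily fun k => (J k).submatrix e e := by
  refine ⟨fun i => ?_, fun i => ?_, fun i j hij => ?_⟩
  · rw [Matrix.conjTranspose_submatrix, hJ.1]
    rfl
  · rw [Matrix.submatrix_mul_equiv, hJ.2, Matrix.submatrix_neg]
    exact congrArg Neg.neg (Matrix.submatrix_one_equiv e)
  · rw [Matrix.submatrix_mul_equiv, Matrix.submatrix_mul_equiv, hJ.3 i j hij,
      Matrix.submatrix_neg]
    rfl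

/-- The real symmetric matrix `diag(1, -1)`. -/
def pauliZ (R : Type) [CommRing R] : Matrix (Fin 2) (Fin 2) R := !![1, 0; 0, -1]

/-- The real symmetric matrix that exchanges the two basis vectors. -/
def pauliX (R : Type) [CommRing R] : Matrix (Fin 2) (Fin 2) R := !![0, 1; 1, 0]

/-- The rotation by a right angle. -/
def rotation (R : Type) [CommRing R] : Matrix (Fin 2) (Fin 2) R := !![0, 1; -1, 0]

theorem pauliZ_mul_self : pauliZ R * pauliZ R = 1 := by
  ext i j; fin_cases i <;> fin_cases j <;> simp [pauliZ]

theorem pauliX_mul_self : pauliX R * pauliX R = 1 := by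
  ext i j; fin_cases i <;> fin_cases j <;> simp [pauliX]

theorem rotation_mul_self : rotation R * rotation R = -1 := by
  ext i j; fin_cases i <;> fin_cases j <;> simp [rotation]

theorem pauliX_mul_pauliZ : pauliX R * pauliZ R = -(pauliZ R * pauliX R) := by
  ext i j; fin_cases i <;> fin_cases j <;> simp [pauliX, pauliZ]

theorem rotation_mul_pauliZ : rotation R * pauliZ R = -(pauliZ R * rotation R) := by
  ext i j; fin_cases i <;> fin_cases j <;> simp [rotation, pauliZ]

theorem rotation_mul_pauliX : rotation R * pauliX R = -(pauliX R * rotation R) := by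
  ext i j; fin_cases i <;> fin_cases j <;> simp [rotation, pauliX]

theorem pauliZ_conjTranspose : (pauliZ R)ᴴ = pauliZ R := by
  ext i j; fin_cases i <;> fin_cases j <;> simp [pauliZ, Matrix.conjTranspose_apply]

theorem pauliX_conjTranspose : (pauliX R)ᴴ = pauliX R := by
  ext i j; fin_cases i <;> fin_cases j <;> simp [pauliX, Matrix.conjTranspose_apply]

theorem rotation_conjTranspose : (rotation R)ᴴ = -rotation R := by
  ext i j; fin_cases i <;> fin_cases j <;> simp [rotation, Matrix.conjTranspose_apply]

theorem neg_kronecker {l m n p : Type} (A : Matrix l m R) (B : Matrix n p R) :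
    (-A) ⊗ₖ B = -(A ⊗ₖ B) := by
  ext; simp

theorem kronecker_neg {l m n p : Type} (A : Matrix l m R) (B : Matrix n p R) :
    A ⊗ₖ (-B) = -(A ⊗ₖ B) := by
  ext; simp

/-- The Clifford family built from two commuting Clifford families of the same size. -/
def doubling {κ κ' ι : Type} [DecidableEq ι] (L : κ → Matrix ι ι R) (L' : κ' → Matrix ι ι R) :
    (κ ⊕ κ') ⊕ Unit → Matrix (ι × Fin 2) (ι × Fin 2) R :=
  Sum.elim (Sum.elim (fun k => L k ⊗ₖ pauliZ R) fun k => L' k ⊗ₖ pauliX R) fun _ => 1 ⊗ₖ rotation R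

/-- The second tensor factors of different blocks anticommute, so the first factors must commute.
`pauliZ` and `pauliX` are symmetric with square `1` and leave the signs to the first factors,
whereas `rotation` is itself a complex structure. -/
theorem IsCliffordFamily.doubling {κ κ' ι : Type} [Fintype ι] [DecidableEq ι]
    {L : κ → Matrix ι ι R} {L' : κ' → Matrix ι ι R} (hL : IsCliffordFamily L)
    (hL' : IsCliffordFamily L') (h : ∀ i j, L i * L' j = L' j * L i) :
    IsCliffordFamily (doubling L L') := by
  refine ⟨?_, ?_, ?_⟩
  · rintro ((i | i) | i) <;>
    simp only [RealMasking.doubling, Sum.elim_inl, Sum.elim_inr, Matrix.conjTranspose_kronecker,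
      hL.1, hL'.1, pauliZ_conjTranspose, pauliX_conjTranspose, rotation_conjTranspose,
      Matrix.conjTranspose_one, neg_kronecker, kronecker_neg]
  · rintro ((i | i) | i) <;>
    simp only [RealMasking.doubling, Sum.elim_inl, Sum.elim_inr, ← Matrix.mul_kronecker_mul,
      hL.2, hL'.2, pauliZ_mul_self, pauliX_mul_self, rotation_mul_self, Matrix.one_mul,
      neg_kronecker, kronecker_neg, Matrix.one_kronecker_one]
  · rintro ((i | i) | i) ((j | j) | j) hij <;>
    simp only [RealMasking.doubling, Sum.elim_inl, Sum.elim_inr, ← Matrix.mul_kronecker_mul,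
      Matrix.one_mul, Matrix.mul_one, kronecker_neg, pauliX_mul_pauliZ,
      rotation_mul_pauliZ, rotation_mul_pauliX, neg_neg, h]
    · rw [hL.3 i j (by simpa using hij), neg_kronecker]
    · rw [hL'.3 i j (by simpa using hij), neg_kronecker]
    · exact absurd rfl hij

/-- There are `n` anticommuting complex structures on `R ^ r`. -/
def HasClifford (R : Type) [CommRing R] [StarRing R] (n r : ℕ) : Prop :=
  ∃ J : Fin n → Matrix (Fin r) (Fin r) R, IsCliffordFamily J

theorem IsCliffordFamily.hasClifford {κ ι : Type} [Fintype κ] [Fintype ι] [DecidableEq ι]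
    {J : κ → Matrix ι ι R} (hJ : IsCliffordFamily J) {n r : ℕ} (hn : n ≤ Fintype.card κ)
    (hr : Fintype.card ι = r) : HasClifford R n r := by
  obtain ⟨f⟩ : Nonempty (Fin n ↪ κ) := Function.Embedding.nonempty_of_card_le (by simpa using hn)
  exact ⟨_, (hJ.comp f).submatrix (Fintype.equivFinOfCardEq hr).symm⟩

theorem HasClifford.mono {n n' r : ℕ} (h : HasClifford R n r) (hn : n' ≤ n) :
    HasClifford R n' r := by
  obtain ⟨J, hJ⟩ := h
  exact hJ.hasClifford (by simpa using hn) (by simp)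

/-- The scalar `i` is a one-element family that commutes with everything, so doubling gains two
generators. -/
theorem HasClifford.complex_step {n r : ℕ} (h : HasClifford ℂ n r) :
    HasClifford ℂ (n + 2) (r * 2) := by
  obtain ⟨J, hJ⟩ := h
  have hI : IsCliffordFamily fun _ : Unit => Complex.I • (1 : Matrix (Fin r) (Fin r) ℂ) := by
    refine ⟨fun i => ?_, fun i => ?_, fun i j hij => absurd rfl hij⟩
    · simp
    · simp [smul_smul]
  exact (hJ.doubling hI (by simp)).hasClifford (by simp) (by simp)

theorem hasClifford_complex (p : ℕ) : HasClifford ℂ (2 * p + 1) (2 ^ p) := by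
  induction p with
  | zero =>
    refine ⟨fun _ => Complex.I • 1, fun i => ?_, fun i => ?_, fun i j hij => ?_⟩
    · simp
    · simp [smul_smul]
    · exact absurd (Fin.ext (by omega)) hij
  | succ p ih => exact ih.complex_step

/-! ### Real Clifford families: quaternions, octonions, Bott periodicity -/

variable (R) in
theorem isCliffordFamily_rotation : IsCliffordFamily fun _ : Unit => rotation R :=
  ⟨fun _ => rotation_conjTranspose, fun _ => rotation_mul_self, fun _ _ h => absurd rfl h⟩

variable (R) in
/-- Left multiplications by the imaginary quaternions. -/
def quaternionLeft : (Unit ⊕ Unit) ⊕ Unit → Matrix (Fin 2 × Fin 2) (Fin 2 × Fin 2) R :=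
  doubling (fun _ : Unit => rotation R) fun _ : Unit => rotation R

variable (R) in
theorem isCliffordFamily_quaternionLeft : IsCliffordFamily (quaternionLeft R) :=
  (isCliffordFamily_rotation R).doubling (isCliffordFamily_rotation R) fun _ _ => rfl

variable (R) in
/-- Right multiplications by the imaginary quaternions. -/
def quaternionRight : (Unit ⊕ Unit) ⊕ Unit → Matrix (Fin 2 × Fin 2) (Fin 2 × Fin 2) R :=
  fun k => (quaternionLeft R k).submatrix (Equiv.prodComm _ _) (Equiv.prodComm _ _)

variable (R) in
theorem isCliffordFamily_quaternionRight : IsCliffordFamily (quaternionRight R) :=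
  (isCliffordFamily_quaternionLeft R).submatrix _

theorem kronecker_submatrix_prodComm {l m : Type} (A : Matrix l l R) (B : Matrix m m R) :
    (A ⊗ₖ B).submatrix (Equiv.prodComm m l) (Equiv.prodComm m l) = B ⊗ₖ A := by
  ext x y
  simp [mul_comm]

/-- The matrix form of associativity of the quaternions: in each pair of generators the sign changes
of the two tensor factors cancel. -/
theorem quaternionLeft_mul_quaternionRight (i j : (Unit ⊕ Unit) ⊕ Unit) :
    quaternionLeft R i * quaternionRight R j = quaternionRight R j * quaternionLeft R i := by
  rcases i with ((i | i) | i) <;> rcases j with ((j | j) | j) <;>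
  simp only [quaternionRight, quaternionLeft, doubling, Sum.elim_inl, Sum.elim_inr,
    kronecker_submatrix_prodComm, ← Matrix.mul_kronecker_mul, Matrix.one_mul, Matrix.mul_one,
    rotation_mul_pauliZ, rotation_mul_pauliX, neg_kronecker, kronecker_neg]

variable (R) in
/-- Seven anticommuting complex structures on `R ^ 8`. -/
def octonionLeft : (((Unit ⊕ Unit) ⊕ Unit) ⊕ ((Unit ⊕ Unit) ⊕ Unit)) ⊕ Unit →
    Matrix ((Fin 2 × Fin 2) × Fin 2) ((Fin 2 × Fin 2) × Fin 2) R :=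
  doubling (quaternionLeft R) (quaternionRight R)

variable (R) in
theorem isCliffordFamily_octonionLeft : IsCliffordFamily (octonionLeft R) :=
  (isCliffordFamily_quaternionLeft R).doubling (isCliffordFamily_quaternionRight R)
    quaternionLeft_mul_quaternionRight

theorem IsCliffordFamily.kronecker_one {κ ι ι' : Type} [Fintype ι] [DecidableEq ι] [Fintype ι']
    [DecidableEq ι'] {J : κ → Matrix ι ι R} (hJ : IsCliffordFamily J) :
    IsCliffordFamily fun k => J k ⊗ₖ (1 : Matrix ι' ι' R) := by
  refine ⟨fun i => ?_, fun i => ?_, fun i j hij => ?_⟩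
  · rw [Matrix.conjTranspose_kronecker, hJ.1, Matrix.conjTranspose_one, neg_kronecker]
  · rw [← Matrix.mul_kronecker_mul, hJ.2, neg_kronecker, Matrix.one_mul, Matrix.one_kronecker_one]
  · rw [← Matrix.mul_kronecker_mul, ← Matrix.mul_kronecker_mul, hJ.3 i j hij, neg_kronecker]

theorem IsCliffordFamily.one_kronecker {κ ι ι' : Type} [Fintype ι] [DecidableEq ι] [Fintype ι']
    [DecidableEq ι'] {J : κ → Matrix ι ι R} (hJ : IsCliffordFamily J) :
    IsCliffordFamily fun k => (1 : Matrix ι' ι' R) ⊗ₖ J k := by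
  refine ⟨fun i => ?_, fun i => ?_, fun i j hij => ?_⟩
  · rw [Matrix.conjTranspose_kronecker, hJ.1, Matrix.conjTranspose_one, kronecker_neg]
  · rw [← Matrix.mul_kronecker_mul, hJ.2, kronecker_neg, Matrix.one_mul, Matrix.one_kronecker_one]
  · rw [← Matrix.mul_kronecker_mul, ← Matrix.mul_kronecker_mul, hJ.3 i j hij, kronecker_neg]

/-- Bott periodicity. -/
theorem HasClifford.periodic {n r : ℕ} (h : HasClifford R n r) :
    HasClifford R (n + 8) (16 * r) := by
  obtain ⟨J, hJ⟩ := h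
  have h1 := hJ.kronecker_one (ι' := (Fin 2 × Fin 2) × Fin 2)
  have h2 := (isCliffordFamily_octonionLeft R).one_kronecker (ι' := Fin r)
  -- Operators on different tensor factors commute, so doubling gives `n + 7 + 1` generators in
  -- dimension `r * 8 * 2`.
  refine (h1.doubling h2 fun i j => ?_).hasClifford (by simp) (by simp; ring)
  rw [← Matrix.mul_kronecker_mul, ← Matrix.mul_kronecker_mul]
  simp

theorem kappaReal_add_eight {d : ℕ} (hd : 1 ≤ d) : kappaReal (d + 8) = 16 * kappaReal d := by
  have h1 : kappa (d + 8) = 16 * kappa d := by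
    have : (d + 8 - 1) / 2 = (d - 1) / 2 + 4 := by omega
    rw [kappa, kappa, this, pow_add]
    ring
  simp only [kappaReal, h1, Nat.add_mod_right]
  split_ifs <;> ring

/-- For `d = 1, 2, 4, 8` these are the multiplications by imaginary units of the four real division
algebras. The other `d ≤ 8` use part of the next family, and periodicity does the rest. -/
theorem hasClifford_kappaReal {d : ℕ} (hd : 1 ≤ d) : HasClifford R (d - 1) (kappaReal d) := by
  induction d using Nat.strong_induction_on with
  | _ d ih =>
    rcases Nat.lt_or_ge 8 d with h | h
    · have h1 := (ih (d - 8) (by omega) (by omega)).periodic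
      rw [← kappaReal_add_eight (by omega)] at h1
      have e1 : d - 8 - 1 + 8 = d - 1 := by omega
      have e2 : d - 8 + 8 = d := by omega
      rwa [e1, e2] at h1
    · have c0 : HasClifford R 0 1 := ⟨fun i => i.elim0, fun i => i.elim0, fun i => i.elim0,
        fun i => i.elim0⟩
      have c1 : HasClifford R 1 2 := (isCliffordFamily_rotation R).hasClifford (by simp) (by simp)
      have c3 : HasClifford R 3 4 :=
        (isCliffordFamily_quaternionLeft R).hasClifford (by simp) (by simp)
      have c7 : HasClifford R 7 8 :=
        (isCliffordFamily_octonionLeft R).hasClifford (by simp) (by simp)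
      interval_cases d
      exacts [c0, c1, c3.mono (by norm_num), c3, c7.mono (by norm_num), c7.mono (by norm_num),
        c7.mono (by norm_num), c7]

end Clifford

/-! ### Dimensions of Clifford representations -/

section Dimension

set_option linter.unusedSectionVars false

variable {ι : Type} [Fintype ι] [DecidableEq ι]

theorem mul_comm_of_anticomm {R : Type*} [Ring R] {x a b : R} (ha : x * a = -(a * x))
    (hb : x * b = -(b * x)) : x * (a * b) = a * b * x := by
  rw [← mul_assoc, ha, neg_mul, mul_assoc, hb, mul_neg, neg_neg, mul_assoc]

/-- The trace of an idempotent is its rank. -/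
theorem trace_eq_rank_of_idempotent {P : Matrix ι ι ℂ} (hP : P * P = P) :
    P.trace = P.rank := by
  have hid : IsIdempotentElem (Matrix.toLin' P) := by
    rw [IsIdempotentElem, Module.End.mul_eq_comp, ← Matrix.toLin'_mul, hP]
  have h := (LinearMap.IsIdempotentElem.isProj_range _ hid).trace
  rw [Matrix.trace_toLin'_eq] at h
  rw [h]
  rfl

/-- `J 0, …, J (n - 1)` are pairwise anticommuting complex structures on the range of the
projection `Q`. -/
structure IsCliffordOn (Q : Matrix ι ι ℂ) (J : ℕ → Matrix ι ι ℂ) (n : ℕ) : Prop where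
  idem : Q * Q = Q
  mul_proj : ∀ i < n, J i * Q = J i
  proj_mul : ∀ i < n, Q * J i = J i
  mul_self : ∀ i < n, J i * J i = -Q
  anticomm : ∀ i < n, ∀ j < n, i ≠ j → J i * J j = -(J j * J i)

/-- The involutions `i J_(2 k) J_(2 k + 1)`. -/
def cliffordInvolution (J : ℕ → Matrix ι ι ℂ) (k : ℕ) : Matrix ι ι ℂ :=
  Complex.I • (J (2 * k) * J (2 * k + 1))

/-- The joint spectral projection of the commuting involutions `i J_(2 k) J_(2 k + 1)`. -/
def cliffordProjection (Q : Matrix ι ι ℂ) (J : ℕ → Matrix ι ι ℂ) : ℕ → Matrix ι ι ℂ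
  | 0 => Q
  | k + 1 => cliffordProjection Q J k * ((2⁻¹ : ℂ) • (1 + cliffordInvolution J k))

variable {Q : Matrix ι ι ℂ} {J : ℕ → Matrix ι ι ℂ} {n : ℕ}

namespace IsCliffordOn

theorem commute_proj (h : IsCliffordOn Q J n) {i : ℕ} (hi : i < n) : J i * Q = Q * J i := by
  rw [h.mul_proj i hi, h.proj_mul i hi]

theorem comm_involution (h : IsCliffordOn Q J n) {i k : ℕ} (hi : i < n) (hk : 2 * k + 1 < n)
    (h1 : i ≠ 2 * k) (h2 : i ≠ 2 * k + 1) :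
    J i * cliffordInvolution J k = cliffordInvolution J k * J i := by
  rw [cliffordInvolution, mul_smul_comm, smul_mul_assoc,
    mul_comm_of_anticomm (h.anticomm i hi _ (by omega) h1) (h.anticomm i hi _ (by omega) h2)]

theorem anticomm_involution (h : IsCliffordOn Q J n) {k : ℕ} (hk : 2 * k + 1 < n) :
    J (2 * k + 1) * cliffordInvolution J k = -(cliffordInvolution J k * J (2 * k + 1)) := by
  rw [cliffordInvolution, mul_smul_comm, smul_mul_assoc, ← mul_assoc,
    h.anticomm (2 * k + 1) hk (2 * k) (by omega) (by omega), neg_mul, smul_neg]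

theorem involution_sq (h : IsCliffordOn Q J n) {k : ℕ} (hk : 2 * k + 1 < n) :
    cliffordInvolution J k * cliffordInvolution J k = Q := by
  have : J (2 * k) * J (2 * k + 1) * (J (2 * k) * J (2 * k + 1)) = -Q := by
    calc _ = J (2 * k) * (J (2 * k + 1) * J (2 * k)) * J (2 * k + 1) := by
          simp only [mul_assoc]
      _ = -(J (2 * k) * J (2 * k)) * (J (2 * k + 1) * J (2 * k + 1)) := by
          rw [h.anticomm (2 * k + 1) hk (2 * k) (by omega) (by omega)]
          noncomm_ring
      _ = -Q := by
          rw [h.mul_self _ (by omega), h.mul_self _ hk]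
          simp [h.idem]
  rw [cliffordInvolution, smul_mul_smul_comm, this]
  simp

theorem involution_proj (h : IsCliffordOn Q J n) {k : ℕ} (hk : 2 * k + 1 < n) :
    cliffordInvolution J k * Q = cliffordInvolution J k ∧
      Q * cliffordInvolution J k = cliffordInvolution J k := by
  constructor
  · rw [cliffordInvolution, smul_mul_assoc, mul_assoc, h.mul_proj _ hk]
  · rw [cliffordInvolution, mul_smul_comm, ← mul_assoc, h.proj_mul _ (by omega)]

theorem involution_comm (h : IsCliffordOn Q J n) {j k : ℕ} (hj : 2 * j + 1 < n)
    (hk : 2 * k + 1 < n) :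
    cliffordInvolution J j * cliffordInvolution J k =
      cliffordInvolution J k * cliffordInvolution J j := by
  rcases eq_or_ne j k with rfl | hjk
  · rfl
  · have e : cliffordInvolution J j = Complex.I • (J (2 * j) * J (2 * j + 1)) := rfl
    rw [e, smul_mul_assoc, mul_smul_comm, mul_assoc,
      h.comm_involution hj hk (by omega) (by omega), ← mul_assoc,
      h.comm_involution (i := 2 * j) (by omega) hk (by omega) (by omega), mul_assoc]

end IsCliffordOn

theorem commute_cliffordProjection {Z : Matrix ι ι ℂ} (hQ : Z * Q = Q * Z) {p : ℕ}
    (hG : ∀ k < p, Z * cliffordInvolution J k = cliffordInvolution J k * Z) :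
    Z * cliffordProjection Q J p = cliffordProjection Q J p * Z := by
  induction p with
  | zero => exact hQ
  | succ p ih =>
    rw [cliffordProjection, ← mul_assoc, ih fun k hk => hG k (by omega), mul_assoc, mul_assoc,
      mul_smul_comm, smul_mul_assoc, mul_add, add_mul, hG p (by omega), mul_one, one_mul]

theorem IsCliffordOn.projection_mul (h : IsCliffordOn Q J n) {p : ℕ} (hp : 2 * p ≤ n) :
    cliffordProjection Q J p * Q = cliffordProjection Q J p := by
  induction p with
  | zero => exact h.idem
  | succ p ih =>
    rw [cliffordProjection, mul_assoc, smul_mul_assoc, add_mul, one_mul,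
      (h.involution_proj (k := p) (by omega)).1]
    conv_rhs => rw [← ih (by omega), mul_assoc, mul_smul_comm, mul_add, mul_one,
      (h.involution_proj (k := p) (by omega)).2]

theorem IsCliffordOn.projection_idem (h : IsCliffordOn Q J n) {p : ℕ} (hp : 2 * p ≤ n) :
    cliffordProjection Q J p * cliffordProjection Q J p = cliffordProjection Q J p := by
  induction p with
  | zero => exact h.idem
  | succ p ih =>
    have hc : cliffordInvolution J p * cliffordProjection Q J p =
        cliffordProjection Q J p * cliffordInvolution J p := by
      refine commute_cliffordProjection ?_ fun k hk => h.involution_comm (by omega) (by omega)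
      have := h.involution_proj (k := p) (by omega)
      rw [this.1, this.2]
    have hPQ := h.projection_mul (p := p) (by omega)
    have hGG := h.involution_sq (k := p) (by omega)
    have ih := ih (by omega)
    rw [cliffordProjection]
    set P := cliffordProjection Q J p
    set G := cliffordInvolution J p
    have e1 : P * (1 + G) * (P * (1 + G)) = (2 : ℂ) • (P * (1 + G)) := by
      calc P * (1 + G) * (P * (1 + G)) = P * P + P * P * G + P * (G * P) + P * (G * P) * G := by
            noncomm_ring
        _ = P + P * G + P * G + P * (G * G) := by
            rw [hc, ← mul_assoc P P G, ih, mul_assoc P G G]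
        _ = (2 : ℂ) • (P * (1 + G)) := by
            rw [hGG, hPQ, two_smul, mul_add, mul_one]
            abel
    rw [mul_smul_comm, smul_mul_smul_comm, e1, smul_smul]
    norm_num

/-- Each involution splits the previous range into halves: the generator `J (2 * p + 1)` commutes
with the projection reached so far but anticommutes with the new involution, which forces the trace
of their product to vanish. -/
theorem IsCliffordOn.trace_projection (h : IsCliffordOn Q J n) {p : ℕ} (hp : 2 * p ≤ n) :
    2 ^ p * (cliffordProjection Q J p).trace = Q.trace := by
  induction p with
  | zero => simp [cliffordProjection]
  | succ p ih =>
    have hc : J (2 * p + 1) * cliffordProjection Q J p =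
        cliffordProjection Q J p * J (2 * p + 1) :=
      commute_cliffordProjection (h.commute_proj (by omega)) fun k hk =>
        h.comm_involution (by omega) (by omega) (by omega) (by omega)
    have hPQ := h.projection_mul (p := p) (by omega)
    have hGQ := (h.involution_proj (k := p) (by omega)).1
    have hJG := h.anticomm_involution (k := p) (by omega)
    have hJJ := h.mul_self (2 * p + 1) (by omega)
    rw [← ih (by omega), cliffordProjection]
    set P := cliffordProjection Q J p
    set G := cliffordInvolution J p
    set B := J (2 * p + 1)
    have h0 : (P * G).trace = 0 := by
      have h1 : (P * G).trace = -(P * G * (B * B)).trace := by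
        rw [hJJ, mul_neg, Matrix.trace_neg, neg_neg, mul_assoc, hGQ]
      have h2 : (P * G * (B * B)).trace = -(P * G * (B * B)).trace := by
        calc (P * G * (B * B)).trace = (B * (P * G) * B).trace := by
              rw [← mul_assoc, Matrix.trace_mul_comm, ← mul_assoc]
          _ = (P * (B * G) * B).trace := by rw [← mul_assoc, hc, mul_assoc P B G]
          _ = -(P * G * (B * B)).trace := by
              rw [hJG, mul_neg, neg_mul, Matrix.trace_neg]
              simp only [mul_assoc]
      rw [h1, neg_eq_zero]
      exact self_eq_neg.1 h2
    rw [mul_smul_comm, Matrix.trace_smul, mul_add, mul_one, Matrix.trace_add, h0, smul_eq_mul,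
      pow_succ]
    ring

theorem IsCliffordOn.rank_eq (h : IsCliffordOn Q J n) {p : ℕ} (hp : 2 * p ≤ n) :
    2 ^ p * (cliffordProjection Q J p).rank = Q.rank := by
  have := h.trace_projection hp
  rw [trace_eq_rank_of_idempotent (h.projection_idem hp), trace_eq_rank_of_idempotent h.idem] at this
  exact_mod_cast this

/-- The rank of `Q` is `2 ^ p` times that of the joint projection, which cannot vanish. -/
theorem IsCliffordOn.two_pow_le_rank (h : IsCliffordOn Q J n) {p : ℕ} (hp : 2 * p ≤ n)
    (hQ : 0 < Q.rank) : 2 ^ p ≤ Q.rank := by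
  rw [← h.rank_eq hp] at hQ ⊢
  exact Nat.le_mul_of_pos_right _ (Nat.pos_of_mul_pos_left hQ)

/-! ### Quaternionic structures for real generators -/

/-- Entrywise complex conjugation. -/
def conjMatrix : Matrix ι ι ℂ →+* Matrix ι ι ℂ := (starRingEnd ℂ).mapMatrix

theorem conjMatrix_smul (c : ℂ) (P : Matrix ι ι ℂ) :
    conjMatrix (c • P) = star c • conjMatrix P := by
  ext i j
  simp [conjMatrix]

/-- A projection that commutes with an antiunitary operator `L ∘ conj` with square `-1` does not
have rank one. -/
theorem rank_ne_one_of_quaternionic {P L : Matrix ι ι ℂ} (hP : P * P = P)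
    (hL : L * conjMatrix P = P * L) (hLL : L * conjMatrix L * P = -P) : P.rank ≠ 1 := by
  intro hrank
  have hfr : Module.finrank ℂ (LinearMap.range P.mulVecLin) = 1 := hrank
  obtain ⟨v, hv, hspan⟩ := finrank_eq_one_iff'.1 hfr
  obtain ⟨v, x, rfl⟩ := v
  have conj_mulVec : ∀ (N : Matrix ι ι ℂ) (y : ι → ℂ), star (N *ᵥ y) = conjMatrix N *ᵥ star y := by
    intro N y
    ext i
    simp [Matrix.mulVec, dotProduct, conjMatrix]
  set v := P.mulVecLin x with hvdef
  have hPv : P *ᵥ v = v := by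
    rw [hvdef, Matrix.mulVecLin_apply, Matrix.mulVec_mulVec, hP]
  have hv0 : v ≠ 0 := fun h => hv (Subtype.ext h)
  have hw : P *ᵥ (L *ᵥ star v) = L *ᵥ star v := by
    rw [Matrix.mulVec_mulVec, ← hL, ← Matrix.mulVec_mulVec, ← conj_mulVec, hPv]
  -- On a line the antilinear map sends `v` to `c v`, hence its square multiplies `v` by `‖c‖ ^ 2`,
  -- which is never `-1`.
  obtain ⟨c, hc⟩ := hspan ⟨L *ᵥ star v, ⟨L *ᵥ star v, hw⟩⟩
  have hc : c • v = L *ᵥ star v := congrArg Subtype.val hc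
  have h1 : L *ᵥ star (L *ᵥ star v) = -v := by
    rw [conj_mulVec, star_star, Matrix.mulVec_mulVec]
    conv_lhs => rw [← hPv, Matrix.mulVec_mulVec, hLL, Matrix.neg_mulVec, hPv]
  rw [← hc, star_smul, Matrix.mulVec_smul, ← hc, smul_smul] at h1
  have h2 : (star c * c + 1) • v = 0 := by rw [add_smul, h1, one_smul, neg_add_cancel]
  have h3 := (smul_eq_zero.1 h2).resolve_right hv0
  rw [Complex.star_def, Complex.conj_mul'] at h3
  have h4 : ‖c‖ ^ 2 + 1 = 0 := by exact_mod_cast h3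
  nlinarith [sq_nonneg ‖c‖]

/-- The generator that is used as the `k`-th factor of `cliffordFlip`. -/
def flipIndex (p k : ℕ) : ℕ := if k < p then 2 * k + 1 else 2 * k

/-- The product of one generator from each of the first `p` pairs, and possibly one more. -/
def cliffordFlip (Q : Matrix ι ι ℂ) (J : ℕ → Matrix ι ι ℂ) (p : ℕ) : ℕ → Matrix ι ι ℂ
  | 0 => Q
  | k + 1 => cliffordFlip Q J p k * J (flipIndex p k)

theorem flipIndex_injective (p : ℕ) : Function.Injective (flipIndex p) := by
  intro i j h
  unfold flipIndex at h
  split_ifs at h <;> omega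

/-- Appending the factor number `r + 1` costs `(-1) ^ r` for moving it past the earlier ones and
`-1` for its square, so the total exponent is `1 + 2 + ⋯ + q`. -/
theorem IsCliffordOn.flip_sq (h : IsCliffordOn Q J n) (p : ℕ) {q : ℕ}
    (hq : ∀ k < q, flipIndex p k < n) :
    cliffordFlip Q J p q * cliffordFlip Q J p q = ((-1 : ℂ) ^ (q * (q + 1) / 2)) • Q := by
  have anti : ∀ r ≤ q, ∀ k, r ≤ k → k < q → J (flipIndex p k) * cliffordFlip Q J p r =
      ((-1 : ℂ) ^ r) • (cliffordFlip Q J p r * J (flipIndex p k)) := by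
    intro r
    induction r with
    | zero => intro _ k _ hk; simpa [cliffordFlip] using h.commute_proj (hq k hk)
    | succ r ih =>
      intro hr k hrk hk
      rw [cliffordFlip, ← mul_assoc, ih (by omega) k (by omega) hk, smul_mul_assoc, mul_assoc,
        h.anticomm _ (hq k hk) _ (hq r (by omega)) ((flipIndex_injective p).ne (by omega)),
        mul_neg, ← mul_assoc, pow_succ, mul_neg_one, neg_smul, smul_neg]
  induction q with
  | zero => simp [cliffordFlip, h.idem]
  | succ q ih =>
    have ih := ih (fun k hk => hq k (by omega)) fun r hr k hrk hk => anti r (by omega) k hrk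
      (by omega)
    have e : (q + 1) * (q + 1 + 1) / 2 = q * (q + 1) / 2 + (q + 1) := by
      have : (q + 1) * (q + 1 + 1) = q * (q + 1) + (q + 1) * 2 := by ring
      rw [this, Nat.add_mul_div_right _ _ two_pos]
    calc cliffordFlip Q J p (q + 1) * cliffordFlip Q J p (q + 1)
        = cliffordFlip Q J p q * (J (flipIndex p q) * cliffordFlip Q J p q) *
            J (flipIndex p q) := by simp only [cliffordFlip, mul_assoc]
      _ = ((-1 : ℂ) ^ q) • (cliffordFlip Q J p q * cliffordFlip Q J p q *
            (J (flipIndex p q) * J (flipIndex p q))) := by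
          rw [anti q (by omega) q le_rfl (by omega), mul_smul_comm, smul_mul_assoc]
          simp only [mul_assoc]
      _ = _ := by
          rw [ih, h.mul_self _ (hq q (by omega)), e, smul_mul_assoc, mul_neg, h.idem, smul_smul,
            smul_neg, ← neg_smul]
          congr 1
          rw [pow_add, pow_succ]
          ring

/-- Exactly one factor, `J (2 * j + 1)`, belongs to the pair of the `j`-th involution and
anticommutes with it; all the others commute with it. -/
theorem IsCliffordOn.flip_involution (h : IsCliffordOn Q J n) {p q : ℕ} (hp : 2 * p ≤ n)
    (hpq : p ≤ q) (hq : ∀ k < q, flipIndex p k < n) {j : ℕ} (hj : j < p) :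
    cliffordFlip Q J p q * cliffordInvolution J j =
      -(cliffordInvolution J j * cliffordFlip Q J p q) := by
  have comm : ∀ k < q, k ≠ j → J (flipIndex p k) * cliffordInvolution J j =
      cliffordInvolution J j * J (flipIndex p k) := by
    intro k hk hkj
    refine h.comm_involution (hq k hk) (by omega) ?_ ?_ <;>
    · unfold flipIndex
      split_ifs <;> omega
  have hGQ := h.involution_proj (k := j) (by omega)
  have before : ∀ r ≤ j, cliffordFlip Q J p r * cliffordInvolution J j =
      cliffordInvolution J j * cliffordFlip Q J p r := by
    intro r
    induction r with
    | zero => intro _; rw [cliffordFlip, hGQ.1, hGQ.2]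
    | succ r ih =>
      intro hr
      rw [cliffordFlip, mul_assoc, comm r (by omega) (by omega), ← mul_assoc, ih (by omega),
        mul_assoc]
  have after : ∀ r, j < r → r ≤ q → cliffordFlip Q J p r * cliffordInvolution J j =
      -(cliffordInvolution J j * cliffordFlip Q J p r) := by
    intro r hjr
    induction r, hjr using Nat.le_induction with
    | base =>
      intro _
      have : flipIndex p j = 2 * j + 1 := if_pos hj
      rw [Nat.succ_eq_add_one, cliffordFlip, this, mul_assoc, h.anticomm_involution (by omega),
        mul_neg, ← mul_assoc, before j le_rfl, mul_assoc]
    | succ r hr ih =>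
      intro hrq
      rw [cliffordFlip, mul_assoc, comm r (by omega) (by omega), ← mul_assoc, ih (by omega),
        neg_mul, mul_assoc]
  exact after q (by omega) le_rfl

/-- For real generators conjugation changes the sign of every involution, and the flip `L` restores
it. So `L ∘ conj` preserves the joint eigenspace, and its square there is `(-1) ^ (q (q + 1) / 2) =
-1` when `q` is 1 or 2 mod 4. The joint eigenspace therefore has dimension at least two. -/
theorem IsCliffordOn.two_pow_succ_le_rank (h : IsCliffordOn Q J n) {p q : ℕ} (hp : 2 * p ≤ n)
    (hpq : p ≤ q) (hq : ∀ k < q, flipIndex p k < n) (hsign : q % 4 = 1 ∨ q % 4 = 2)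
    (hQ : 0 < Q.rank) (hQc : conjMatrix Q = Q) (hJc : ∀ i < n, conjMatrix (J i) = J i) :
    2 ^ (p + 1) ≤ Q.rank := by
  set L := cliffordFlip Q J p q
  have hLc : conjMatrix L = L := by
    have : ∀ r ≤ q, conjMatrix (cliffordFlip Q J p r) = cliffordFlip Q J p r := by
      intro r
      induction r with
      | zero => exact fun _ => hQc
      | succ r ih => intro hr; rw [cliffordFlip, map_mul, ih (by omega), hJc _ (hq r (by omega))]
    exact this q le_rfl
  have hGc : ∀ k < p, conjMatrix (cliffordInvolution J k) = -cliffordInvolution J k := by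
    intro k hk
    rw [cliffordInvolution, conjMatrix_smul, map_mul, hJc _ (by omega), hJc _ (by omega)]
    simp
  have hLQ : L * Q = Q * L := by
    have : ∀ r ≤ q, cliffordFlip Q J p r * Q = Q * cliffordFlip Q J p r := by
      intro r
      induction r with
      | zero => exact fun _ => rfl
      | succ r ih =>
        intro hr
        rw [cliffordFlip, mul_assoc, h.commute_proj (hq r (by omega)), ← mul_assoc, ih (by omega),
          mul_assoc]
    exact this q le_rfl
  have hLP : ∀ r ≤ p, L * conjMatrix (cliffordProjection Q J r) = cliffordProjection Q J r * L := by
    intro r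
    induction r with
    | zero => intro _; rw [cliffordProjection, hQc, hLQ]
    | succ r ih =>
      intro hr
      have h2 : star (2⁻¹ : ℂ) = 2⁻¹ := by simp
      rw [cliffordProjection, map_mul, ← mul_assoc, ih (by omega), conjMatrix_smul, map_add,
        map_one, hGc r (by omega), mul_assoc, mul_assoc, mul_smul_comm, smul_mul_assoc, mul_add,
        mul_neg, h.flip_involution hp hpq hq (by omega : r < p), neg_neg, mul_one, add_mul,
        one_mul, h2]
  have hLL : L * conjMatrix L * cliffordProjection Q J p = -cliffordProjection Q J p := by
    have hs : (-1 : ℂ) ^ (q * (q + 1) / 2) = -1 := by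
      apply Odd.neg_one_pow
      obtain ⟨t, ht⟩ : ∃ t, q = 4 * t + q % 4 := ⟨q / 4, by omega⟩
      rcases hsign with hs | hs
      · rw [hs] at ht
        subst ht
        refine ⟨4 * t * t + 3 * t, ?_⟩
        have : (4 * t + 1) * (4 * t + 1 + 1) = 2 * (2 * (4 * t * t + 3 * t) + 1) := by ring
        omega
      · rw [hs] at ht
        subst ht
        refine ⟨4 * t * t + 5 * t + 1, ?_⟩
        have : (4 * t + 2) * (4 * t + 2 + 1) = 2 * (2 * (4 * t * t + 5 * t + 1) + 1) := by ring
        omega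
    have hQP : Q * cliffordProjection Q J p = cliffordProjection Q J p := by
      rw [commute_cliffordProjection rfl fun k hk => ?_, h.projection_mul hp]
      have := h.involution_proj (k := k) (by omega)
      rw [this.1, this.2]
    rw [hLc, h.flip_sq p hq, hs, smul_mul_assoc, hQP, neg_one_smul]
  have hne := rank_ne_one_of_quaternionic (h.projection_idem hp) (hLP p le_rfl) hLL
  have hr := h.rank_eq hp
  rw [← hr] at hQ ⊢
  have hpos := Nat.pos_of_mul_pos_left hQ
  rw [pow_succ]
  exact Nat.mul_le_mul_left _ (by omega)

end Dimension

/-! ### Schmidt coefficients of maskers -/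

section MaskFamily

set_option linter.unusedSectionVars false

variable {A B : Type} [Fintype A] [DecidableEq A] [Fintype B] [DecidableEq B]

/-- The coefficient matrices of the kets `M |j⟩` for a masker `M` of the real states. -/
structure IsMaskFamily {d : ℕ} (X : Fin d → Matrix A B ℂ) (τ : Matrix A A ℂ)
    (τ' : Matrix B B ℂ) : Prop where
  left : ∀ j, X j * (X j)ᴴ = τ
  right : ∀ j, (X j)ᴴ * X j = τ'
  left_cross : ∀ j k, j ≠ k → X j * (X k)ᴴ = -(X k * (X j)ᴴ)
  right_cross : ∀ j k, j ≠ k → (X j)ᴴ * X k = -((X k)ᴴ * X j)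

theorem IsMaskFamily.intertwine {d : ℕ} {X : Fin d → Matrix A B ℂ} {τ : Matrix A A ℂ}
    {τ' : Matrix B B ℂ} (h : IsMaskFamily X τ τ') (j : Fin d) : τ * X j = X j * τ' := by
  rw [← h.left j, ← h.right j, Matrix.mul_assoc]

theorem IsMaskFamily.intertwine' {d : ℕ} {X : Fin d → Matrix A B ℂ} {τ : Matrix A A ℂ}
    {τ' : Matrix B B ℂ} (h : IsMaskFamily X τ τ') (j : Fin d) : (X j)ᴴ * τ = τ' * (X j)ᴴ := by
  rw [← h.left j, ← h.right j, Matrix.mul_assoc]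

/-- `X j` intertwines the two reduced states; consequently `X j (X k)ᴴ` preserves every eigenspace
of `τ`. -/
theorem IsMaskFamily.commute {d : ℕ} {X : Fin d → Matrix A B ℂ} {τ : Matrix A A ℂ}
    {τ' : Matrix B B ℂ} (h : IsMaskFamily X τ τ') (j k : Fin d) :
    (X j * (X k)ᴴ) * τ = τ * (X j * (X k)ᴴ) := by
  rw [Matrix.mul_assoc, h.intertwine', ← Matrix.mul_assoc, ← h.intertwine, Matrix.mul_assoc]

/-- `W` has no entries between different eigenvalues. This is used with `f` the indicator of one
eigenvalue. -/
theorem diagonal_comp_comm {l : A → ℝ} {W : Matrix A A ℂ}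
    (hW : Matrix.diagonal (fun i => (l i : ℂ)) * W = W * Matrix.diagonal (fun i => (l i : ℂ)))
    (f : ℝ → ℂ) :
    Matrix.diagonal (fun i => f (l i)) * W = W * Matrix.diagonal (fun i => f (l i)) := by
  ext i j
  have h := congrFun (congrFun hW i) j
  rw [Matrix.diagonal_mul, Matrix.mul_diagonal] at h ⊢
  by_cases hij : l i = l j
  · rw [hij, mul_comm]
  · have : ((l i : ℂ) - l j) * W i j = 0 := by rw [sub_mul, h]; ring
    rcases mul_eq_zero.1 this with h0 | h0
    · exact absurd (by exact_mod_cast sub_eq_zero.1 h0) hij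
    · rw [h0, mul_zero, zero_mul]

/-- The spectral projection of `U diag(l) U†` for the eigenvalue `c`. -/
def eigenProjection (U : Matrix A A ℂ) (l : A → ℝ) (c : ℝ) : Matrix A A ℂ :=
  U * Matrix.diagonal (fun i => if l i = c then 1 else 0) * Uᴴ

/-! ### Spectral projections of the reduced state -/

section EigenProjection

variable {U : Matrix A A ℂ} {l : A → ℝ} (c : ℝ)

theorem eigenProjection_idem (hU : Uᴴ * U = 1) :
    eigenProjection U l c * eigenProjection U l c = eigenProjection U l c := by
  rw [eigenProjection, conj_diagonal_mul hU]
  congr 3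
  ext i
  simp

theorem mul_eigenProjection (hU : Uᴴ * U = 1) :
    U * Matrix.diagonal (fun i => (l i : ℂ)) * Uᴴ * eigenProjection U l c =
      (c : ℂ) • eigenProjection U l c := by
  rw [eigenProjection, conj_diagonal_mul hU, ← Matrix.smul_mul, ← Matrix.mul_smul,
    ← Matrix.diagonal_smul]
  congr 3
  ext i
  by_cases h : l i = c <;> simp [h]

theorem rank_eigenProjection (hU : Uᴴ * U = 1) :
    (eigenProjection U l c).rank = (Finset.univ.filter fun i => l i = c).card := by
  have h := trace_eq_rank_of_idempotent (eigenProjection_idem (l := l) c hU)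
  have htr : (eigenProjection U l c).trace = (Finset.univ.filter fun i => l i = c).card := by
    rw [eigenProjection, Matrix.trace_mul_comm, ← Matrix.mul_assoc, hU, Matrix.one_mul,
      Matrix.trace_diagonal, Finset.sum_boole]
  rw [htr] at h
  exact_mod_cast h.symm

theorem commute_eigenProjection (hU : Uᴴ * U = 1) (hU' : U * Uᴴ = 1) {Z : Matrix A A ℂ}
    (hZ : Z * (U * Matrix.diagonal (fun i => (l i : ℂ)) * Uᴴ) =
      U * Matrix.diagonal (fun i => (l i : ℂ)) * Uᴴ * Z) :
    Z * eigenProjection U l c = eigenProjection U l c * Z := by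
  have h1 : Matrix.diagonal (fun i => (l i : ℂ)) * (Uᴴ * Z * U) =
      (Uᴴ * Z * U) * Matrix.diagonal (fun i => (l i : ℂ)) := by
    calc _ = Uᴴ * U * Matrix.diagonal (fun i => (l i : ℂ)) * (Uᴴ * Z * U) := by
          rw [hU, Matrix.one_mul]
      _ = Uᴴ * (U * Matrix.diagonal (fun i => (l i : ℂ)) * Uᴴ * Z) * U := by
          simp only [Matrix.mul_assoc]
      _ = Uᴴ * Z * U * Matrix.diagonal (fun i => (l i : ℂ)) * (Uᴴ * U) := by
          rw [← hZ]
          simp only [Matrix.mul_assoc]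
      _ = _ := by rw [hU, Matrix.mul_one]
  have h2 := diagonal_comp_comm h1 fun x => if x = c then 1 else 0
  calc Z * eigenProjection U l c
      = U * ((Uᴴ * Z * U) * Matrix.diagonal (fun i => if l i = c then 1 else 0)) * Uᴴ := by
        calc _ = (U * Uᴴ) * Z * eigenProjection U l c := by rw [hU', Matrix.one_mul]
          _ = _ := by simp only [eigenProjection, Matrix.mul_assoc]
    _ = eigenProjection U l c * Z * (U * Uᴴ) := by
        rw [← h2]
        simp only [eigenProjection, Matrix.mul_assoc]
    _ = _ := by rw [hU', Matrix.mul_one]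

theorem conjMatrix_diagonal (f : A → ℂ) (hf : ∀ i, star (f i) = f i) :
    conjMatrix (Matrix.diagonal f) = Matrix.diagonal f := by
  ext i j
  rcases eq_or_ne i j with rfl | hij
  · simpa [conjMatrix] using hf i
  · simp [conjMatrix, hij]

theorem conjMatrix_conjTranspose (Z : Matrix A A ℂ) : conjMatrix Zᴴ = (conjMatrix Z)ᴴ := by
  ext i j
  simp [conjMatrix]

/-- The conjugate of `U` also diagonalizes the real matrix with the same `l`, and a spectral
projection does not depend on the eigenbasis: `Uᴴ V` commutes with `diag(l)`, hence with the
indicator of `c`. -/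
theorem conjMatrix_eigenProjection (hU : Uᴴ * U = 1) (hU' : U * Uᴴ = 1)
    (hτ : conjMatrix (U * Matrix.diagonal (fun i => (l i : ℂ)) * Uᴴ) =
      U * Matrix.diagonal (fun i => (l i : ℂ)) * Uᴴ) :
    conjMatrix (eigenProjection U l c) = eigenProjection U l c := by
  set V := conjMatrix U
  have hV : Vᴴ * V = 1 := by rw [← conjMatrix_conjTranspose, ← map_mul, hU, map_one]
  rw [map_mul, map_mul, conjMatrix_conjTranspose, conjMatrix_diagonal _ (by simp)] at hτ
  have h1 : Matrix.diagonal (fun i => (l i : ℂ)) * (Uᴴ * V) =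
      (Uᴴ * V) * Matrix.diagonal (fun i => (l i : ℂ)) := by
    calc _ = Uᴴ * U * Matrix.diagonal (fun i => (l i : ℂ)) * (Uᴴ * V) := by
          rw [hU, Matrix.one_mul]
      _ = Uᴴ * (U * Matrix.diagonal (fun i => (l i : ℂ)) * Uᴴ) * V := by
          simp only [Matrix.mul_assoc]
      _ = Uᴴ * V * Matrix.diagonal (fun i => (l i : ℂ)) * (Vᴴ * V) := by
          rw [← hτ]
          simp only [V, Matrix.mul_assoc]
      _ = _ := by rw [hV, Matrix.mul_one]
  have h2 := diagonal_comp_comm h1 fun x => if x = c then 1 else 0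
  have hV' : V * Vᴴ = 1 := mul_eq_one_comm.1 hV
  rw [eigenProjection, map_mul, map_mul, conjMatrix_conjTranspose,
    conjMatrix_diagonal _ (fun i => by split_ifs <;> simp)]
  change V * _ * Vᴴ = _
  calc V * Matrix.diagonal (fun i => if l i = c then 1 else 0) * Vᴴ
      = U * ((Uᴴ * V) * Matrix.diagonal (fun i => if l i = c then 1 else 0)) * Vᴴ := by
        calc _ = (U * Uᴴ) * V * Matrix.diagonal (fun i => if l i = c then 1 else 0) * Vᴴ := by
              rw [hU', Matrix.one_mul]
          _ = _ := by simp only [Matrix.mul_assoc]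
    _ = U * Matrix.diagonal (fun i => if l i = c then 1 else 0) * Uᴴ * (V * Vᴴ) := by
        rw [← h2]
        simp only [Matrix.mul_assoc]
    _ = _ := by rw [hV', Matrix.mul_one]

end EigenProjection

theorem fin_ofNat_ne {n j k : ℕ} (hj : j < n + 1) (hk : k < n + 1) (h : j ≠ k) :
    Fin.ofNat (n + 1) j ≠ Fin.ofNat (n + 1) k := by
  intro he
  have := congrArg Fin.val he
  rw [Fin.val_ofNat, Fin.val_ofNat, Nat.mod_eq_of_lt hj, Nat.mod_eq_of_lt hk] at this
  exact h this

/-! ### Upper bounds on the eigenvalues of the reduced state -/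

section Bounds

variable {n : ℕ} {X : Fin (n + 1) → Matrix A B ℂ} {τ : Matrix A A ℂ} {τ' : Matrix B B ℂ}
  {U : Matrix A A ℂ} {l : A → ℝ}

/-- The complex structures that a masker induces on an eigenspace of the reduced state. -/
def maskGenerator (X : Fin (n + 1) → Matrix A B ℂ) (U : Matrix A A ℂ) (l : A → ℝ) (c : ℝ)
    (k : ℕ) : Matrix A A ℂ :=
  (c⁻¹ : ℂ) • (X (Fin.ofNat (n + 1) (k + 1)) * (X 0)ᴴ * eigenProjection U l c)

/-- The relation for `(X 0)ᴴ * Z` and `X 0 (X 0)ᴴ Q = c Q` collapse a product of two generators to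
`-c⁻¹ Y Zᴴ Q`; the Clifford relations are then the relations for `X j (X k)ᴴ`. Both halves of the
masking condition are thus used. -/
theorem IsMaskFamily.isCliffordOn (h : IsMaskFamily X τ τ') (hU : Uᴴ * U = 1) (hU' : U * Uᴴ = 1)
    (hτ : τ = U * Matrix.diagonal (fun i => (l i : ℂ)) * Uᴴ) {c : ℝ} (hc : c ≠ 0) :
    IsCliffordOn (eigenProjection U l c) (maskGenerator X U l c) n := by
  have hQ := eigenProjection_idem (l := l) c hU
  have hτQ := mul_eigenProjection (l := l) c hU
  have hcomm : ∀ j, X j * (X 0)ᴴ * eigenProjection U l c =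
      eigenProjection U l c * (X j * (X 0)ᴴ) := fun j =>
    commute_eigenProjection c hU hU' (by rw [← hτ]; exact h.commute j 0)
  rw [← hτ] at hτQ
  have hcC : (c : ℂ) ≠ 0 := by exact_mod_cast hc
  set Q := eigenProjection U l c
  have h0 : ∀ k < n, (Fin.ofNat (n + 1) (k + 1)) ≠ 0 := fun k hk => by
    exact fin_ofNat_ne (j := k + 1) (k := 0) (n := n) (by omega) (by omega) (by omega)
  have hprod : ∀ j < n, ∀ k < n, maskGenerator X U l c j * maskGenerator X U l c k =
      -((c⁻¹ : ℂ) • (X (Fin.ofNat (n + 1) (j + 1)) * (X (Fin.ofNat (n + 1) (k + 1)))ᴴ * Q)) := by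
    intro j hj k hk
    set Y := X (Fin.ofNat (n + 1) (j + 1))
    set Z := X (Fin.ofNat (n + 1) (k + 1)) with hZ
    have hc0 : (X 0)ᴴ * Z = -(Zᴴ * X 0) := h.right_cross _ _ (h0 k hk).symm
    calc maskGenerator X U l c j * maskGenerator X U l c k
        = ((c⁻¹ : ℂ) * (c⁻¹ : ℂ)) • (Y * (X 0)ᴴ * (Q * (Z * (X 0)ᴴ)) * Q) := by
          rw [maskGenerator, maskGenerator, Matrix.smul_mul, Matrix.mul_smul, smul_smul]
          simp only [Matrix.mul_assoc]
          rfl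
      _ = ((c⁻¹ : ℂ) * (c⁻¹ : ℂ)) • (Y * ((X 0)ᴴ * Z) * (X 0)ᴴ * Q) := by
          rw [hZ, ← hcomm]
          simp only [Matrix.mul_assoc, hQ]
      _ = ((c⁻¹ : ℂ) * (c⁻¹ : ℂ)) • -(Y * Zᴴ * ((X 0 * (X 0)ᴴ) * Q)) := by
          rw [hc0]
          simp only [Matrix.mul_neg, Matrix.neg_mul, Matrix.mul_assoc]
      _ = _ := by
          rw [h.left 0, hτQ, Matrix.mul_smul, smul_neg, smul_smul, mul_assoc,
            inv_mul_cancel₀ hcC, mul_one]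
  refine ⟨hQ, fun i _ => ?_, fun i _ => ?_, fun i hi => ?_, fun i hi j hj hij => ?_⟩
  · rw [maskGenerator, Matrix.smul_mul, Matrix.mul_assoc, hQ]
  · rw [maskGenerator, Matrix.mul_smul, hcomm, ← Matrix.mul_assoc, hQ]
  · rw [hprod i hi i hi, h.left, hτQ, smul_smul, inv_mul_cancel₀ hcC, one_smul]
  · rw [hprod i hi j hj, hprod j hj i hi, h.left_cross _ _ (fin_ofNat_ne _ _ _)]
    · simp
    all_goals omega

theorem le_one_div_of_rank (hU : Uᴴ * U = 1) (h0 : ∀ i, 0 ≤ l i) (hl : ∑ i, l i = 1) {c : ℝ}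
    (hc : 0 < c) {k : ℕ} (hk : 0 < k) (hrank : k ≤ (eigenProjection U l c).rank) : c ≤ 1 / k := by
  rw [rank_eigenProjection c hU] at hrank
  have h1 : (Finset.univ.filter fun i => l i = c).card * c ≤ 1 := by
    rw [← hl, ← nsmul_eq_mul, ← Finset.sum_const]
    calc ∑ i with l i = c, c = ∑ i with l i = c, l i :=
          Finset.sum_congr rfl fun i hi => (Finset.mem_filter.1 hi).2.symm
      _ ≤ ∑ i, l i := Finset.sum_le_sum_of_subset_of_nonneg (Finset.filter_subset _ _)
          fun i _ _ => h0 i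
  rw [le_div_iff₀ (by exact_mod_cast hk)]
  have h2 : (k : ℝ) ≤ (Finset.univ.filter fun i => l i = c).card := by exact_mod_cast hrank
  nlinarith

theorem rank_eigenProjection_pos (hU : Uᴴ * U = 1) (i : A) :
    0 < (eigenProjection U l (l i)).rank := by
  rw [rank_eigenProjection _ hU]
  exact Finset.card_pos.2 ⟨i, by simp⟩

theorem IsMaskFamily.eigenvalue_le_kappa (h : IsMaskFamily X τ τ') (hU : Uᴴ * U = 1)
    (hU' : U * Uᴴ = 1) (hτ : τ = U * Matrix.diagonal (fun i => (l i : ℂ)) * Uᴴ)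
    (h0 : ∀ i, 0 ≤ l i) (hl : ∑ i, l i = 1) (i : A) : l i ≤ 1 / kappa (n + 1) := by
  rcases (h0 i).eq_or_lt with hi | hi
  · rw [← hi]
    positivity
  · refine le_one_div_of_rank hU h0 hl hi (by unfold kappa; positivity) ?_
    exact (h.isCliffordOn hU hU' hτ hi.ne').two_pow_le_rank
      (by simp only [Nat.add_sub_cancel]; omega) (rank_eigenProjection_pos hU i)

theorem IsMaskFamily.eigenvalue_le_kappaReal (h : IsMaskFamily X τ τ') (hU : Uᴴ * U = 1)
    (hU' : U * Uᴴ = 1) (hτ : τ = U * Matrix.diagonal (fun i => (l i : ℂ)) * Uᴴ)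
    (h0 : ∀ i, 0 ≤ l i) (hl : ∑ i, l i = 1)
    (hreal : ∀ j k, conjMatrix (X j * (X k)ᴴ) = X j * (X k)ᴴ) (i : A) :
    l i ≤ 1 / kappaReal (n + 1) := by
  rcases (h0 i).eq_or_lt with hi | hi
  · rw [← hi]
    positivity
  · unfold kappaReal
    split_ifs with hd
    · exact h.eigenvalue_le_kappa hU hU' hτ h0 hl i
    · refine le_one_div_of_rank hU h0 hl hi (by unfold kappa; positivity) ?_
      have hcl := h.isCliffordOn hU hU' hτ hi.ne'
      have hQc : conjMatrix (eigenProjection U l (l i)) = eigenProjection U l (l i) := by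
        refine conjMatrix_eigenProjection _ hU hU' ?_
        rw [← hτ, ← h.left 0, hreal]
      have hJc : ∀ k < n, conjMatrix (maskGenerator X U l (l i) k) =
          maskGenerator X U l (l i) k := by
        intro k _
        rw [maskGenerator, conjMatrix_smul, map_mul, hreal, hQc]
        congr 1
        simp
      have hp := rank_eigenProjection_pos (l := l) hU i
      rw [kappa, Nat.add_sub_cancel, mul_comm, ← pow_succ]
      -- One generator from each of the `n / 2` pairs gives `q = 1, 2` mod 4 when `n + 1` is 3, 4, 5
      -- or 6 mod 8. When `n + 1` is 2 mod 8, `n / 2` is divisible by 4, and the unpaired last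
      -- generator is added to make `q = 1` mod 4.
      by_cases h2 : (n + 1) % 8 = 2
      · refine hcl.two_pow_succ_le_rank (p := n / 2) (q := n / 2 + 1) (by omega) (by omega)
          (fun k hk => ?_) (by omega) hp hQc hJc
        unfold flipIndex
        split_ifs <;> omega
      · refine hcl.two_pow_succ_le_rank (p := n / 2) (q := n / 2) (by omega) (by omega)
          (fun k hk => ?_) (by omega) hp hQc hJc
        unfold flipIndex
        split_ifs
        omega

/-- `H = i X 1 (X 0)ᴴ` is Hermitian with `H ^ 2 = τ ^ 2`, so its eigenvalues are those of `τ` up to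
signs, and orthogonality makes it traceless. Real numbers with sum zero and absolute sum one have
absolute value at most `1 / 2`. This is indispensable for `d = 2`, where the Clifford bound is
trivial. -/
theorem IsMaskFamily.eigenvalue_le_half (h : IsMaskFamily X τ τ') (hn : 1 ≤ n) (hU : Uᴴ * U = 1)
    (hτ : τ = U * Matrix.diagonal (fun i => (l i : ℂ)) * Uᴴ)
    (h0 : ∀ i, 0 ≤ l i) (hl : ∑ i, l i = 1)
    (horth : ∀ j k, j ≠ k → (X j * (X k)ᴴ).trace = 0) (i : A) : l i ≤ 1 / 2 := by
  have h10 : (Fin.ofNat (n + 1) 1) ≠ 0 := by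
    exact fin_ofNat_ne (j := 1) (k := 0) (n := n) (by omega) (by omega) (by omega)
  set Y := X (Fin.ofNat (n + 1) 1) with hY
  set H : Matrix A A ℂ := Complex.I • (Y * (X 0)ᴴ) with hHdef
  have hH : H.IsHermitian := by
    have : (Y * (X 0)ᴴ)ᴴ = -(Y * (X 0)ᴴ) := by
      rw [Matrix.conjTranspose_mul, Matrix.conjTranspose_conjTranspose]
      exact h.left_cross _ _ h10.symm
    rw [Matrix.IsHermitian, hHdef, Matrix.conjTranspose_smul, this]
    simp
  have hHH : H * H = τ * τ := by
    rw [hHdef, Matrix.smul_mul, Matrix.mul_smul, smul_smul, Complex.I_mul_I, neg_one_smul]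
    calc -(Y * (X 0)ᴴ * (Y * (X 0)ᴴ)) = -(Y * ((X 0)ᴴ * Y) * (X 0)ᴴ) := by
          simp only [Matrix.mul_assoc]
      _ = (Y * Yᴴ) * (X 0 * (X 0)ᴴ) := by
          rw [hY, h.right_cross _ _ h10.symm]
          simp only [Matrix.mul_neg, Matrix.neg_mul, neg_neg, Matrix.mul_assoc]
      _ = τ * τ := by rw [hY, h.left, h.left]
  obtain ⟨V, hV, -, hVH⟩ := exists_eigen_decomposition hH
  generalize hH.eigenvalues = e at hVH
  have roots : ∀ {W : Matrix A A ℂ} (f : A → ℝ), Wᴴ * W = 1 →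
      ((W * Matrix.diagonal (fun i => (f i : ℂ)) * Wᴴ) *
        (W * Matrix.diagonal (fun i => (f i : ℂ)) * Wᴴ)).charpoly.roots =
      Finset.univ.val.map fun i => ((f i * f i : ℝ) : ℂ) := by
    intro W f hW
    rw [conj_diagonal_mul hW, Matrix.charpoly_mul_comm, ← Matrix.mul_assoc, hW, Matrix.one_mul,
      Matrix.charpoly_diagonal]
    have h := Polynomial.roots_multiset_prod_X_sub_C
      (Finset.univ.val.map fun i => ((f i * f i : ℝ) : ℂ))
    rw [Multiset.map_map] at h
    rw [← h]
    congr 1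
    refine Finset.prod_congr rfl fun i _ => ?_
    simp
  have hroots : (Finset.univ.val.map fun i => ((l i * l i : ℝ) : ℂ)) =
      Finset.univ.val.map fun i => ((e i * e i : ℝ) : ℂ) := by
    rw [← roots l hU, ← roots e hV, ← hτ, ← hVH, hHH]
  have habs : Finset.univ.val.map l = Finset.univ.val.map fun i => |e i| := by
    have := congrArg (fun s : Multiset ℂ => s.map fun z => √z.re) hroots
    simpa only [Multiset.map_map, Function.comp_def, Complex.ofReal_re, Real.sqrt_mul_self_eq_abs,
      abs_of_nonneg (h0 _)] using this
  have hsum : ∑ j, |e j| = 1 := by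
    rw [← hl]
    exact (congrArg Multiset.sum habs).symm
  have htr : ∑ j, e j = 0 := by
    have : H.trace = 0 := by rw [hHdef, Matrix.trace_smul, horth _ _ h10, smul_zero]
    rw [hVH, Matrix.trace_mul_comm, ← Matrix.mul_assoc, hV, Matrix.one_mul,
      Matrix.trace_diagonal] at this
    exact_mod_cast this
  have hmem : l i ∈ Finset.univ.val.map fun i => |e i| := by
    rw [← habs]
    exact Multiset.mem_map_of_mem l (Finset.mem_univ i)
  obtain ⟨j, -, hj⟩ := Multiset.mem_map.1 hmem
  rw [← hj]
  rw [← Finset.add_sum_erase _ _ (Finset.mem_univ j)] at hsum htr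
  have h1 : |e j| = |∑ k ∈ Finset.univ.erase j, e k| := by
    rw [eq_neg_of_add_eq_zero_left htr, abs_neg]
  have h2 := Finset.abs_sum_le_sum_abs e (Finset.univ.erase j)
  linarith

end Bounds

end MaskFamily

/-! ### Maskers of the real states -/

section Masker

set_option linter.unusedSectionVars false

variable {A B : Type} [Fintype A] [DecidableEq A] [Fintype B] [DecidableEq B] {d : ℕ}

/-- The coefficient matrix of the ket `M |j⟩`. -/
def coeff (M : Matrix (A × B) (Fin d) ℂ) (j : Fin d) : Matrix A B ℂ :=
  Matrix.of fun a b => M (a, b) j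

/-- The ket with real amplitudes `c`. -/
def realKet (c : Fin d → ℝ) : Fin d → ℂ := fun j => c j

theorem sandwich_ketBra_realKet (M : Matrix (A × B) (Fin d) ℂ) (c : Fin d → ℝ) :
    M * ketBra (realKet c) * Mᴴ = pureOp (∑ j, (c j : ℂ) • coeff M j) := by
  have : M *ᵥ realKet c = fun p => (∑ j, (c j : ℂ) • coeff M j) p.1 p.2 := by
    ext ⟨a, b⟩
    simp [Matrix.mulVec, dotProduct, Matrix.sum_apply, coeff, realKet, mul_comm]
  rw [pureOp, ketBra, Matrix.mul_vecMulVec, Matrix.vecMulVec_mul, this, ← Matrix.star_mulVec, this]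
  rfl

theorem traceB_pureOp (Y : Matrix A B ℂ) : traceB (pureOp Y) = Y * Yᴴ := by
  ext a a'
  simp [traceB, pureOp, ketBra, Matrix.vecMulVec_apply, Matrix.mul_apply]

theorem traceA_pureOp (Y : Matrix A B ℂ) : traceA (pureOp Y) = (Yᴴ * Y)ᵀ := by
  ext b b'
  simp [traceA, pureOp, ketBra, Matrix.vecMulVec_apply, Matrix.mul_apply, mul_comm]

theorem traceB_sum {ι : Type*} (s : Finset ι) (ρ : ι → Matrix (A × B) (A × B) ℂ) :
    traceB (∑ i ∈ s, ρ i) = ∑ i ∈ s, traceB (ρ i) := by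
  ext a a'
  simp only [traceB, Matrix.of_apply, Matrix.sum_apply]
  exact Finset.sum_comm

theorem traceA_sum {ι : Type*} (s : Finset ι) (ρ : ι → Matrix (A × B) (A × B) ℂ) :
    traceA (∑ i ∈ s, ρ i) = ∑ i ∈ s, traceA (ρ i) := by
  ext a a'
  simp only [traceA, Matrix.of_apply, Matrix.sum_apply]
  exact Finset.sum_comm

theorem ketBra_realKet_mem {c : Fin d → ℝ} (hc : ∑ j, c j ^ 2 = 1) :
    ketBra (realKet c) ∈ realPureStates (Fin d) := by
  have hd : IsDensity (ketBra (realKet c)) := by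
    refine ⟨Matrix.posSemidef_vecMulVec_self_star _, ?_⟩
    rw [ketBra, Matrix.trace_vecMulVec]
    have : realKet c ⬝ᵥ star (realKet c) = ((∑ j, c j ^ 2 : ℝ) : ℂ) := by
      simp [dotProduct, realKet, sq]
    rw [this, hc, Complex.ofReal_one]
  refine ⟨⟨hd, fun i j => ?_⟩, hd, _, rfl⟩
  simp [ketBra, Matrix.vecMulVec_apply, realKet]

theorem sum_single_sq (j : Fin d) : ∑ i, (Pi.single j 1 : Fin d → ℝ) i ^ 2 = 1 := by
  simp [Pi.single_apply]

/-- The unit vector `(e_j + e_k) / √2`. -/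
def pairVector (j k : Fin d) : Fin d → ℝ :=
  fun i => (√2)⁻¹ * ((if i = j then 1 else 0) + if i = k then 1 else 0)

theorem sum_pairVector_sq {j k : Fin d} (hjk : j ≠ k) : ∑ i, pairVector j k i ^ 2 = 1 := by
  have h2 : ((√2)⁻¹ : ℝ) ^ 2 = 2⁻¹ := by rw [inv_pow, Real.sq_sqrt zero_le_two]
  have : ∀ i, pairVector j k i ^ 2 =
      2⁻¹ * ((if i = j then 1 else 0) + if i = k then 1 else 0) := by
    intro i
    rw [pairVector, mul_pow, h2]
    by_cases h : i = j
    · have : i ≠ k := h ▸ hjk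
      simp [h, hjk]
    · simp [h]
  simp only [this]
  rw [← Finset.mul_sum, Finset.sum_add_distrib]
  simp
  norm_num

theorem eq_neg_of_add_add_eq {V : Type*} [AddCommGroup V] {a x y : V}
    (h : a + x + (y + a) = a + a) : x = -y := by
  have e : x + y = a + x + (y + a) - (a + a) := by abel
  rw [eq_neg_iff_add_eq_zero, e, h, sub_self]

/-- Polarization with basis vectors and the vectors `(e_j + e_k) / √2`. Only real superpositions are
available, so the cross terms are antisymmetric but need not vanish. -/
theorem IsMasker.isMaskFamily {m n : ℕ} {M : Matrix (Fin m × Fin n) (Fin d) ℂ}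
    (h : IsMasker (realPureStates (Fin d)) M) :
    ∃ (τ : Matrix (Fin m) (Fin m) ℂ) (τ' : Matrix (Fin n) (Fin n) ℂ),
      IsMaskFamily (coeff M) τ τ' := by
  obtain ⟨-, τ, τ', h⟩ := h
  have hc : ∀ c : Fin d → ℝ, ∑ j, c j ^ 2 = 1 →
      (∑ j, (c j : ℂ) • coeff M j) * (∑ j, (c j : ℂ) • coeff M j)ᴴ = τ ∧
      (∑ j, (c j : ℂ) • coeff M j)ᴴ * (∑ j, (c j : ℂ) • coeff M j) = τ'ᵀ := by
    intro c hc
    have := h _ (ketBra_realKet_mem hc)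
    rw [sandwich_ketBra_realKet, traceB_pureOp, traceA_pureOp] at this
    exact ⟨this.1, by rw [← this.2, Matrix.transpose_transpose]⟩
  have hsingle : ∀ j, ∑ i, (((Pi.single j 1 : Fin d → ℝ) i : ℝ) : ℂ) • coeff M i = coeff M j := by
    intro j
    rw [Finset.sum_eq_single j]
    · simp
    · intro i _ hij
      simp [hij]
    · simp
  have hpair : ∀ j k, ∑ i, (pairVector j k i : ℂ) • coeff M i =
      (((√2)⁻¹ : ℝ) : ℂ) • (coeff M j + coeff M k) := by
    intro j k
    have e : ∀ i, (pairVector j k i : ℂ) • coeff M i = (((√2)⁻¹ : ℝ) : ℂ) •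
        ((if i = j then coeff M i else 0) + if i = k then coeff M i else 0) := by
      intro i
      simp only [pairVector]
      split_ifs <;> simp [mul_add, add_smul]
    simp only [e]
    rw [← Finset.smul_sum, Finset.sum_add_distrib]
    simp
  have hleft : ∀ j, coeff M j * (coeff M j)ᴴ = τ := fun j => by
    simpa only [hsingle] using (hc _ (sum_single_sq j)).1
  have hright : ∀ j, (coeff M j)ᴴ * coeff M j = τ'ᵀ := fun j => by
    simpa only [hsingle] using (hc _ (sum_single_sq j)).2
  have h2 : (((√2)⁻¹ : ℝ) : ℂ) * (((√2)⁻¹ : ℝ) : ℂ) = 2⁻¹ := by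
    rw [← Complex.ofReal_mul, ← mul_inv, Real.mul_self_sqrt zero_le_two]
    norm_num
  refine ⟨τ, τ'ᵀ, hleft, hright, fun j k hjk => ?_, fun j k hjk => ?_⟩
  · have h1 := (hc _ (sum_pairVector_sq hjk)).1
    rw [hpair, Matrix.conjTranspose_smul, Matrix.smul_mul, Matrix.mul_smul, smul_smul,
      Complex.star_def, Complex.conj_ofReal, h2, Matrix.conjTranspose_add, Matrix.add_mul,
      Matrix.mul_add, Matrix.mul_add, hleft, hleft, inv_smul_eq_iff₀ two_ne_zero, two_smul] at h1
    exact eq_neg_of_add_add_eq h1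
  · have h1 := (hc _ (sum_pairVector_sq hjk)).2
    rw [hpair, Matrix.conjTranspose_smul, Matrix.smul_mul, Matrix.mul_smul, smul_smul,
      Complex.star_def, Complex.conj_ofReal, h2, Matrix.conjTranspose_add, Matrix.add_mul,
      Matrix.mul_add, Matrix.mul_add, hright, hright, inv_smul_eq_iff₀ two_ne_zero, two_smul] at h1
    exact eq_neg_of_add_add_eq h1

theorem gram_coeff (M : Matrix (A × B) (Fin d) ℂ) (j k : Fin d) :
    (coeff M k * (coeff M j)ᴴ).trace = (Mᴴ * M) j k := by
  simp [Matrix.trace, Matrix.mul_apply, coeff, Fintype.sum_prod_type, mul_comm]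

/-- The coefficients are symmetric in `j` and `k`, so adding the sum to itself with exchanged
indices cancels the antisymmetric cross terms. -/
theorem sum_smul_gram {V : Type*} [AddCommGroup V] [Module ℂ V] (c : Fin d → ℝ)
    (F : Fin d → Fin d → V) {τ : V} (hs : ∀ j, F j j = τ) (hc : ∀ j k, j ≠ k → F j k = -F k j) :
    ∑ j, ∑ k, ((c j : ℂ) * c k) • F j k = ((∑ j, c j ^ 2 : ℝ) : ℂ) • τ := by
  have h1 : (2 : ℂ) • ∑ j, ∑ k, ((c j : ℂ) * c k) • F j k =
      (2 : ℂ) • (((∑ j, c j ^ 2 : ℝ) : ℂ) • τ) := by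
    rw [two_smul]
    nth_rewrite 2 [Finset.sum_comm]
    rw [← Finset.sum_add_distrib]
    have : ∀ j, ∑ k, ((c j : ℂ) * c k) • F j k + ∑ k, ((c k : ℂ) * c j) • F k j =
        (2 : ℂ) • (((c j ^ 2 : ℝ) : ℂ) • τ) := by
      intro j
      rw [← Finset.sum_add_distrib, Finset.sum_eq_single j]
      · rw [hs, ← two_smul ℂ]
        congr 2
        push_cast
        ring
      · intro k _ hk
        rw [hc j k hk.symm, mul_comm (c k : ℂ), smul_neg, neg_add_cancel]
      · simp
    simp only [this]
    rw [← Finset.smul_sum, ← Finset.sum_smul, Complex.ofReal_sum]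
  exact smul_right_injective V (two_ne_zero' ℂ) h1

theorem IsMaskFamily.comb_left {X : Fin d → Matrix A B ℂ} {τ : Matrix A A ℂ}
    {τ' : Matrix B B ℂ} (h : IsMaskFamily X τ τ') (c : Fin d → ℝ) :
    (∑ j, (c j : ℂ) • X j) * (∑ j, (c j : ℂ) • X j)ᴴ = ((∑ j, c j ^ 2 : ℝ) : ℂ) • τ := by
  rw [← sum_smul_gram c (fun j k => X j * (X k)ᴴ) h.left h.left_cross, Matrix.conjTranspose_sum,
    Matrix.sum_mul]
  refine Finset.sum_congr rfl fun j _ => ?_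
  rw [Matrix.mul_sum]
  refine Finset.sum_congr rfl fun k _ => ?_
  rw [Matrix.conjTranspose_smul, Matrix.smul_mul, Matrix.mul_smul, smul_smul, Complex.star_def,
    Complex.conj_ofReal]

theorem IsMaskFamily.comb_right {X : Fin d → Matrix A B ℂ} {τ : Matrix A A ℂ}
    {τ' : Matrix B B ℂ} (h : IsMaskFamily X τ τ') (c : Fin d → ℝ) :
    (∑ j, (c j : ℂ) • X j)ᴴ * (∑ j, (c j : ℂ) • X j) = ((∑ j, c j ^ 2 : ℝ) : ℂ) • τ' := by
  rw [← sum_smul_gram c (fun j k => (X j)ᴴ * X k) h.right h.right_cross, Matrix.conjTranspose_sum,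
    Matrix.sum_mul]
  refine Finset.sum_congr rfl fun j _ => ?_
  rw [Matrix.mul_sum]
  refine Finset.sum_congr rfl fun k _ => ?_
  rw [Matrix.conjTranspose_smul, Matrix.smul_mul, Matrix.mul_smul, smul_smul, Complex.star_def,
    Complex.conj_ofReal]

/-- Real states are mixtures of real pure states. -/
theorem exists_real_decomposition {ρ : Matrix (Fin d) (Fin d) ℂ} (hρ : ρ ∈ realStates (Fin d)) :
    ∃ r : Fin d ⊕ Fin d → Fin d → ℝ, ρ = ∑ i, ketBra (realKet (r i)) ∧
      ∑ i, ∑ j, r i j ^ 2 = 1 := by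
  obtain ⟨⟨hpsd, htr⟩, hreal⟩ := hρ
  obtain ⟨ξ, hξ⟩ := exists_eq_sum_ketBra hpsd
  -- The vectors `ξ i` may be complex, but the real part of `|ξ⟩⟨ξ|` is the sum of the operators of
  -- the real and the imaginary part of `ξ`.
  let r : Fin d ⊕ Fin d → Fin d → ℝ :=
    Sum.elim (fun i j => (ξ i j).re) fun i j => (ξ i j).im
  have hr : ρ = ∑ i, ketBra (realKet (r i)) := by
    ext j k
    have h1 : ρ j k = ((ρ j k).re : ℂ) := by
      apply Complex.ext <;> simp [hreal]
    rw [h1, hξ]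
    simp only [Matrix.sum_apply, ketBra, Matrix.vecMulVec_apply, Fintype.sum_sum_type, r, realKet,
      Sum.elim_inl, Sum.elim_inr, Pi.star_apply, Complex.star_def, Complex.conj_ofReal,
      Complex.re_sum, Complex.mul_re, Complex.conj_re, Complex.conj_im]
    rw [← Finset.sum_add_distrib]
    push_cast
    refine Finset.sum_congr rfl fun i _ => ?_
    ring
  refine ⟨r, hr, ?_⟩
  rw [hr, Matrix.trace_sum] at htr
  have : ∀ i, (ketBra (realKet (r i))).trace = ((∑ j, r i j ^ 2 : ℝ) : ℂ) := fun i => by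
    simp [ketBra, dotProduct, realKet, sq]
  simp only [this] at htr
  exact_mod_cast htr

theorem sandwich_eq_sum_pureOp (M : Matrix (A × B) (Fin d) ℂ) {ι : Type*} [Fintype ι]
    (r : ι → Fin d → ℝ) :
    M * (∑ i, ketBra (realKet (r i))) * Mᴴ = ∑ i, pureOp (∑ j, (r i j : ℂ) • coeff M j) := by
  simp only [Matrix.mul_sum, Matrix.sum_mul, sandwich_ketBra_realKet]

theorem IsMaskFamily.isMasker {m n : ℕ} {M : Matrix (Fin m × Fin n) (Fin d) ℂ}
    {τ : Matrix (Fin m) (Fin m) ℂ} {τ' : Matrix (Fin n) (Fin n) ℂ}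
    (h : IsMaskFamily (coeff M) τ τ') (hM : Mᴴ * M = 1) : IsMasker (realStates (Fin d)) M := by
  refine ⟨hM, τ, τ'ᵀ, fun ρ hρ => ?_⟩
  obtain ⟨r, rfl, hr⟩ := exists_real_decomposition hρ
  have hr' : ∑ i, ((∑ j, r i j ^ 2 : ℝ) : ℂ) = 1 := by exact_mod_cast hr
  rw [sandwich_eq_sum_pureOp, traceB_sum, traceA_sum]
  simp only [traceB_pureOp, traceA_pureOp, h.comb_left, h.comb_right, Matrix.transpose_smul]
  rw [← Finset.sum_smul, ← Finset.sum_smul, hr', one_smul, one_smul]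
  exact ⟨rfl, rfl⟩

theorem nonempty_of_trace_eq_one {X : Matrix A B ℂ} (h : (X * Xᴴ).trace = 1) :
    Nonempty A ∧ Nonempty B := by
  constructor <;>
  · by_contra hA
    rw [not_nonempty_iff] at hA
    simp [Matrix.trace, Matrix.mul_apply] at h

/-- All the outputs of a masker can be obtained by LOCC from each of its pure outputs. -/
theorem IsMaskFamily.reach {M : Matrix (A × B) (Fin d) ℂ} {τ : Matrix A A ℂ} {τ' : Matrix B B ℂ}
    (h : IsMaskFamily (coeff M) τ τ') (hM : Mᴴ * M = 1) (j₀ : Fin d)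
    {ρ : Matrix (Fin d) (Fin d) ℂ} (hρ : ρ ∈ realStates (Fin d)) :
    LOCCReach (pureOp (coeff M j₀)) (M * ρ * Mᴴ) := by
  obtain ⟨r, rfl, hr⟩ := exists_real_decomposition hρ
  rw [sandwich_eq_sum_pureOp]
  have htr : (coeff M j₀ * (coeff M j₀)ᴴ).trace = 1 := by rw [gram_coeff, hM, Matrix.one_apply_eq]
  obtain ⟨_, _⟩ := nonempty_of_trace_eq_one htr
  have hs : ∀ i, (((√(∑ j, r i j ^ 2) : ℝ) : ℂ)) * ((√(∑ j, r i j ^ 2) : ℝ) : ℂ) =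
      ((∑ j, r i j ^ 2 : ℝ) : ℂ) := fun i => by
    rw [← Complex.ofReal_mul, Real.mul_self_sqrt (Finset.sum_nonneg fun _ _ => sq_nonneg _)]
  -- Alice only draws `i` with probability `∑ j, r i j ^ 2` and announces it. The corresponding pure
  -- output has the same reduced state up to normalization, so Bob alone can produce it.
  refine LOCCReach.oneWay _ (fun i => ((√(∑ j, r i j ^ 2) : ℝ) : ℂ) • (1 : Matrix A A ℂ)) 0
    (by simp) (by simp) ?_ (by simp) _ fun i => ?_
  · simp only [Matrix.conjTranspose_smul, Matrix.mul_smul, smul_smul,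
      Complex.star_def, Complex.conj_ofReal, hs, Matrix.conjTranspose_one, Matrix.mul_one]
    rw [← Finset.sum_smul, ← Complex.ofReal_sum, hr]
    simp
  · simp only [Matrix.conjTranspose_smul, Matrix.smul_mul, Matrix.mul_smul, smul_smul,
      Complex.star_def, Complex.conj_ofReal, hs, Matrix.conjTranspose_one, Matrix.mul_one,
      Matrix.one_mul, h.comb_left, h.left]

/-- The matrix of a real masker is real up to a global phase. -/
theorem IsRealMasker.exists_phase {m n : ℕ} {M : Matrix (Fin m × Fin n) (Fin d) ℂ}
    (h : IsRealMasker (realPureStates (Fin d)) M) :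
    ∃ w : ℂ, ∀ x j, M x j = w * star (M x j) := by
  obtain ⟨⟨hM, -⟩, h⟩ := h
  rcases Nat.eq_zero_or_pos d with rfl | hd
  · exact ⟨0, fun _ j => j.elim0⟩
  set N : Matrix (Fin m × Fin n) (Fin d) ℂ := M.map star with hN
  have hNN : Nᴴ * N = 1 := by
    have := congrArg (fun Z : Matrix (Fin d) (Fin d) ℂ => Zᵀ) hM
    simp only [Matrix.transpose_mul, Matrix.transpose_one] at this
    have e : Nᴴ = Mᵀ := by
      ext i j
      simp [hN]
    rw [e]
    exact this
  have hρ : ∀ c : Fin d → ℝ, ∑ j, c j ^ 2 = 1 →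
      N * ketBra (realKet c) * Nᴴ = M * ketBra (realKet c) * Mᴴ := by
    intro c hc
    ext x y
    have h1 : star ((M * ketBra (realKet c) * Mᴴ) x y) = (M * ketBra (realKet c) * Mᴴ) x y :=
      Complex.conj_eq_iff_im.2 ((h _ (ketBra_realKet_mem hc)).2 x y)
    rw [← h1]
    simp [Matrix.mul_apply, hN, ketBra, Matrix.vecMulVec_apply, realKet]
  -- `M` and its conjugate `N` have equal outputs on real pure states, so `C` commutes with all real
  -- rank-one projections and is a scalar; this scalar gives the phase.
  set C := Mᴴ * N with hC
  have hρ' : ∀ c : Fin d → ℝ, ∑ j, c j ^ 2 = 1 →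
      C * ketBra (realKet c) * Nᴴ = ketBra (realKet c) * Mᴴ := by
    intro c hc
    rw [hC, Matrix.mul_assoc Mᴴ, Matrix.mul_assoc Mᴴ, hρ c hc, ← Matrix.mul_assoc,
      ← Matrix.mul_assoc, hM, Matrix.one_mul]
  have hcomm : ∀ c : Fin d → ℝ, ∑ j, c j ^ 2 = 1 →
      C * ketBra (realKet c) = ketBra (realKet c) * C := by
    intro c hc
    calc C * ketBra (realKet c) = C * ketBra (realKet c) * (Nᴴ * N) := by
          rw [hNN, Matrix.mul_one]
      _ = ketBra (realKet c) * C := by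
          rw [← Matrix.mul_assoc, hρ' c hc, Matrix.mul_assoc]
  have hsingle : ∀ j : Fin d, ketBra (realKet (Pi.single j 1)) = Matrix.single j j (1 : ℂ) := by
    intro j
    ext i k
    rcases eq_or_ne j i with rfl | hi
    · rcases eq_or_ne j k with rfl | hk
      · simp [ketBra, Matrix.vecMulVec_apply, realKet]
      · simp [ketBra, Matrix.vecMulVec_apply, realKet, hk, hk.symm]
    · simp [ketBra, Matrix.vecMulVec_apply, realKet, hi, hi.symm]
  have hoff : ∀ i j, i ≠ j → C i j = 0 := by
    intro i j hij
    have := congrFun (congrFun (hcomm _ (sum_single_sq j)) i) j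
    rw [hsingle] at this
    simpa [hij] using this
  have hdiag : ∀ i j, C i i = C j j := by
    intro i j
    rcases eq_or_ne i j with rfl | hij
    · rfl
    have h1 := congrFun (congrFun (hcomm _ (sum_pairVector_sq hij)) i) j
    have e1 : C = Matrix.diagonal fun i => C i i := by
      ext a b
      rcases eq_or_ne a b with rfl | hab
      · simp
      · simp [hab, hoff a b hab]
    rw [e1, Matrix.diagonal_mul, Matrix.mul_diagonal, mul_comm] at h1
    refine mul_left_cancel₀ ?_ h1
    simp [ketBra, Matrix.vecMulVec_apply, realKet, pairVector, hij, hij.symm]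
  refine ⟨star (C ⟨0, hd⟩ ⟨0, hd⟩), fun x j => ?_⟩
  have h1 := congrFun (congrFun (hρ' _ (sum_single_sq j)) j) x
  have e1 : C = (C ⟨0, hd⟩ ⟨0, hd⟩) • 1 := by
    ext a b
    rcases eq_or_ne a b with rfl | hab
    · simp [hdiag a ⟨0, hd⟩]
    · simp [hab, hoff a b hab]
  rw [hsingle, e1] at h1
  have h2 := congrArg star h1
  simp only [Matrix.smul_mul, Matrix.smul_apply, smul_eq_mul, star_mul',
    Matrix.single_mul_apply_same, Matrix.conjTranspose_apply, star_star, one_mul] at h2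
  exact h2.symm

end Masker

/-! ### The entanglement of masking -/

section Masking

theorem IsMasker.mono {d m n : ℕ} {S S' : Set (Matrix (Fin d) (Fin d) ℂ)}
    {M : Matrix (Fin m × Fin n) (Fin d) ℂ} (h : IsMasker S M) (hS : S' ⊆ S) : IsMasker S' M := by
  obtain ⟨hM, τ, τ', h⟩ := h
  exact ⟨hM, τ, τ', fun ρ hρ => h ρ (hS hρ)⟩

theorem IsRealMasker.mono {d m n : ℕ} {S S' : Set (Matrix (Fin d) (Fin d) ℂ)}
    {M : Matrix (Fin m × Fin n) (Fin d) ℂ} (h : IsRealMasker S M) (hS : S' ⊆ S) :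
    IsRealMasker S' M :=
  ⟨h.1.mono hS, fun ρ hρ => h.2 ρ (hS hρ)⟩

theorem IsEntanglementMonotone.le_of_reach {E : BipartiteFunctional}
    (hE : IsEntanglementMonotone E) {m n m' n' : ℕ} {ρ : Matrix (Fin m × Fin n) (Fin m × Fin n) ℂ}
    {σ : Matrix (Fin m' × Fin n') (Fin m' × Fin n') ℂ} (hρ : IsDensity ρ) (h : LOCCReach ρ σ) :
    E m' n' σ ≤ E m n ρ := by
  obtain ⟨Λ, hΛ, rfl⟩ := h
  exact hE _ _ _ _ Λ hΛ ρ hρ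

variable {n m m' : ℕ} {M : Matrix (Fin m × Fin m') (Fin (n + 1)) ℂ}
  {S : Set (Matrix (Fin (n + 1)) (Fin (n + 1)) ℂ)}

theorem trace_coeff {d : ℕ} {M : Matrix (Fin m × Fin m') (Fin d) ℂ} (hM : Mᴴ * M = 1) (j : Fin d) :
    (coeff M j * (coeff M j)ᴴ).trace = 1 := by
  rw [gram_coeff, hM, Matrix.one_apply_eq]

/-- The output of a masker is most entangled on a pure state. -/
theorem IsMasker.maskerEntanglementEq {E : BipartiteFunctional} (hE : IsEntanglementMonotone E)
    (hS : realPureStates (Fin (n + 1)) ⊆ S) (hS' : S ⊆ realStates (Fin (n + 1)))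
    (h : IsMasker S M) : MaskerEntanglementEq E S M (E m m' (pureOp (coeff M 0))) := by
  obtain ⟨τ, τ', hX⟩ := (h.mono hS).isMaskFamily
  refine ⟨⟨_, hS (ketBra_realKet_mem (sum_single_sq 0)), ?_⟩, ?_⟩
  · rw [sandwich_ketBra_realKet, Finset.sum_eq_single 0]
    · simp
    · intro i _ hi
      simp [hi]
    · simp
  · rintro _ ⟨ρ, hρ, rfl⟩
    exact hE.le_of_reach (isDensity_pureOp (trace_coeff h.1 0)) (hX.reach h.1 0 (hS' hρ))

theorem exists_schmidt {X : Matrix (Fin m) (Fin m') ℂ} (hX : (X * Xᴴ).trace = 1) :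
    ∃ (U : Matrix (Fin m) (Fin m) ℂ) (l : Fin m → ℝ), Uᴴ * U = 1 ∧ U * Uᴴ = 1 ∧
      X * Xᴴ = U * Matrix.diagonal (fun i => (l i : ℂ)) * Uᴴ ∧ (∀ i, 0 ≤ l i) ∧ ∑ i, l i = 1 := by
  obtain ⟨U, hU, hU', hτ⟩ := exists_eigen_decomposition (Matrix.isHermitian_mul_conjTranspose_self X)
  refine ⟨U, _, hU, hU', hτ, (Matrix.posSemidef_self_mul_conjTranspose X).eigenvalues_nonneg, ?_⟩
  generalize (Matrix.isHermitian_mul_conjTranspose_self X).eigenvalues = l at hτ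
  rw [hτ, Matrix.trace_mul_comm, ← Matrix.mul_assoc, hU, Matrix.one_mul,
    Matrix.trace_diagonal] at hX
  exact_mod_cast hX

theorem IsMasker.reach_maxEntangled (hn : 1 ≤ n)
    (h : IsMasker (realPureStates (Fin (n + 1))) M) {k k' : ℕ} {Φ : Fin k × Fin k' → ℂ}
    (hΦ : IsMaxEntangled (max (kappa (n + 1)) 2) Φ) :
    LOCCReach (pureOp (coeff M 0)) (ketBra Φ) := by
  obtain ⟨τ, τ', hX⟩ := h.isMaskFamily
  have htr := trace_coeff h.1 0
  obtain ⟨U, l, hU, hU', hτ, h0, hl⟩ := exists_schmidt htr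
  have hτ' := hτ
  rw [hX.left] at hτ'
  refine LOCCReach.maxEntangled (by positivity) htr hU hU' hτ h0 (fun i => ?_) hΦ
  rcases le_total (kappa (n + 1)) 2 with hk | hk
  · rw [max_eq_right hk]
    refine hX.eigenvalue_le_half hn hU hτ' h0 hl (fun j k hjk => ?_) i
    rw [gram_coeff, h.1, Matrix.one_apply_ne hjk.symm]
  · rw [max_eq_left hk]
    exact hX.eigenvalue_le_kappa hU hU' hτ' h0 hl i

theorem kappaReal_pos (d : ℕ) : 0 < kappaReal d := by
  unfold kappaReal kappa
  split_ifs <;> positivity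

theorem IsRealMasker.reach_maxEntangled
    (h : IsRealMasker (realPureStates (Fin (n + 1))) M) {k k' : ℕ} {Φ : Fin k × Fin k' → ℂ}
    (hΦ : IsMaxEntangled (kappaReal (n + 1)) Φ) :
    LOCCReach (pureOp (coeff M 0)) (ketBra Φ) := by
  obtain ⟨τ, τ', hX⟩ := h.1.isMaskFamily
  have htr := trace_coeff h.1.1 0
  obtain ⟨U, l, hU, hU', hτ, h0, hl⟩ := exists_schmidt htr
  have hτ' := hτ
  rw [hX.left] at hτ'
  refine LOCCReach.maxEntangled (kappaReal_pos _) htr hU hU' hτ h0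
    (hX.eigenvalue_le_kappaReal hU hU' hτ' h0 hl fun j k => ?_) hΦ
  obtain ⟨w, hw⟩ := h.exists_phase
  ext a a'
  simp only [conjMatrix, RingHom.mapMatrix_apply, Matrix.map_apply, Matrix.mul_apply, coeff,
    Matrix.of_apply, Matrix.conjTranspose_apply, map_sum, map_mul]
  refine Finset.sum_congr rfl fun b _ => ?_
  -- The phase relation is used once for each factor and exchanges the two conjugations; `|w| = 1`
  -- is not needed.
  change star (M (a, b) j) * star (star (M (a', b) k)) = _
  rw [star_star]
  conv_lhs => rw [hw (a', b) k]
  conv_rhs => rw [hw (a, b) j]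
  ring

/-- A maximally entangled state of Schmidt rank `k` can be converted to the standard one. -/
theorem IsMaxEntangled.reach_std {k : ℕ} (hk : 0 < k) {Φ : Fin m × Fin m' → ℂ}
    (hΦ : IsMaxEntangled k Φ) : LOCCReach (ketBra Φ) (ketBra (stdMaxEntangled k)) := by
  obtain ⟨u, v, hu, hv, hΦX⟩ := hΦ.exists_coeff
  have : Nonempty (Fin k) := ⟨⟨0, hk⟩⟩
  have hvv : vᵀ * vᵀᴴ = 1 := by
    have h := congrArg Matrix.transpose hv
    rw [Matrix.transpose_mul, Matrix.transpose_one] at h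
    exact h
  have huu : (u * vᵀ) * (u * vᵀ)ᴴ = u * uᴴ := by
    rw [Matrix.conjTranspose_mul, ← Matrix.mul_assoc, Matrix.mul_assoc u, hvv, Matrix.mul_one]
  rw [hΦX, ketBra_stdMaxEntangled]
  have h := LOCCReach.oneWay (((1 / √(k : ℝ) : ℝ) : ℂ) • (u * vᵀ)) (fun _ : Unit => uᴴ)
    (1 - u * uᴴ) (by simp)
    (by
      have : u * uᴴ * (u * uᴴ) = u * uᴴ := by
        rw [Matrix.mul_assoc, ← Matrix.mul_assoc uᴴ, hu, Matrix.one_mul]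
      rw [Matrix.mul_sub, Matrix.sub_mul, Matrix.sub_mul, this]
      simp)
    (by simp)
    (by
      rw [Matrix.mul_smul, Matrix.sub_mul, Matrix.one_mul, Matrix.mul_assoc u,
        ← Matrix.mul_assoc uᴴ, hu, Matrix.one_mul, sub_self, smul_zero])
    (fun _ => uniformCoeff (Fin k))
    (fun _ => by
      simp only [Matrix.conjTranspose_smul, Matrix.smul_mul, Matrix.mul_smul, huu, uniformCoeff,
        Fintype.card_fin, Matrix.conjTranspose_conjTranspose, Matrix.conjTranspose_one,
        Matrix.mul_one]
      rw [← Matrix.mul_assoc uᴴ, hu, Matrix.one_mul, hu])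
  simpa using h

/-! ### Optimal maskers from Clifford families -/

/-- The masker that is built from a Clifford family. -/
theorem exists_masker {k : ℕ} (hk : 0 < k) {J : Fin n → Matrix (Fin k) (Fin k) ℂ}
    (hJ : IsCliffordFamily J) (htr : ∀ i, (J i).trace = 0) :
    ∃ M : Matrix (Fin k × Fin k) (Fin (n + 1)) ℂ, IsMasker (realStates (Fin (n + 1))) M ∧
      pureOp (coeff M 0) = ketBra (stdMaxEntangled k) ∧
      ((∀ i a b, (J i a b).im = 0) → IsRealMasker (realStates (Fin (n + 1))) M) := by
  set c : ℂ := ((1 / √(k : ℝ) : ℝ) : ℂ) with hc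
  -- `M |0⟩` is the standard maximally entangled ket and `M |j⟩` its image under a generator acting
  -- on Alice's side. Vanishing traces make the latter orthogonal to `M |0⟩`; orthogonality among
  -- them follows from anticommutation.
  let W : Fin (n + 1) → Matrix (Fin k) (Fin k) ℂ := Fin.cons 1 J
  let M : Matrix (Fin k × Fin k) (Fin (n + 1)) ℂ := Matrix.of fun x j => c * W j x.1 x.2
  have hcoeff : ∀ j, coeff M j = c • W j := fun j => by
    ext a b
    simp [coeff, M]
  have hkC : (k : ℂ) ≠ 0 := by exact_mod_cast hk.ne'
  have hcc : c * star c = (k : ℂ)⁻¹ := by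
    rw [hc, Complex.star_def, Complex.conj_ofReal, ← Complex.ofReal_mul, div_mul_div_comm,
      Real.mul_self_sqrt (Nat.cast_nonneg _)]
    simp
  have hself : ∀ j, W j * (W j)ᴴ = 1 ∧ (W j)ᴴ * W j = 1 := by
    intro j
    refine Fin.cases ?_ (fun i => ?_) j
    · simp [W]
    · simp [W, hJ.1, hJ.2]
  have hcross : ∀ i j, i ≠ j → W i * (W j)ᴴ = -(W j * (W i)ᴴ) ∧
      (W i)ᴴ * W j = -((W j)ᴴ * W i) := by
    intro i j
    refine Fin.cases ?_ (fun i => ?_) i <;> refine Fin.cases ?_ (fun j => ?_) j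
    · intro h
      exact absurd rfl h
    · intro _
      simp [W, hJ.1]
    · intro _
      simp [W, hJ.1]
    · intro h
      have hij : i ≠ j := fun e => h (by rw [e])
      simp [W, hJ.1, hJ.3 i j hij]
  have hgram : ∀ i j, coeff M i * (coeff M j)ᴴ = (k : ℂ)⁻¹ • (W i * (W j)ᴴ) := fun i j => by
    rw [hcoeff, hcoeff, Matrix.conjTranspose_smul, Matrix.smul_mul, Matrix.mul_smul, smul_smul,
      hcc]
  have hgram' : ∀ i j, (coeff M i)ᴴ * coeff M j = (k : ℂ)⁻¹ • ((W i)ᴴ * W j) := fun i j => by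
    rw [hcoeff, hcoeff, Matrix.conjTranspose_smul, Matrix.smul_mul, Matrix.mul_smul, smul_smul,
      mul_comm, hcc]
  have hfam : IsMaskFamily (coeff M) ((k : ℂ)⁻¹ • 1) ((k : ℂ)⁻¹ • 1) := by
    refine ⟨fun j => ?_, fun j => ?_, fun i j hij => ?_, fun i j hij => ?_⟩
    · rw [hgram, (hself j).1]
    · rw [hgram', (hself j).2]
    · rw [hgram, hgram, (hcross i j hij).1, smul_neg]
    · rw [hgram', hgram', (hcross i j hij).2, smul_neg]
  have htrW : ∀ i j, i ≠ j → (W i * (W j)ᴴ).trace = 0 := by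
    intro i j
    refine Fin.cases ?_ (fun i => ?_) i <;> refine Fin.cases ?_ (fun j => ?_) j
    · intro h
      exact absurd rfl h
    · intro _
      simp [W, hJ.1, htr]
    · intro _
      simp [W, htr]
    · intro h
      have hij : i ≠ j := fun e => h (by rw [e])
      have h1 : (J i * J j).trace = -(J i * J j).trace := by
        conv_lhs => rw [hJ.3 i j hij, Matrix.trace_neg, Matrix.trace_mul_comm]
      simp [W, hJ.1, self_eq_neg.1 h1]
  have hM : Mᴴ * M = 1 := by
    ext i j
    rw [← gram_coeff, hgram, Matrix.trace_smul]
    rcases eq_or_ne i j with rfl | hij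
    · rw [(hself i).1, Matrix.trace_one, Fintype.card_fin, smul_eq_mul, inv_mul_cancel₀ hkC,
        Matrix.one_apply_eq]
    · rw [htrW j i hij.symm, smul_zero, Matrix.one_apply_ne hij]
  have hmask := hfam.isMasker hM
  refine ⟨M, hmask, ?_, fun hreal => ⟨hmask, fun ρ hρ => ⟨⟨?_, ?_⟩, fun x y => ?_⟩⟩⟩
  · rw [ketBra_stdMaxEntangled, hcoeff, uniformCoeff, Fintype.card_fin]
    rfl
  · exact hρ.1.1.mul_mul_conjTranspose_same M
  · rw [Matrix.trace_mul_comm, ← Matrix.mul_assoc, hM, Matrix.one_mul, hρ.1.2]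
  · have hMim : ∀ x j, (M x j).im = 0 := by
      intro x j
      have hW : (W j x.1 x.2).im = 0 := by
        refine Fin.cases ?_ (fun i => ?_) j
        · simp only [W, Fin.cons_zero, Matrix.one_apply]
          split_ifs <;> simp
        · simpa [W] using hreal i x.1 x.2
      simp only [M, Matrix.of_apply, Complex.mul_im, hW, hc, Complex.ofReal_im, zero_mul, mul_zero,
        add_zero]
    simp only [Matrix.mul_apply, Matrix.conjTranspose_apply, Complex.im_sum, Complex.mul_im,
      Complex.star_def, Complex.conj_im, Complex.conj_re, hMim, hρ.2, mul_zero, zero_mul, neg_zero,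
      add_zero, Finset.sum_const_zero]

/-- The exponent is at least one so that the family has at least three members: each then
anticommutes with another and is traceless. In dimension one the only generator is the scalar `i`,
whose trace is nonzero, which is why Schmidt rank 2 is needed for `d = 2`. -/
theorem exists_complex_masker (hn : 1 ≤ n) :
    ∃ M : Matrix (Fin (max (kappa (n + 1)) 2) × Fin (max (kappa (n + 1)) 2)) (Fin (n + 1)) ℂ,
      IsMasker (realStates (Fin (n + 1))) M ∧
      pureOp (coeff M 0) = ketBra (stdMaxEntangled (max (kappa (n + 1)) 2)) := by
  have hk : max (kappa (n + 1)) 2 = 2 ^ max (n / 2) 1 := by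
    rw [kappa, Nat.add_sub_cancel]
    exact ((pow_right_mono₀ (by norm_num : 1 ≤ 2)).map_max (a := n / 2) (b := 1)).symm
  rw [hk]
  obtain ⟨J, hJ⟩ := hasClifford_complex (max (n / 2) 1)
  have htr : ∀ i, (J i).trace = 0 := by
    intro i
    obtain ⟨j, hj⟩ : ∃ j, i ≠ j := by
      have : Nontrivial (Fin (2 * max (n / 2) 1 + 1)) := Fin.nontrivial_iff_two_le.2 (by omega)
      exact (exists_ne i).imp fun j hj => hj.symm
    have h1 : (J i).trace = -(J i * (J j * J j)).trace := by
      rw [hJ.2, Matrix.mul_neg, Matrix.trace_neg, neg_neg, Matrix.mul_one]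
    have h2 : (J i * (J j * J j)).trace = -(J i * (J j * J j)).trace := by
      conv_lhs => rw [← Matrix.mul_assoc, hJ.3 i j hj, Matrix.neg_mul, Matrix.trace_neg,
        Matrix.mul_assoc, Matrix.trace_mul_comm, Matrix.mul_assoc]
    rw [h1, neg_eq_zero]
    exact self_eq_neg.1 h2
  let f : Fin n ↪ Fin (2 * max (n / 2) 1 + 1) := Fin.castLEEmb (by omega)
  obtain ⟨M, h1, h2, -⟩ := exists_masker (by positivity) (hJ.comp f) fun i => htr _
  exact ⟨M, h1, h2⟩

/-- Real skew-symmetric generators are traceless, so no lower bound on the dimension beyond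
`kappaReal` is required. -/
theorem exists_real_masker (n : ℕ) :
    ∃ M : Matrix (Fin (kappaReal (n + 1)) × Fin (kappaReal (n + 1))) (Fin (n + 1)) ℂ,
      IsRealMasker (realStates (Fin (n + 1))) M ∧
      pureOp (coeff M 0) = ketBra (stdMaxEntangled (kappaReal (n + 1))) := by
  have h := hasClifford_kappaReal (R := ℝ) (d := n + 1) (by omega)
  rw [Nat.add_sub_cancel] at h
  obtain ⟨J, hJ⟩ := h
  have hstar : ∀ i, (Complex.ofRealHom.mapMatrix (J i))ᴴ = Complex.ofRealHom.mapMatrix (J i)ᴴ := by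
    intro i
    ext a b
    simp
  have hJC : IsCliffordFamily fun i => Complex.ofRealHom.mapMatrix (J i) := by
    refine ⟨fun i => ?_, fun i => ?_, fun i j hij => ?_⟩
    · rw [hstar, hJ.1, map_neg]
    · rw [← map_mul, hJ.2, map_neg, map_one]
    · rw [← map_mul, hJ.3 i j hij, map_neg, map_mul]
  have htr : ∀ i, (J i).trace = 0 := fun i => by
    have h1 := congrArg Matrix.trace (hJ.1 i)
    rw [Matrix.trace_conjTranspose, Matrix.trace_neg, star_trivial] at h1
    exact self_eq_neg.1 h1
  obtain ⟨M, -, h2, h3⟩ := exists_masker (kappaReal_pos _) hJC fun i => by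
    exact (AddMonoidHom.map_trace Complex.ofRealHom (J i)).symm.trans (by rw [htr, map_zero])
  exact ⟨M, h3 fun i a b => by simp, h2⟩

theorem IsMaxEntangled.isDensity {k : ℕ} (hk : 0 < k) {Φ : Fin m × Fin m' → ℂ}
    (hΦ : IsMaxEntangled k Φ) : IsDensity (ketBra Φ) := by
  obtain ⟨u, v, hu, hv, h⟩ := hΦ.exists_coeff
  rw [h]
  refine isDensity_pureOp ?_
  have hvv : vᵀ * vᵀᴴ = 1 := by
    have h := congrArg Matrix.transpose hv
    rw [Matrix.transpose_mul, Matrix.transpose_one] at h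
    exact h
  have hkC : (k : ℂ) ≠ 0 := by exact_mod_cast hk.ne'
  rw [Matrix.conjTranspose_smul, Matrix.smul_mul, Matrix.mul_smul, Matrix.conjTranspose_mul,
    ← Matrix.mul_assoc, Matrix.mul_assoc u, hvv, Matrix.mul_one, smul_smul, Matrix.trace_smul,
    Matrix.trace_mul_comm, hu, Matrix.trace_one, Fintype.card_fin, Complex.star_def,
    Complex.conj_ofReal, ← Complex.ofReal_mul, div_mul_div_comm,
    Real.mul_self_sqrt (Nat.cast_nonneg _)]
  simp [hkC]

/-- A masker attains the entanglement of masking if its pure outputs are maximally entangled and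
every other masker of the same class yields at least that entanglement. -/
theorem isLeast_maskerEntanglement {E : BipartiteFunctional} (hE : IsEntanglementMonotone E)
    (hS : realPureStates (Fin (n + 1)) ⊆ S) (hS' : S ⊆ realStates (Fin (n + 1)))
    {P : ∀ {m m' : ℕ}, Matrix (Fin m × Fin m') (Fin (n + 1)) ℂ → Prop}
    (hP : ∀ {m m' : ℕ} {M : Matrix (Fin m × Fin m') (Fin (n + 1)) ℂ}, P M → IsMasker S M)
    {k : ℕ} (hk : 0 < k)
    (hreach : ∀ {m m' : ℕ} {M : Matrix (Fin m × Fin m') (Fin (n + 1)) ℂ}, P M →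
      ∀ {l l' : ℕ} {Φ : Fin l × Fin l' → ℂ}, IsMaxEntangled k Φ →
        LOCCReach (pureOp (coeff M 0)) (ketBra Φ))
    {M₀ : Matrix (Fin k × Fin k) (Fin (n + 1)) ℂ} (hM₀ : P M₀)
    (hstd : pureOp (coeff M₀ 0) = ketBra (stdMaxEntangled k))
    {l l' : ℕ} {Φ : Fin l × Fin l' → ℂ} (hΦ : IsMaxEntangled k Φ) :
    (∀ (m m' : ℕ) (M : Matrix (Fin m × Fin m') (Fin (n + 1)) ℂ), P M →
      ∃ x, MaskerEntanglementEq E S M x) ∧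
    IsLeast {x | ∃ (m m' : ℕ) (M : Matrix (Fin m × Fin m') (Fin (n + 1)) ℂ),
      P M ∧ MaskerEntanglementEq E S M x} (E l l' (ketBra Φ)) := by
  have hle : ∀ {m m' : ℕ} {M : Matrix (Fin m × Fin m') (Fin (n + 1)) ℂ}, P M →
      E l l' (ketBra Φ) ≤ E m m' (pureOp (coeff M 0)) := fun hM =>
    hE.le_of_reach (isDensity_pureOp (trace_coeff (hP hM).1 0)) (hreach hM hΦ)
  refine ⟨fun m m' M hM => ⟨_, (hP hM).maskerEntanglementEq hE hS hS'⟩, ⟨k, k, M₀, hM₀, ?_⟩, ?_⟩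
  · have h := (hP hM₀).maskerEntanglementEq hE hS hS'
    -- The output of `M₀` is the standard maximally entangled state, which is interconvertible with
    -- `Φ`; a monotone therefore takes the same value on both.
    rwa [← (hle hM₀).antisymm (hstd ▸ hE.le_of_reach (hΦ.isDensity hk) (hΦ.reach_std hk))] at h
  · rintro x ⟨m, m', M, hM, hx⟩
    rw [hx.unique ((hP hM).maskerEntanglementEq hE hS hS')]
    exact hle hM

theorem maskingEntanglementEq {E : BipartiteFunctional} (hE : IsEntanglementMonotone E)
    (hn : 1 ≤ n) (hS : realPureStates (Fin (n + 1)) ⊆ S) (hS' : S ⊆ realStates (Fin (n + 1)))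
    {l l' : ℕ} {Φ : Fin l × Fin l' → ℂ} (hΦ : IsMaxEntangled (max (kappa (n + 1)) 2) Φ) :
    MaskingEntanglementEq E S (E l l' (ketBra Φ)) := by
  obtain ⟨M₀, hM₀, hstd⟩ := exists_complex_masker hn
  exact isLeast_maskerEntanglement hE hS hS' (P := fun M => IsMasker S M) id (by positivity)
    (fun hM => (hM.mono hS).reach_maxEntangled hn) (hM₀.mono hS') hstd hΦ

theorem realMaskingEntanglementEq {E : BipartiteFunctional} (hE : IsEntanglementMonotone E)
    (hS : realPureStates (Fin (n + 1)) ⊆ S) (hS' : S ⊆ realStates (Fin (n + 1)))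
    {l l' : ℕ} {Φ : Fin l × Fin l' → ℂ} (hΦ : IsMaxEntangled (kappaReal (n + 1)) Φ) :
    RealMaskingEntanglementEq E S (E l l' (ketBra Φ)) := by
  obtain ⟨M₀, hM₀, hstd⟩ := exists_real_masker n
  exact isLeast_maskerEntanglement hE hS hS' (P := fun M => IsRealMasker S M) (fun h => h.1)
    (kappaReal_pos _) (fun hM => (hM.mono hS).reach_maxEntangled) (hM₀.mono hS') hstd hΦ

/-! ### Values for the entanglement cost -/

theorem entanglementCost_stdMaxEntangled_of_eq {k p : ℕ} (h : k = 2 ^ p) :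
    entanglementCost k k (ketBra (stdMaxEntangled k)) = p := by
  rw [h, entanglementCost_stdMaxEntangled]

theorem max_kappa_two {d : ℕ} (hd : 2 ≤ d) :
    max (kappa d) 2 = 2 ^ (if d = 2 then 1 else (d - 1) / 2) := by
  unfold kappa
  split_ifs with h
  · simp [h]
  · exact max_eq_left (le_self_pow₀ one_le_two (by omega))

theorem kappaReal_eq (d : ℕ) :
    kappaReal d = 2 ^ (if d % 8 = 0 ∨ d % 8 = 1 ∨ d % 8 = 7 then (d - 1) / 2
      else (d - 1) / 2 + 1) := by
  unfold kappaReal kappa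
  split_ifs
  · rfl
  · rw [pow_succ, mul_comm]

theorem maskingEntanglementEq_entanglementCost (hn : 1 ≤ n)
    (hS : realPureStates (Fin (n + 1)) ⊆ S) (hS' : S ⊆ realStates (Fin (n + 1))) :
    MaskingEntanglementEq entanglementCost S
      (if n + 1 = 2 then 1 else (((n + 1 - 1) / 2 : ℕ) : ℝ)) := by
  have h := maskingEntanglementEq isEntanglementMonotone_entanglementCost hn hS hS'
    (isMaxEntangled_stdMaxEntangled _)
  rw [entanglementCost_stdMaxEntangled_of_eq (max_kappa_two (by omega))] at h
  convert h using 1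
  split_ifs <;> simp

theorem realMaskingEntanglementEq_entanglementCost
    (hS : realPureStates (Fin (n + 1)) ⊆ S) (hS' : S ⊆ realStates (Fin (n + 1))) :
    RealMaskingEntanglementEq entanglementCost S
      (if (n + 1) % 8 = 0 ∨ (n + 1) % 8 = 1 ∨ (n + 1) % 8 = 7 then (((n + 1 - 1) / 2 : ℕ) : ℝ)
        else (((n + 1 - 1) / 2 : ℕ) : ℝ) + 1) := by
  have h := realMaskingEntanglementEq isEntanglementMonotone_entanglementCost hS hS'
    (isMaxEntangled_stdMaxEntangled _)
  rw [entanglementCost_stdMaxEntangled_of_eq (kappaReal_eq _)] at h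
  convert h using 1
  split_ifs <;> simp

end Masking

end

end RealMasking

theorem corollary7 (d : ℕ) (hd : 2 ≤ d) :
    (∀ E : BipartiteFunctional, IsEntanglementMonotone E →
      (∀ (m n : ℕ) (Φ : Fin m × Fin n → ℂ), IsMaxEntangled (max (kappa d) 2) Φ →
        MaskingEntanglementEq E (realStates (Fin d)) (E m n (ketBra Φ)) ∧
        MaskingEntanglementEq E (realPureStates (Fin d)) (E m n (ketBra Φ))) ∧
      (∀ (m n : ℕ) (Φ : Fin m × Fin n → ℂ), IsMaxEntangled (kappaReal d) Φ →
        RealMaskingEntanglementEq E (realStates (Fin d)) (E m n (ketBra Φ)) ∧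
        RealMaskingEntanglementEq E (realPureStates (Fin d)) (E m n (ketBra Φ)))) ∧
    MaskingEntanglementEq entanglementCost (realStates (Fin d))
      (if d = 2 then 1 else (((d - 1) / 2 : ℕ) : ℝ)) ∧
    MaskingEntanglementEq entanglementCost (realPureStates (Fin d))
      (if d = 2 then 1 else (((d - 1) / 2 : ℕ) : ℝ)) ∧
    RealMaskingEntanglementEq entanglementCost (realStates (Fin d))
      (if d % 8 = 0 ∨ d % 8 = 1 ∨ d % 8 = 7 then (((d - 1) / 2 : ℕ) : ℝ)
        else (((d - 1) / 2 : ℕ) : ℝ) + 1) ∧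
    RealMaskingEntanglementEq entanglementCost (realPureStates (Fin d))
      (if d % 8 = 0 ∨ d % 8 = 1 ∨ d % 8 = 7 then (((d - 1) / 2 : ℕ) : ℝ)
        else (((d - 1) / 2 : ℕ) : ℝ) + 1) := by
  obtain ⟨n, rfl⟩ : ∃ n, d = n + 1 := ⟨d - 1, by omega⟩
  have hn : 1 ≤ n := by omega
  -- The results above hold for any set between the real pure states and the real states; the two
  -- sets in question are the extremes.
  have hsub : realPureStates (Fin (n + 1)) ⊆ realStates (Fin (n + 1)) := fun _ h => h.1
  refine ⟨fun E hE => ⟨fun _ _ Φ hΦ => ⟨?_, ?_⟩, fun _ _ Φ hΦ => ⟨?_, ?_⟩⟩, ?_, ?_, ?_, ?_⟩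
  · exact maskingEntanglementEq hE hn hsub subset_rfl hΦ
  · exact maskingEntanglementEq hE hn subset_rfl hsub hΦ
  · exact realMaskingEntanglementEq hE hsub subset_rfl hΦ
  · exact realMaskingEntanglementEq hE subset_rfl hsub hΦ
  · exact maskingEntanglementEq_entanglementCost hn hsub subset_rfl
  · exact maskingEntanglementEq_entanglementCost hn subset_rfl hsub
  · exact realMaskingEntanglementEq_entanglementCost hsub subset_rfl
  · exact realMaskingEntanglementEq_entanglementCost subset_rfl hsub
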